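/- **Setting.** Let $\mathcal G$ be a directed graph without self-loops on $\{1,\dots,N\}$, $N\ge1$; let $\mathcal V_i=\{j:(j,i)\in\mathcal E\}$, listed in ascending order $j_1<\dots<j_{p_i}$, let $p_i=|\mathcal V_i|$ be the in-degree and $q_i$ the out-degree of node $i$. Let $0=t_0<t_1<\dots$, $t_k\to\infty$, be sampling instants, put $t_k=0$ for $k<0$, and assume that $\tau_i=\sup_{k\ge0}(t_{k+1}-t_{k-p_i+1})$ is finite for all $i$; $\tau=\max_i\tau_i$. Let $\Pi\{j_1,\dots,j_p\}=\{j_p,j_1,\dots,j_{p-1}\}$ and let $\nu_j=\nu_j^{k,i}\in\{1,\dots,p_i\}$ be the position of $j$ in $\Pi^k(\mathcal V_i)$. Consider the plant and measurements $$\dot x=Ax+B_2w,\quad x(t)=x_0\ (t\le0),\qquad y_i=C_ix+D_{2i}w+\bar D_{2i}v_i,$$ with $x(t)\in\mathbf R^n$, $\xi_i=[w'\ v_i']'\in L_2[0,\infty)$, $\xi=[\xi_1'\dots\xi_N']'$, and the observers, for $t\in[t_k,t_{k+1})$, $k\ge 0$, $$\dot{\hat x}_i=A\hat x_i+L_i(y_i-C_i\hat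 x_i)+K_i\sum_{j\in\mathcal V_i}H_i\bigl(\hat x_j(t_{k-\nu_j+1})-\hat x_i(t_{k-\nu_j+1})\bigr),\quad \hat x_i(t)=0\ (t\le0).$$ With $B=[B_2\ 0]$, $D_i=[D_{2i}\ \bar D_{2i}]$, the errors $e_i=x-\hat x_i$ satisfy on $[t_k,t_{k+1})$ $$\dot e_i=(A-L_iC_i)e_i+(B-L_iD_i)\xi_i+K_iH_i\sum_{j\in\mathcal V_i}\bigl(e_j(t_{k-\nu_j+1})-e_i(t_{k-\nu_j+1})\bigr).\tag{1}$$ Differential equations are understood in the Carathéodory sense. Let $J(\xi)=\frac1N\int_0^\infty\sum_i\sum_{j\in\mathcal V_i}\|\hat x_j-\hat x_i\|^2dt$. **Problem.** Given $\gamma>0$, the gains $K_i,L_i$ *solve the estimation problem with the matrix $P=P'>0$* if (i) (1) with $\xi=0$ is exponentially stable, i.e. there are $M,\lambda>0$ such that for every $s_0\ge0$ and every solution of (1) with $\xi=0$ on $[s_0,\infty)$ with a history satisfying $\|e_j(s)\|\le\beta$ for all $j$ and $s\in[s_0-\tau,s_0]$, one has $\|e_i(t)\|\le Me^{-\lambda(t-s_0)}\beta$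 for all $i$ and $t\ge s_0$; and (ii) $$\sup_{(x_0,\xi)\ne0}\frac{J(\xi)}{x_0'Px_0+\frac1N\|\xi\|_2^2}\le\gamma^2 .$$ **Matrices.** Let $Y_i,X_i,Z_i,Q_i,W_i,S_i,R_i,G_i$ be real $n\times n$ matrices and $\alpha_i,\pi_i$ real numbers. Let $\Psi_i$ be the matrix of $(p_i+1)\times(p_i+1)$ blocks with diagonal blocks $R_i$ and all other blocks $\frac12(G_i+G_i')$; let $T_i$ map $(z_0,\dots,z_{p_i+1})$, $z_\nu\in\mathbf R^n$, to $(z_0-z_1,z_1-z_2,\dots,z_{p_i}-z_{p_i+1})$; let $\bar\Psi_i=e^{-2\alpha_i\tau_i}T_i'\Psi_iT_i$, partitioned into $3\times3$ blocks of sizes $n,p_in,n$; let $\tilde\Psi_{i,11}=\bar\Psi_{i,11}-2\alpha_iY_i^{-1}-S_i$, $\tilde\Psi_{i,33}=\bar\Psi_{i,33}+e^{-2\alpha_i\tau_i}S_i$ and $\tilde\Psi_{i,\mu\nu}=\bar\Psi_{i,\mu\nu}$ otherwise. Let $\bar\Phi_{i,11}$ and $\bar\Phi_{i,22}$ be block diagonal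 with blocks $\pi_{j_\nu}Y_{j_\nu}^{-1}+\frac{\pi^2}4W_{j_\nu}$ and $\frac{\pi^2}4W_{j_\nu}$, $\nu=1,\dots,p_i$, and $\bar\Phi_{i,12}=-\bar\Phi_{i,22}$. With $\mathbf 1=\mathbf 1_{p_i}$ the column of ones and $\bar A_i=A-L_iC_i$, $\bar B_i=B-L_iD_i$, let $\Xi_i$ be the symmetric matrix $$\Xi_i=\begin{bmatrix} \Xi_{aa}&\Xi_{ab}&-Z_i'(\mathbf 1'\otimes K_iH_i)&0&0&\mathbf 1'\otimes(-Q_i+Z_i'K_iH_i)&Z_i'\bar B_i\\ \star&\Xi_{bb}&-\tilde\Psi_{i,12}-\mathbf 1'\otimes X_i'K_iH_i&-\tilde\Psi_{i,13}&-\frac1{\gamma^2}\mathbf 1'\otimes I&\mathbf 1'\otimes(X_i'K_iH_i+\bar A_i'Q_i)&X_i'\bar B_i\\ \star&\star&-\tilde\Psi_{i,22}&-\tilde\Psi_{i,23}&0&-\mathbf 1\mathbf 1'\otimes H_i'K_i'Q_i&0\\ \star&\star&\star&-\tilde\Psi_{i,33}&0&0&0\\ \star&\star&\star&\star&-\bar\Phi_{i,11}&-\bar\Phi_{i,12}&0\\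 \star&\star&\star&\star&\star&\Xi_{ff}&\mathbf 1\otimes Q_i'\bar B_i\\ \star&\star&\star&\star&\star&\star&-I\end{bmatrix},$$ $\Xi_{aa}=\tau_i^2R_i+\bigl(\sum_{j:\,i\in\mathcal V_j}\tau_j^2\bigr)W_i-Z_i-Z_i'$, $\ \Xi_{ab}=Y_i^{-1}-X_i+Z_i'\bar A_i$, $\ \Xi_{bb}=\frac{p_i+q_i}{\gamma^2}I-\tilde\Psi_{i,11}+X_i'\bar A_i+\bar A_i'X_i$, $\ \Xi_{ff}=\mathbf 1\mathbf 1'\otimes(Q_i'K_iH_i+H_i'K_i'Q_i)-\bar\Phi_{i,22}$. **Theorem.** Let $\gamma>0$. Suppose that matrices $Y_i=Y_i'>0$, $X_i$, $Z_i$, $Q_i$, $W_i=W_i'\ge0$, $S_i=S_i'\ge0$, $R_i=R_i'\ge0$, $G_i$, constants $\alpha_i>0$, $\pi_i\ge0$ with $q_i\pi_i<2\alpha_i$, and gains $K_i$, $L_i$ satisfy, for all $i=1,\dots,N$, $$\begin{bmatrix}R_i&G_i\\G_i'&R_i\end{bmatrix}\ge0,\qquad \Xi_i<0 .$$ Then the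 gains $K_i,L_i$ solve the estimation problem with the (positive definite) matrix $$P=\frac1N\sum_{i=1}^N\Bigl(Y_i^{-1}+\frac{1-e^{-2\alpha_i\tau_i}}{2\alpha_i}S_i\Bigr).$$ -/

import Mathlib

open MeasureTheory Matrix Set
open scoped Kronecker ENNReal

namespace RoundRobin

noncomputable section

/-- The Euclidean norm of a plain coordinate vector. -/
def eucl {ι : Type} [Fintype ι] (v : ι → ℝ) : ℝ := ‖WithLp.toLp 2 v‖

/-! ### Graph and round-robin ordering -/

/-- The neighbourhood of `i`: the nodes `j` with an edge from `j` to `i`. -/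
def nbhd {N : ℕ} (G : Digraph (Fin N)) (i : Fin N) : Finset (Fin N) :=
  open scoped Classical in Finset.univ.filter fun j => G.Adj j i

/-- The in-degree `p_i`. -/
def inDeg {N : ℕ} (G : Digraph (Fin N)) (i : Fin N) : ℕ := (nbhd G i).card

/-- The nodes that receive information from `i`. -/
def outNbhd {N : ℕ} (G : Digraph (Fin N)) (i : Fin N) : Finset (Fin N) :=
  Finset.univ.filter fun j => i ∈ nbhd G j

/-- The out-degree `q_i`. -/
def outDeg {N : ℕ} (G : Digraph (Fin N)) (i : Fin N) : ℕ := (outNbhd G i).card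

/-- The neighbours of `i` in ascending order. -/
def nbr {N : ℕ} (G : Digraph (Fin N)) (i : Fin N) (ν : Fin (inDeg G i)) : Fin N :=
  (nbhd G i).orderEmbOfFin rfl ν

/-- The shift permutation `{j₁, …, j_{p-1}, j_p} ↦ {j_p, j₁, …, j_{p-1}}`. -/
def shiftPerm {V : Type} (l : List V) : List V := l.rotateRight 1

/-- The ordered neighbourhood of `i` (ascending order) after `k` shift permutations. -/
def pollOrder {N : ℕ} (G : Digraph (Fin N)) (i : Fin N) (k : ℕ) : List (Fin N) :=
  shiftPerm^[k] ((nbhd G i).sort (· ≤ ·))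

/-- The index, counted from one, of `j` in the ordered neighbourhood of `i` after `k` shifts. -/
def pollIndex {N : ℕ} (G : Digraph (Fin N)) (i : Fin N) (k : ℕ) (j : Fin N) : ℕ :=
  (pollOrder G i k).idxOf j + 1

/-! ### Plant, measurements, sampling instants -/

/-- The data of the plant, of the measurements, of the communication graph and of the sampling
schedule; `r i` is the dimension of the `i`-th measurement and `h i` the number of rows of `H i`. -/
structure Network (N n mw mv : ℕ) where
  graph : Digraph (Fin N)
  loopless : ∀ i, ¬ graph.Adj i i
  A : Matrix (Fin n) (Fin n) ℝ
  B₂ : Matrix (Fin n) (Fin mw) ℝ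
  r : Fin N → ℕ
  C : ∀ i, Matrix (Fin (r i)) (Fin n) ℝ
  D₂ : ∀ i, Matrix (Fin (r i)) (Fin mw) ℝ
  Dbar₂ : ∀ i, Matrix (Fin (r i)) (Fin mv) ℝ
  h : Fin N → ℕ
  H : ∀ i, Matrix (Fin (h i)) (Fin n) ℝ
  t : ℕ → ℝ
  t_zero : t 0 = 0
  t_strictMono : StrictMono t
  t_tendsto : Filter.Tendsto t Filter.atTop Filter.atTop

variable {N n mw mv : ℕ}

namespace Network

/-- Sampling instants with integer index. No sampling takes place before time zero, where all
signals are constant, so instants of negative index are placed at `t₀ = 0`. -/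
def tExt (S : Network N n mw mv) (k : ℤ) : ℝ := S.t k.toNat

/-- The in-degree `p_i`. -/
abbrev p (S : Network N n mw mv) (i : Fin N) : ℕ := inDeg S.graph i

/-- The out-degree `q_i`. -/
abbrev q (S : Network N n mw mv) (i : Fin N) : ℕ := outDeg S.graph i

/-- The times between consecutive polls of a channel of node `i`, `t_{k+1} - t_{k-p_i+1}`. -/
def pollGap (S : Network N n mw mv) (i : Fin N) (k : ℕ) : ℝ :=
  S.t (k + 1) - S.tExt ((k : ℤ) - (S.p i : ℤ) + 1)

/-- The maximum communication delay `τ_i` at node `i`. -/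
def τ (S : Network N n mw mv) (i : Fin N) : ℝ := ⨆ k : ℕ, S.pollGap i k

/-- The largest communication delay in the network. -/
def τmax (S : Network N n mw mv) : ℝ := ⨆ i : Fin N, S.τ i

/-- The instant `t_{k-ν+1}` at which the sample of channel `j → i` in use on `[t_k, t_{k+1})`
was taken, `ν` being the index of `j` in the current polling order of node `i`. -/
def sampleTime (S : Network N n mw mv) (i : Fin N) (k : ℕ) (j : Fin N) : ℝ :=
  S.tExt ((k : ℤ) - (pollIndex S.graph i k j : ℤ) + 1)

/-- `B = [B₂ 0]`. -/
def B (S : Network N n mw mv) : Matrix (Fin n) (Fin mw ⊕ Fin mv) ℝ := fromCols S.B₂ 0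

/-- `D_i = [D₂ᵢ D̄₂ᵢ]`. -/
def D (S : Network N n mw mv) (i : Fin N) : Matrix (Fin (S.r i)) (Fin mw ⊕ Fin mv) ℝ :=
  fromCols (S.D₂ i) (S.Dbar₂ i)

end Network

/-- The gains of the observers: coupling gains `K i` and observer gains `L i`. -/
structure Gains (S : Network N n mw mv) where
  K : ∀ i, Matrix (Fin n) (Fin (S.h i)) ℝ
  L : ∀ i, Matrix (Fin n) (Fin (S.r i)) ℝ

/-! ### Trajectories -/

/-- The measurement `y_i = C_i x + D₂ᵢ w + D̄₂ᵢ v_i`. -/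
def measurement (S : Network N n mw mv) (x : ℝ → Fin n → ℝ) (w : ℝ → Fin mw → ℝ)
    (v : Fin N → ℝ → Fin mv → ℝ) (i : Fin N) (s : ℝ) : Fin (S.r i) → ℝ :=
  S.C i *ᵥ x s + S.D₂ i *ᵥ w s + S.Dbar₂ i *ᵥ v i s

/-- `x` and `xh` are the (Carathéodory) solutions of the plant equation with initial state `x₀`
and of the observer equations with zero initial state, under the disturbances `w`, `v`. -/
structure IsTrajectory (S : Network N n mw mv) (g : Gains S) (x₀ : Fin n → ℝ)
    (w : ℝ → Fin mw → ℝ) (v : Fin N → ℝ → Fin mv → ℝ)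
    (x : ℝ → Fin n → ℝ) (xh : Fin N → ℝ → Fin n → ℝ) : Prop where
  plant_cont : Continuous x
  plant_init : ∀ t ≤ 0, x t = x₀
  plant_eq : ∀ t, 0 ≤ t → x t = x₀ + ∫ s in (0 : ℝ)..t, (S.A *ᵥ x s + S.B₂ *ᵥ w s)
  obs_cont : ∀ i, Continuous (xh i)
  obs_init : ∀ i, ∀ t ≤ 0, xh i t = 0
  obs_eq : ∀ i, ∀ k : ℕ, ∀ t ∈ Icc (S.t k) (S.t (k + 1)),
    xh i t = xh i (S.t k) + ∫ s in (S.t k)..t,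
      (S.A *ᵥ xh i s + g.L i *ᵥ (measurement S x w v i s - S.C i *ᵥ xh i s)
        + g.K i *ᵥ ∑ j ∈ nbhd S.graph i,
            S.H i *ᵥ (xh j (S.sampleTime i k j) - xh i (S.sampleTime i k j)))

/-- `e` is a (Carathéodory) solution of the error dynamics on `[s₀, ∞)` under the perturbations
`ξ`; its values before `s₀` are the initial history and are unrestricted here. -/
structure IsErrorTrajectory (S : Network N n mw mv) (g : Gains S) (s₀ : ℝ)
    (ξ : Fin N → ℝ → Fin mw ⊕ Fin mv → ℝ) (e : Fin N → ℝ → Fin n → ℝ) : Prop where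
  cont : ∀ i, ContinuousOn (e i) (Ici s₀)
  eq : ∀ i, ∀ k : ℕ, ∀ a b : ℝ, s₀ ≤ a → S.t k ≤ a → a ≤ b → b ≤ S.t (k + 1) →
    e i b = e i a + ∫ s in a..b,
      ((S.A - g.L i * S.C i) *ᵥ e i s + (S.B - g.L i * S.D i) *ᵥ ξ i s
        + (g.K i * S.H i) *ᵥ ∑ j ∈ nbhd S.graph i,
            (e j (S.sampleTime i k j) - e i (S.sampleTime i k j)))

/-! ### The distributed estimation problem -/

/-- Uniform exponential stability of the unperturbed error dynamics: every solution that starts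
at a time `s₀ ≥ 0` from a history bounded by `β` on `[s₀ - τ, s₀]` decays exponentially, with
constants that depend neither on `s₀` nor on the solution. -/
def ExponentiallyStable (S : Network N n mw mv) (g : Gains S) : Prop :=
  ∃ M > (0 : ℝ), ∃ rate > (0 : ℝ), ∀ s₀ : ℝ, 0 ≤ s₀ → ∀ e : Fin N → ℝ → Fin n → ℝ,
    IsErrorTrajectory S g s₀ 0 e →
    ∀ β : ℝ, (∀ i, ∀ s ∈ Icc (s₀ - S.τmax) s₀, eucl (e i s) ≤ β) →
    ∀ i, ∀ t, s₀ ≤ t → eucl (e i t) ≤ M * Real.exp (-rate * (t - s₀)) * β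

/-- The cost of disagreement between the observers, with values in `[0, ∞]`. -/
def disagreement (S : Network N n mw mv) (xh : Fin N → ℝ → Fin n → ℝ) : ℝ≥0∞ :=
  (N : ℝ≥0∞)⁻¹ * ∫⁻ t in Ioi (0 : ℝ),
    ∑ i, ∑ j ∈ nbhd S.graph i, ENNReal.ofReal (eucl (xh j t - xh i t) ^ 2)

/-- The perturbation `ξ_i = [w' v_i']'`. -/
def pert (w : ℝ → Fin mw → ℝ) (v : Fin N → ℝ → Fin mv → ℝ) (i : Fin N) (t : ℝ) :
    Fin mw ⊕ Fin mv → ℝ :=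
  Sum.elim (w t) (v i t)

/-- The squared `L₂` norm of `ξ = [ξ_1' … ξ_N']'`. -/
def pertNormSq (w : ℝ → Fin mw → ℝ) (v : Fin N → ℝ → Fin mv → ℝ) : ℝ≥0∞ :=
  ∫⁻ t in Ioi (0 : ℝ), ∑ i, ENNReal.ofReal (eucl (pert w v i t) ^ 2)

/-- The perturbations belong to `L₂[0, ∞)`. -/
def IsL2 (w : ℝ → Fin mw → ℝ) (v : Fin N → ℝ → Fin mv → ℝ) : Prop :=
  ∀ i, MemLp (pert w v i) 2 (volume.restrict (Ioi 0))

/-- `(x₀, ξ)` is not zero, `ξ` being regarded as an element of `L₂[0, ∞)`. -/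
def NonzeroInput (x₀ : Fin n → ℝ) (w : ℝ → Fin mw → ℝ) (v : Fin N → ℝ → Fin mv → ℝ) : Prop :=
  x₀ ≠ 0 ∨ ¬ ∀ᵐ t ∂(volume.restrict (Ioi (0 : ℝ))), ∀ i, pert w v i t = 0

/-- The guaranteed level of transient consensus performance. -/
def ConsensusPerformance (S : Network N n mw mv) (g : Gains S) (γ : ℝ)
    (P : Matrix (Fin n) (Fin n) ℝ) : Prop :=
  (⨆ (x₀ : Fin n → ℝ) (w : ℝ → Fin mw → ℝ) (v : Fin N → ℝ → Fin mv → ℝ)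
      (x : ℝ → Fin n → ℝ) (xh : Fin N → ℝ → Fin n → ℝ)
      (_ : IsL2 w v) (_ : NonzeroInput x₀ w v) (_ : IsTrajectory S g x₀ w v x xh),
    disagreement S xh /
      (ENNReal.ofReal (x₀ ⬝ᵥ P *ᵥ x₀) + (N : ℝ≥0∞)⁻¹ * pertNormSq w v))
    ≤ ENNReal.ofReal (γ ^ 2)

/-- The gains `g` solve the distributed estimation problem with performance level `γ` and
weight `P` of the initial state. -/
structure SolvesEstimationProblem (S : Network N n mw mv) (g : Gains S) (γ : ℝ)
    (P : Matrix (Fin n) (Fin n) ℝ) : Prop where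
  posDef : P.PosDef
  stable : ExponentiallyStable S g
  performance : ConsensusPerformance S g γ P

/-! ### The matrix inequalities -/

/-- The unknown matrices and constants of the matrix inequalities; `ϖ i` is the constant
`π_i`. -/
structure LMIVars (N n : ℕ) where
  (Y X Z Q W S R G : Fin N → Matrix (Fin n) (Fin n) ℝ)
  (α ϖ : Fin N → ℝ)

section Blocks

variable {p : ℕ}

/-- `1_p' ⊗ M`. -/
def rowRep {m m' : Type} (p : ℕ) (M : Matrix m m' ℝ) : Matrix m (Fin p × m') ℝ :=
  of fun a b => M a b.2

/-- `1_p ⊗ M`. -/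
def colRep {m m' : Type} (p : ℕ) (M : Matrix m m' ℝ) : Matrix (Fin p × m) m' ℝ :=
  of fun a b => M a.2 b

/-- `1_p 1_p' ⊗ M`. -/
def sqRep {m m' : Type} (p : ℕ) (M : Matrix m m' ℝ) : Matrix (Fin p × m) (Fin p × m') ℝ :=
  of fun a b => M a.2 b.2

/-- The block diagonal matrix with the blocks `M 0, …, M (p - 1)`. -/
def diagBlocks (M : Fin p → Matrix (Fin n) (Fin n) ℝ) :
    Matrix (Fin p × Fin n) (Fin p × Fin n) ℝ :=
  of fun a b => if a.1 = b.1 then M a.1 a.2 b.2 else 0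

/-- The symmetric block matrix whose lower left block is the transpose of the upper right one. -/
def symBlock {m m' : Type} (E : Matrix m m ℝ) (F : Matrix m m' ℝ) (D : Matrix m' m' ℝ) :
    Matrix (m ⊕ m') (m ⊕ m') ℝ :=
  fromBlocks E F Fᵀ D

/-- `(p+1) × (p+1)` blocks, `R` on the diagonal and `(G + G')/2` elsewhere. -/
def Psi (p : ℕ) (R G : Matrix (Fin n) (Fin n) ℝ) :
    Matrix (Fin (p + 1) × Fin n) (Fin (p + 1) × Fin n) ℝ :=
  of fun a b => if a.1 = b.1 then R a.2 b.2 else ((1 / 2 : ℝ) • (G + Gᵀ)) a.2 b.2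

/-- The matrix of successive differences, `(T z)_ν = z_ν - z_{ν+1}` for `ν = 0, …, p`, which maps
`(e_i(t), e_i(t_k), …, e_i(t_{k-p+1}), e_i(t-τ_i))` to
`(e_i(t) - e_i(t_k), …, e_i(t_{k-p+1}) - e_i(t-τ_i))`. -/
def T (p n : ℕ) : Matrix (Fin (p + 1) × Fin n) (Fin (p + 2) × Fin n) ℝ :=
  (of fun (a : Fin (p + 1)) (b : Fin (p + 2)) =>
    if b = a.castSucc then (1 : ℝ) else if b = a.succ then -1 else 0) ⊗ₖ
      (1 : Matrix (Fin n) (Fin n) ℝ)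

/-- First block of the partition `n, p n, n` of the index set of size `(p + 2) n`. -/
def blk₁ (p : ℕ) (a : Fin n) : Fin (p + 2) × Fin n := (0, a)

/-- Second block of the partition. -/
def blk₂ (p : ℕ) (a : Fin p × Fin n) : Fin (p + 2) × Fin n := (a.1.castSucc.succ, a.2)

/-- Third block of the partition. -/
def blk₃ (p : ℕ) (a : Fin n) : Fin (p + 2) × Fin n := (Fin.last (p + 1), a)

end Blocks

section Xi

variable (S : Network N n mw mv) (g : Gains S) (γ : ℝ) (V : LMIVars N n) (i : Fin N)

/-- `Ψ̄_i = e^{-2 α_i τ_i} T_i' Ψ_i T_i`. -/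
def PsiBar : Matrix (Fin (S.p i + 2) × Fin n) (Fin (S.p i + 2) × Fin n) ℝ :=
  Real.exp (-2 * V.α i * S.τ i) • ((T (S.p i) n)ᵀ * Psi (S.p i) (V.R i) (V.G i) * T (S.p i) n)

def PsiTilde₁₁ : Matrix (Fin n) (Fin n) ℝ :=
  (PsiBar S V i).submatrix (blk₁ _) (blk₁ _) - (2 * V.α i) • (V.Y i)⁻¹ - V.S i

def PsiTilde₁₂ : Matrix (Fin n) (Fin (S.p i) × Fin n) ℝ :=
  (PsiBar S V i).submatrix (blk₁ _) (blk₂ _)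

def PsiTilde₁₃ : Matrix (Fin n) (Fin n) ℝ :=
  (PsiBar S V i).submatrix (blk₁ _) (blk₃ _)

def PsiTilde₂₂ : Matrix (Fin (S.p i) × Fin n) (Fin (S.p i) × Fin n) ℝ :=
  (PsiBar S V i).submatrix (blk₂ _) (blk₂ _)

def PsiTilde₂₃ : Matrix (Fin (S.p i) × Fin n) (Fin n) ℝ :=
  (PsiBar S V i).submatrix (blk₂ _) (blk₃ _)

def PsiTilde₃₃ : Matrix (Fin n) (Fin n) ℝ :=
  (PsiBar S V i).submatrix (blk₃ _) (blk₃ _) + Real.exp (-2 * V.α i * S.τ i) • V.S i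

def PhiBar₁₁ : Matrix (Fin (S.p i) × Fin n) (Fin (S.p i) × Fin n) ℝ :=
  diagBlocks fun ν => V.ϖ (nbr S.graph i ν) • (V.Y (nbr S.graph i ν))⁻¹
    + (Real.pi ^ 2 / 4) • V.W (nbr S.graph i ν)

def PhiBar₂₂ : Matrix (Fin (S.p i) × Fin n) (Fin (S.p i) × Fin n) ℝ :=
  diagBlocks fun ν => (Real.pi ^ 2 / 4) • V.W (nbr S.graph i ν)

def PhiBar₁₂ : Matrix (Fin (S.p i) × Fin n) (Fin (S.p i) × Fin n) ℝ := -PhiBar₂₂ S V i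

def XiAA : Matrix (Fin n) (Fin n) ℝ :=
  (S.τ i ^ 2) • V.R i + (∑ j ∈ outNbhd S.graph i, S.τ j ^ 2) • V.W i - V.Z i - (V.Z i)ᵀ

def XiAB : Matrix (Fin n) (Fin n) ℝ :=
  (V.Y i)⁻¹ - V.X i + (V.Z i)ᵀ * (S.A - g.L i * S.C i)

def XiAC : Matrix (Fin n) (Fin (S.p i) × Fin n) ℝ :=
  -((V.Z i)ᵀ * rowRep (S.p i) (g.K i * S.H i))

def XiAF : Matrix (Fin n) (Fin (S.p i) × Fin n) ℝ :=
  rowRep (S.p i) (-V.Q i + (V.Z i)ᵀ * g.K i * S.H i)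

def XiAG : Matrix (Fin n) (Fin mw ⊕ Fin mv) ℝ :=
  (V.Z i)ᵀ * (S.B - g.L i * S.D i)

def XiBB : Matrix (Fin n) (Fin n) ℝ :=
  (((S.p i : ℝ) + (S.q i : ℝ)) / γ ^ 2) • (1 : Matrix (Fin n) (Fin n) ℝ) - PsiTilde₁₁ S V i
    + (V.X i)ᵀ * (S.A - g.L i * S.C i) + (S.A - g.L i * S.C i)ᵀ * V.X i

def XiBC : Matrix (Fin n) (Fin (S.p i) × Fin n) ℝ :=
  -PsiTilde₁₂ S V i - rowRep (S.p i) ((V.X i)ᵀ * g.K i * S.H i)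

def XiBE : Matrix (Fin n) (Fin (S.p i) × Fin n) ℝ :=
  -((1 / γ ^ 2) • rowRep (S.p i) (1 : Matrix (Fin n) (Fin n) ℝ))

def XiBF : Matrix (Fin n) (Fin (S.p i) × Fin n) ℝ :=
  rowRep (S.p i) ((V.X i)ᵀ * g.K i * S.H i + (S.A - g.L i * S.C i)ᵀ * V.Q i)

def XiBG : Matrix (Fin n) (Fin mw ⊕ Fin mv) ℝ :=
  (V.X i)ᵀ * (S.B - g.L i * S.D i)

def XiCF : Matrix (Fin (S.p i) × Fin n) (Fin (S.p i) × Fin n) ℝ :=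
  -sqRep (S.p i) ((S.H i)ᵀ * (g.K i)ᵀ * V.Q i)

def XiFF : Matrix (Fin (S.p i) × Fin n) (Fin (S.p i) × Fin n) ℝ :=
  sqRep (S.p i) ((V.Q i)ᵀ * g.K i * S.H i + (S.H i)ᵀ * (g.K i)ᵀ * V.Q i) - PhiBar₂₂ S V i

def XiFG : Matrix (Fin (S.p i) × Fin n) (Fin mw ⊕ Fin mv) ℝ :=
  colRep (S.p i) ((V.Q i)ᵀ * (S.B - g.L i * S.D i))

/-- The index set of `Ξ_i`, with the seven blocks `a, …, g`. -/
abbrev XiIndex : Type :=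
  Fin n ⊕ Fin n ⊕ (Fin (S.p i) × Fin n) ⊕ Fin n ⊕ (Fin (S.p i) × Fin n) ⊕
    (Fin (S.p i) × Fin n) ⊕ (Fin mw ⊕ Fin mv)

/-- The symmetric matrix `Ξ_i`, given by the diagonal block and the part to the right of the
diagonal of each of its seven block rows. -/
def Xi : Matrix (XiIndex S i) (XiIndex S i) ℝ :=
  symBlock (XiAA S V i)
    (fromCols (XiAB S g V i) <| fromCols (XiAC S g V i) <| fromCols 0 <| fromCols 0 <|
      fromCols (XiAF S g V i) (XiAG S g V i)) <|
  symBlock (XiBB S g γ V i)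
    (fromCols (XiBC S g V i) <| fromCols (-PsiTilde₁₃ S V i) <| fromCols (XiBE S γ i) <|
      fromCols (XiBF S g V i) (XiBG S g V i)) <|
  symBlock (-PsiTilde₂₂ S V i)
    (fromCols (-PsiTilde₂₃ S V i) <| fromCols 0 <| fromCols (XiCF S g V i) 0) <|
  symBlock (-PsiTilde₃₃ S V i)
    (fromCols 0 <| fromCols 0 0) <|
  symBlock (-PhiBar₁₁ S V i)
    (fromCols (-PhiBar₁₂ S V i) 0) <|
  symBlock (XiFF S g V i)
    (XiFG S g V i)
    (-1)

/-- `P = (1/N) ∑_i (Y_i⁻¹ + (1 - e^{-2 α_i τ_i}) / (2 α_i) S_i)`. -/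
def weightP : Matrix (Fin n) (Fin n) ℝ :=
  (1 / (N : ℝ)) • ∑ i, ((V.Y i)⁻¹ +
    ((1 - Real.exp (-2 * V.α i * S.τ i)) / (2 * V.α i)) • V.S i)

end Xi

end

end RoundRobin

/-! The proof attaches to the error system a Lyapunov–Krasovskii functional, `lyap`. Node i
contributes e_i'Y_i⁻¹e_i, a moving-window integral of e_i'S_ie_i and a double integral of
ė_i'R_iė_i. A channel j → i whose current sample was taken at time s contributes τ_i²∫ₛᵗ ė_j'W_jė_j
− (π²/4)∫ₛᵗ (e_j − e_j(s))'W_j(e_j − e_j(s)). A sample in use is never older than τ_i, so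
Wirtinger's inequality (`wirtinger`) makes the channel term nonnegative. The term drops to zero when
the sample is renewed, hence the functional is nonnegative and never jumps upwards (`lyap_succ_le`).

Between sampling instants its derivative is controlled by the forms Ξ_i. The energy of R_i over the
window [t − τ_i, t] dominates a quadratic form in the increments of e_i between successive sampling
instants (`reciprocally_convex`). The matrices X_i, Z_i, Q_i only multiply the residual of the error
equation, which vanishes along solutions (`bil_Xi`). After summation over the nodes the W terms
cancel by double counting of edges, the π_j terms are absorbed because q_jπ_j < 2α_j, and the γ⁻²
terms assemble into the disagreement. With Ξ_i ≤ −εI this gives (`lyapRate_le`) V̇ ≤ Σ|ξ_i|² − γ⁻² ·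
disagreement − ε Σ(|e_i|² + |ė_i|²).

Performance follows by integrating from time zero, where the constant history x₀ gives V(0) ≤ N
x₀'Px₀ (`lyap_zero_le`).

The weights e^{-2α_iτ_i} in the functional are constant in time, so exponential stability comes from
the ε term: V(t) is at most a constant times ∫(|e|² + |ė|²) over [t − h, t] (`exists_lyap_le`),
hence V contracts by a fixed factor over each step of length h (`exists_lyap_decay`). An arbitrary
history need not be absolutely continuous, so this applies only from s₀ + τ on, when every sample in
use was taken after s₀; before that a Gronwall-type bound (`IsErrorTrajectory.growth`) is enough. -/

namespace RoundRobin

noncomputable section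

/-! ### Bilinear forms of matrices -/

section Bilinear

variable {m m' : Type} [Fintype m'] [Fintype m]

/-- The bilinear form `u' M v`. -/
def bil (M : Matrix m m' ℝ) (u : m → ℝ) (v : m' → ℝ) : ℝ := u ⬝ᵥ M *ᵥ v

lemma bil_sub_left (M : Matrix m m' ℝ) (u u' : m → ℝ) (v : m' → ℝ) :
    bil M (u - u') v = bil M u v - bil M u' v := by simp [bil, sub_dotProduct]

lemma bil_neg_left (M : Matrix m m' ℝ) (u : m → ℝ) (v : m' → ℝ) :
    bil M (-u) v = -bil M u v := by simp [bil]

lemma bil_smul_left (M : Matrix m m' ℝ) (c : ℝ) (u : m → ℝ) (v : m' → ℝ) :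
    bil M (c • u) v = c * bil M u v := by simp [bil]

lemma bil_zero_left (M : Matrix m m' ℝ) (v : m' → ℝ) : bil M 0 v = 0 := by simp [bil]

lemma bil_sub_right (M : Matrix m m' ℝ) (u : m → ℝ) (v v' : m' → ℝ) :
    bil M u (v - v') = bil M u v - bil M u v' := by simp [bil, mulVec_sub]

lemma bil_neg_right (M : Matrix m m' ℝ) (u : m → ℝ) (v : m' → ℝ) :
    bil M u (-v) = -bil M u v := by simp [bil, mulVec_neg]

lemma bil_smul_right (M : Matrix m m' ℝ) (c : ℝ) (u : m → ℝ) (v : m' → ℝ) :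
    bil M u (c • v) = c * bil M u v := by simp [bil, mulVec_smul]

lemma bil_add (M M' : Matrix m m' ℝ) (u : m → ℝ) (v : m' → ℝ) :
    bil (M + M') u v = bil M u v + bil M' u v := by simp [bil, add_mulVec]

lemma bil_sub (M M' : Matrix m m' ℝ) (u : m → ℝ) (v : m' → ℝ) :
    bil (M - M') u v = bil M u v - bil M' u v := by simp [bil, sub_mulVec]

lemma bil_neg (M : Matrix m m' ℝ) (u : m → ℝ) (v : m' → ℝ) :
    bil (-M) u v = -bil M u v := by simp [bil, neg_mulVec]

lemma bil_smul (c : ℝ) (M : Matrix m m' ℝ) (u : m → ℝ) (v : m' → ℝ) :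
    bil (c • M) u v = c * bil M u v := by simp [bil, smul_mulVec]

lemma bil_zero (u : m → ℝ) (v : m' → ℝ) : bil (0 : Matrix m m' ℝ) u v = 0 := by simp [bil]

lemma bil_transpose (M : Matrix m m' ℝ) (u : m → ℝ) (v : m' → ℝ) :
    bil Mᵀ v u = bil M u v := by
  rw [bil, bil, dotProduct_comm, mulVec_transpose, dotProduct_mulVec]

lemma bil_mul {m'' : Type} [Fintype m''] (M : Matrix m m'' ℝ) (M' : Matrix m'' m' ℝ)
    (u : m → ℝ) (v : m' → ℝ) : bil (M * M') u v = bil M u (M' *ᵥ v) := by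
  simp [bil, mulVec_mulVec]

lemma bil_transpose_mul {m'' : Type} [Fintype m''] (M : Matrix m'' m ℝ) (M' : Matrix m'' m' ℝ)
    (u : m → ℝ) (v : m' → ℝ) : bil (Mᵀ * M') u v = (M *ᵥ u) ⬝ᵥ (M' *ᵥ v) := by
  rw [bil_mul, bil_transpose, bil, dotProduct_comm]

lemma bil_one [DecidableEq m] (u v : m → ℝ) : bil (1 : Matrix m m ℝ) u v = u ⬝ᵥ v := by
  simp [bil]

lemma bil_eq_sum (M : Matrix m m' ℝ) (u : m → ℝ) (v : m' → ℝ) :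
    bil M u v = ∑ a, ∑ b, M a b * (u a * v b) := by
  simp only [bil, dotProduct, mulVec, Finset.mul_sum]
  exact Finset.sum_congr rfl fun a _ => Finset.sum_congr rfl fun b _ => by ring

lemma bil_comm_of_isHermitian {M : Matrix m m ℝ} (hM : M.IsHermitian) (u v : m → ℝ) :
    bil M u v = bil M v u := by
  rw [← bil_transpose M u v]
  congr 1

lemma bil_self_nonneg {M : Matrix m m ℝ} (hM : M.PosSemidef) (u : m → ℝ) : 0 ≤ bil M u u := by
  simpa [bil] using hM.dotProduct_mulVec_nonneg u

lemma continuous_bil (M : Matrix m m' ℝ) {X : Type*} [TopologicalSpace X] {u : X → m → ℝ}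
    {v : X → m' → ℝ} (hu : Continuous u) (hv : Continuous v) :
    Continuous fun x => bil M (u x) (v x) := by
  simp only [bil_eq_sum]
  fun_prop

lemma dotProduct_self_nonneg' (v : m → ℝ) : 0 ≤ v ⬝ᵥ v :=
  Finset.sum_nonneg fun a _ => mul_self_nonneg (v a)

lemma two_mul_dotProduct_le (u v : m → ℝ) : 2 * (u ⬝ᵥ v) ≤ u ⬝ᵥ u + v ⬝ᵥ v := by
  have := dotProduct_self_nonneg' (u - v)
  simp only [sub_dotProduct, dotProduct_sub] at this
  rw [dotProduct_comm v u] at this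
  linarith

/-- On plain coordinate vectors ‖·‖ is the sup norm. This bound and the next one compare it with the
Euclidean square v ⬝ᵥ v. -/
lemma dotProduct_self_le_card_mul (v : m → ℝ) : v ⬝ᵥ v ≤ Fintype.card m * ‖v‖ ^ 2 := by
  rw [← nsmul_eq_mul, ← Finset.card_univ]
  refine Finset.sum_le_card_nsmul _ _ _ fun a _ => ?_
  rw [← pow_two, ← sq_abs]
  gcongr
  exact norm_le_pi_norm v a

lemma norm_sq_le_dotProduct_self (v : m → ℝ) : ‖v‖ ^ 2 ≤ v ⬝ᵥ v := by
  refine (Real.le_sqrt (norm_nonneg v) (dotProduct_self_nonneg' v)).1 ?_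
  refine (pi_norm_le_iff_of_nonneg (Real.sqrt_nonneg _)).2 fun a => Real.le_sqrt_of_sq_le ?_
  rw [Real.norm_eq_abs, sq_abs, pow_two]
  exact Finset.single_le_sum (f := fun a => v a * v a) (fun a _ => mul_self_nonneg (v a))
    (Finset.mem_univ a)

/-- A quadratic form is bounded. -/
lemma exists_bil_self_le (M : Matrix m m ℝ) :
    ∃ c : ℝ, 0 ≤ c ∧ ∀ u, bil M u u ≤ c * (u ⬝ᵥ u) := by
  refine ⟨∑ a, ∑ b, |M a b|, by positivity, fun u => ?_⟩
  refine le_trans ?_ (mul_le_mul_of_nonneg_left (norm_sq_le_dotProduct_self u) (by positivity))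
  rw [bil_eq_sum, Finset.sum_mul]
  refine Finset.sum_le_sum fun a _ => ?_
  rw [Finset.sum_mul]
  refine Finset.sum_le_sum fun b _ => (le_abs_self _).trans ?_
  rw [abs_mul, abs_mul, pow_two]
  gcongr
  · exact norm_le_pi_norm u a
  · exact norm_le_pi_norm u b

lemma exists_norm_mulVec_le (M : Matrix m m' ℝ) :
    ∃ c : ℝ, 0 ≤ c ∧ ∀ v, ‖M *ᵥ v‖ ≤ c * ‖v‖ :=
  ⟨‖(LinearMap.toContinuousLinearMap M.mulVecLin)‖, norm_nonneg _, fun v =>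
    (LinearMap.toContinuousLinearMap M.mulVecLin).le_opNorm v⟩

/-- The form attains a positive minimum on the compact unit sphere, and homogeneity extends the
bound to all vectors. -/
lemma exists_norm_sq_le_bil {M : Matrix m m ℝ} (hM : M.PosDef) :
    ∃ ε : ℝ, 0 < ε ∧ ∀ v, ε * ‖v‖ ^ 2 ≤ bil M v v := by
  classical
  rcases isEmpty_or_nonempty m with he | he
  · exact ⟨1, one_pos, fun v => by simp [Subsingleton.elim v 0, bil_zero_left]⟩
  have hc : ContinuousOn (fun v => bil M v v) (Metric.sphere (0 : m → ℝ) 1) :=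
    (continuous_bil M continuous_id continuous_id).continuousOn
  obtain ⟨v₀, hv₀, hmin⟩ := (isCompact_sphere (0 : m → ℝ) 1).exists_isMinOn
    (NormedSpace.sphere_nonempty.2 zero_le_one) hc
  have hv₀' : v₀ ≠ 0 := by
    rintro rfl
    simp at hv₀
  refine ⟨bil M v₀ v₀, by simpa [bil] using hM.dotProduct_mulVec_pos hv₀', fun v => ?_⟩
  rcases eq_or_ne v 0 with rfl | hv
  · simp [bil_zero_left]
  have hn : 0 < ‖v‖ := norm_pos_iff.2 hv
  have h := hmin (a := ‖v‖⁻¹ • v) (by simp [norm_smul, hn.ne'])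
  simp only [mem_ofPred_eq, bil_smul_left, bil_smul_right] at h
  calc bil M v₀ v₀ * ‖v‖ ^ 2 ≤ ‖v‖⁻¹ * (‖v‖⁻¹ * bil M v v) * ‖v‖ ^ 2 := by gcongr
    _ = bil M v v := by field_simp

/-- A positive definite form is coercive. -/
lemma exists_coercive {M : Matrix m m ℝ} (hM : M.PosDef) :
    ∃ ε : ℝ, 0 < ε ∧ ∀ v, ε * (v ⬝ᵥ v) ≤ bil M v v := by
  obtain ⟨ε, hε, h⟩ := exists_norm_sq_le_bil hM
  -- The added 1 keeps the constant positive when the index type is empty.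
  refine ⟨ε / (Fintype.card m + 1), by positivity, fun v => le_trans ?_ (h v)⟩
  rw [div_mul_eq_mul_div, div_le_iff₀ (by positivity), mul_assoc]
  gcongr
  nlinarith [dotProduct_self_le_card_mul v, sq_nonneg ‖v‖]

end Bilinear

/-! ### Absolutely continuous functions with square integrable derivative -/

/-- Integration by parts for primitives of integrable functions. -/
lemma integral_mul_add_mul_of_primitive {F G f g : ℝ → ℝ} {a b : ℝ}
    (hf : IntervalIntegrable f volume a b) (hg : IntervalIntegrable g volume a b)
    (hF : ∀ x ∈ uIcc a b, F x = F a + ∫ s in a..x, f s)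
    (hG : ∀ x ∈ uIcc a b, G x = G a + ∫ s in a..x, g s) :
    ∫ x in a..b, (f x * G x + F x * g x) = F b * G b - F a * G a := by
  have hac : ∀ (c : ℝ) {h : ℝ → ℝ}, IntervalIntegrable h volume a b →
      AbsolutelyContinuousOnInterval (fun x => c + ∫ s in a..x, h s) a b := by
    intro c h hh
    have h1 := hh.absolutelyContinuousOnInterval_intervalIntegral (c := a) left_mem_uIcc
    have h2 : AbsolutelyContinuousOnInterval (fun _ : ℝ => c) a b :=
      (LipschitzWith.const c).lipschitzOnWith.absolutelyContinuousOnInterval (K := 0)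
    exact h2.add h1
  have key := (hac (F a) hf).integral_deriv_mul_eq_sub (hac (G a) hg)
  rw [hF b right_mem_uIcc, hG b right_mem_uIcc]
  simp only [intervalIntegral.integral_same, add_zero] at key
  rw [← key]
  apply intervalIntegral.integral_congr_ae
  -- Lebesgue differentiation: almost everywhere the primitives have derivatives f and g, so `deriv`
  -- can be replaced by the given integrands.
  filter_upwards [hf.ae_hasDerivAt_integral, hg.ae_hasDerivAt_integral] with x h1 h2 hx
  have hx' := uIoc_subset_uIcc hx
  rw [((h1 hx' a left_mem_uIcc).const_add (F a)).deriv,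
    ((h2 hx' a left_mem_uIcc).const_add (G a)).deriv, ← hF x hx', ← hG x hx']

lemma intervalIntegrable_fun_sum {κ : Type} {s : Finset κ} {F : κ → ℝ → ℝ} {a b : ℝ}
    (h : ∀ k ∈ s, IntervalIntegrable (F k) volume a b) :
    IntervalIntegrable (fun t => ∑ k ∈ s, F k t) volume a b := by
  simpa only [Finset.sum_fn] using IntervalIntegrable.sum s h

/-- `z` is an absolutely continuous function whose derivative `f` is locally square integrable. -/
structure HasL2Deriv {ι : Type} (z f : ℝ → ι → ℝ) : Prop where
  memLp : ∀ a b c, MemLp (fun t => f t c) 2 (volume.restrict (Ioc a b))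
  sub_eq : ∀ a b c, z b c - z a c = ∫ s in a..b, f s c

namespace HasL2Deriv

variable {ι ι' : Type} {z f : ℝ → ι → ℝ} {z' f' : ℝ → ι' → ℝ}

lemma intervalIntegrable_apply (h : HasL2Deriv z f) (c : ι) (a b : ℝ) :
    IntervalIntegrable (fun t => f t c) volume a b :=
  ⟨(h.memLp a b c).integrable one_le_two, (h.memLp b a c).integrable one_le_two⟩

lemma intervalIntegrable_mul (h : HasL2Deriv z f) (h' : HasL2Deriv z' f') (c : ι) (d : ι')
    (a b : ℝ) : IntervalIntegrable (fun t => f t c * f' t d) volume a b :=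
  ⟨(h.memLp a b c).integrable_mul (h'.memLp a b d), (h.memLp b a c).integrable_mul (h'.memLp b a d)⟩

lemma continuous (h : HasL2Deriv z f) : Continuous z := by
  refine continuous_pi fun c => ?_
  have : (fun t => z t c) = fun t => z 0 c + ∫ s in (0 : ℝ)..t, f s c := by
    ext t
    rw [← h.sub_eq]
    ring
  rw [this]
  exact continuous_const.add
    (intervalIntegral.continuous_primitive (fun a b => h.intervalIntegrable_apply c a b) 0)

lemma sub_const (h : HasL2Deriv z f) (v : ι → ℝ) : HasL2Deriv (fun t => z t - v) f where
  memLp := h.memLp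
  sub_eq a b c := by simp [← h.sub_eq]

variable [Fintype ι] [Fintype ι']

lemma intervalIntegrable_bil (h : HasL2Deriv z f) (h' : HasL2Deriv z' f') (M : Matrix ι ι' ℝ)
    (a b : ℝ) : IntervalIntegrable (fun t => bil M (f t) (f' t)) volume a b := by
  simp only [bil_eq_sum]
  exact intervalIntegrable_fun_sum fun c _ => intervalIntegrable_fun_sum fun d _ =>
    (h.intervalIntegrable_mul h' c d a b).const_mul _

lemma intervalIntegrable_bil_continuous (h : HasL2Deriv z f) (M : Matrix ι' ι ℝ)
    {w : ℝ → ι' → ℝ} {a b : ℝ} (hw : ContinuousOn w (uIcc a b)) :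
    IntervalIntegrable (fun t => bil M (w t) (f t)) volume a b := by
  simp only [bil_eq_sum]
  refine intervalIntegrable_fun_sum fun c _ => intervalIntegrable_fun_sum fun d _ =>
    IntervalIntegrable.const_mul ?_ _
  exact (h.intervalIntegrable_apply d a b).continuousOn_mul (continuousOn_pi.1 hw c)

lemma integral_bil_const (h : HasL2Deriv z f) (M : Matrix ι' ι ℝ) (w : ι' → ℝ) (a b : ℝ) :
    ∫ t in a..b, bil M w (f t) = bil M w (z b - z a) := by
  simp only [bil_eq_sum, Pi.sub_apply, h.sub_eq a b]
  rw [intervalIntegral.integral_finsetSum]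
  · refine Finset.sum_congr rfl fun c _ => ?_
    rw [intervalIntegral.integral_finsetSum]
    · refine Finset.sum_congr rfl fun d _ => ?_
      rw [intervalIntegral.integral_const_mul, intervalIntegral.integral_const_mul]
    · exact fun d _ => ((h.intervalIntegrable_apply d a b).const_mul _).const_mul _
  · exact fun c _ => intervalIntegrable_fun_sum fun d _ =>
      ((h.intervalIntegrable_apply d a b).const_mul _).const_mul _

/-- The derivative of a quadratic form along `z`. -/
lemma integral_two_bil (h : HasL2Deriv z f) {M : Matrix ι ι ℝ} (hM : M.IsHermitian) (a b : ℝ) :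
    ∫ t in a..b, 2 * bil M (z t) (f t) = bil M (z b) (z b) - bil M (z a) (z a) := by
  have hcont := h.continuous
  have h1 : ∀ t, 2 * bil M (z t) (f t) =
      ∑ c, ∑ d, M c d * (f t c * z t d + z t c * f t d) := by
    intro t
    have : 2 * bil M (z t) (f t) = bil M (f t) (z t) + bil M (z t) (f t) := by
      rw [bil_comm_of_isHermitian hM (f t)]; ring
    rw [this]
    simp only [bil_eq_sum, mul_add, Finset.sum_add_distrib]
  have hi : ∀ c d, IntervalIntegrable (fun t => f t c * z t d + z t c * f t d) volume a b :=
    fun c d => ((h.intervalIntegrable_apply c a b).mul_continuousOn (by fun_prop)).add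
      ((h.intervalIntegrable_apply d a b).continuousOn_mul (by fun_prop))
  simp only [h1]
  rw [intervalIntegral.integral_finsetSum]
  · simp only [bil_eq_sum, ← Finset.sum_sub_distrib]
    refine Finset.sum_congr rfl fun c _ => ?_
    rw [intervalIntegral.integral_finsetSum]
    · refine Finset.sum_congr rfl fun d _ => ?_
      rw [intervalIntegral.integral_const_mul, integral_mul_add_mul_of_primitive
        (F := fun t => z t c) (G := fun t => z t d)
        (h.intervalIntegrable_apply c a b) (h.intervalIntegrable_apply d a b)
        (fun x _ => by rw [← h.sub_eq]; ring) (fun x _ => by rw [← h.sub_eq]; ring)]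
      ring
    · exact fun d _ => (hi c d).const_mul _
  · exact fun c _ => intervalIntegrable_fun_sum fun d _ => (hi c d).const_mul _

end HasL2Deriv

/-! ### Wirtinger's inequality and the reciprocally convex combination inequality -/

namespace HasL2Deriv

variable {ι : Type} [Fintype ι] {z f : ℝ → ι → ℝ}

/-- Wirtinger's inequality with a constant below the sharp one. -/
lemma wirtinger_of_lt (h : HasL2Deriv z f) {W : Matrix ι ι ℝ} (hW : W.PosSemidef) {a b c : ℝ}
    (hab : a ≤ b) (hc : 0 ≤ c) (hcb : c * (b - a) < Real.pi / 2) (hz : z a = 0) :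
    c ^ 2 * ∫ t in a..b, bil W (z t) (z t) ≤ ∫ t in a..b, bil W (f t) (f t) := by
  -- φ solves the Riccati equation φ' = −c² − φ² with φ(b) = 0, and is finite on [a, b] because c(b
  -- − a) < π/2.
  set φ : ℝ → ℝ := fun t => c * Real.tan (c * (b - t)) with hφ
  have hcos : ∀ t ∈ uIcc a b, Real.cos (c * (b - t)) ≠ 0 := by
    intro t ht
    rw [uIcc_of_le hab] at ht
    refine (Real.cos_pos_of_mem_Ioo ⟨?_, ?_⟩).ne'
    · have : 0 ≤ c * (b - t) := mul_nonneg hc (by linarith [ht.2])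
      linarith [Real.pi_pos]
    · have : c * (b - t) ≤ c * (b - a) := by gcongr; exact ht.1
      linarith
  have hφd : ∀ t ∈ uIcc a b, HasDerivAt φ (-c ^ 2 - φ t ^ 2) t := by
    intro t ht
    have h1 := ((Real.hasDerivAt_tan (hcos t ht)).comp t
      (((hasDerivAt_id t).const_sub b).const_mul c)).const_mul c
    refine h1.congr_deriv ?_
    simp only [hφ]
    have h2 : 1 / Real.cos (c * (b - t)) ^ 2 = 1 + Real.tan (c * (b - t)) ^ 2 := by
      rw [Real.tan_eq_sin_div_cos]
      have := hcos t ht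
      field_simp
      rw [Real.cos_sq_add_sin_sq]
    rw [h2]
    ring
  have hφc : ContinuousOn φ (uIcc a b) := fun t ht => (hφd t ht).continuousAt.continuousWithinAt
  have hφ'c : ContinuousOn (fun t => -c ^ 2 - φ t ^ 2) (uIcc a b) := by fun_prop
  have hzc : Continuous z := h.continuous
  have hq : Continuous fun t => bil W (z t) (z t) := continuous_bil W hzc hzc
  have hzf : IntervalIntegrable (fun t => bil W (z t) (f t)) volume a b :=
    h.intervalIntegrable_bil_continuous W hzc.continuousOn
  have hff := h.intervalIntegrable_bil h W a b
  have hparts := integral_mul_add_mul_of_primitive (F := φ) (G := fun t => bil W (z t) (z t))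
    hφ'c.intervalIntegrable (hzf.const_mul 2)
    (fun x hx => by
      rw [intervalIntegral.integral_eq_sub_of_hasDerivAt
        (fun t ht => hφd t (uIcc_subset_uIcc_left hx ht))
        (hφ'c.mono (uIcc_subset_uIcc_left hx)).intervalIntegrable]
      ring)
    (fun x _ => by rw [h.integral_two_bil hW.1]; ring)
  -- Both boundary terms of ∫ (φ · z'Wz)' vanish: at b because φ(b) = 0, at a because z(a) = 0.
  have hb0 : φ b = 0 := by simp [hφ]
  simp only [hb0, hz, bil_zero_left, zero_mul, mul_zero, sub_zero] at hparts
  -- By the Riccati equation the expression is the square (f − φz)'W(f − φz).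
  have hpos : ∀ t, 0 ≤ bil W (f t) (f t) - c ^ 2 * bil W (z t) (z t)
      - ((-c ^ 2 - φ t ^ 2) * bil W (z t) (z t) + φ t * (2 * bil W (z t) (f t))) := by
    intro t
    have := bil_self_nonneg hW (f t - φ t • z t)
    simp only [bil_sub_left, bil_sub_right, bil_smul_left, bil_smul_right] at this
    rw [bil_comm_of_isHermitian hW.1 (f t) (z t)] at this
    linarith
  have h1 : IntervalIntegrable (fun t => bil W (f t) (f t) - c ^ 2 * bil W (z t) (z t))
      volume a b :=
    hff.sub ((hq.intervalIntegrable a b).const_mul _)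
  have h2 : IntervalIntegrable (fun t => (-c ^ 2 - φ t ^ 2) * bil W (z t) (z t)
      + φ t * (2 * bil W (z t) (f t))) volume a b :=
    (hφ'c.mul hq.continuousOn).intervalIntegrable.add ((hzf.const_mul 2).continuousOn_mul hφc)
  have := intervalIntegral.integral_nonneg (μ := volume) hab fun t _ => hpos t
  rw [intervalIntegral.integral_sub h1 h2, hparts, intervalIntegral.integral_sub hff
    ((hq.intervalIntegrable a b).const_mul _), intervalIntegral.integral_const_mul] at this
  linarith

/-- Wirtinger's inequality for a function that vanishes at the left end of the interval. -/
lemma wirtinger (h : HasL2Deriv z f) {W : Matrix ι ι ℝ} (hW : W.PosSemidef) {a b τ : ℝ}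
    (hab : a ≤ b) (hτ : b - a ≤ τ) :
    Real.pi ^ 2 / 4 * ∫ t in a..b, bil W (z t - z a) (z t - z a) ≤
      τ ^ 2 * ∫ t in a..b, bil W (f t) (f t) := by
  have hI : 0 ≤ ∫ t in a..b, bil W (f t) (f t) :=
    intervalIntegral.integral_nonneg hab fun t _ => bil_self_nonneg hW _
  rcases hab.eq_or_lt with rfl | hlt
  · simp
  set I := ∫ t in a..b, bil W (z t - z a) (z t - z a) with hIdef
  set J := ∫ t in a..b, bil W (f t) (f t) with hJdef
  have hL : 0 < b - a := sub_pos.2 hlt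
  have hpi := Real.pi_pos
  -- The sharp constant π/(2(b − a)) is where the tangent blows up at a, so it is approached from
  -- below by a factor r → 1.
  have key : ∀ r ∈ Ioo (0 : ℝ) 1, (r * (Real.pi / (2 * (b - a)))) ^ 2 * I ≤ J := by
    intro r hr
    refine (h.sub_const (z a)).wirtinger_of_lt hW hab (mul_nonneg hr.1.le (by positivity)) ?_
      (by simp)
    calc r * (Real.pi / (2 * (b - a))) * (b - a) = r * (Real.pi / 2) := by field_simp
      _ < 1 * (Real.pi / 2) := by gcongr; exact hr.2
      _ = Real.pi / 2 := one_mul _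
  have hlim : (1 * (Real.pi / (2 * (b - a)))) ^ 2 * I ≤ J := by
    have ht : Filter.Tendsto (fun r : ℝ => (r * (Real.pi / (2 * (b - a)))) ^ 2 * I)
        (nhdsWithin 1 (Iio 1)) (nhds ((1 * (Real.pi / (2 * (b - a)))) ^ 2 * I)) :=
      (Continuous.tendsto (by fun_prop) 1).mono_left nhdsWithin_le_nhds
    refine le_of_tendsto ht ?_
    filter_upwards [Ioo_mem_nhdsLT (zero_lt_one' ℝ)] with r hr using key r hr
  calc Real.pi ^ 2 / 4 * I = (b - a) ^ 2 * ((1 * (Real.pi / (2 * (b - a)))) ^ 2 * I) := by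
        field_simp; ring
    _ ≤ (b - a) ^ 2 * J := by gcongr
    _ ≤ τ ^ 2 * J := by gcongr

/-- The integrated form of a pointwise inequality between the derivatives on two intervals. -/
lemma two_bil_sub_le (h : HasL2Deriv z f) {R M : Matrix ι ι ℝ}
    (hRM : ∀ u v, 2 * bil M u v ≤ bil R u u + bil R v v) {a b c d : ℝ} (hab : a ≤ b)
    (hcd : c ≤ d) :
    2 * bil M (z b - z a) (z d - z c) ≤
      (d - c) * (∫ t in a..b, bil R (f t) (f t)) + (b - a) * ∫ t in c..d, bil R (f t) (f t) := by
  have hR := fun x y => h.intervalIntegrable_bil h R x y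
  -- The pointwise inequality is integrated over the rectangle [a, b] × [c, d] one variable at a
  -- time: first u = f(t) with v fixed, then v = f(t).
  have hinner : ∀ v, 2 * bil M (z b - z a) v ≤
      (∫ t in a..b, bil R (f t) (f t)) + (b - a) * bil R v v := by
    intro v
    have hi : IntervalIntegrable (fun t => 2 * bil M (f t) v) volume a b := by
      simp only [← bil_transpose M]
      exact (h.intervalIntegrable_bil_continuous Mᵀ continuousOn_const).const_mul 2
    have := intervalIntegral.integral_mono_on hab hi
      ((hR a b).add (intervalIntegrable_const (c := bil R v v))) fun t _ => hRM (f t) v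
    rw [intervalIntegral.integral_const_mul, intervalIntegral.integral_add (hR a b)
      intervalIntegrable_const, intervalIntegral.integral_const, smul_eq_mul] at this
    simp only [← bil_transpose M] at this ⊢
    rwa [h.integral_bil_const] at this
  have hi : IntervalIntegrable (fun t => 2 * bil M (z b - z a) (f t)) volume c d :=
    (h.intervalIntegrable_bil_continuous M continuousOn_const).const_mul 2
  have := intervalIntegral.integral_mono_on hcd hi
    ((intervalIntegrable_const (c := ∫ t in a..b, bil R (f t) (f t))).add
      ((hR c d).const_mul (b - a))) fun t _ => hinner (f t)
  rwa [intervalIntegral.integral_const_mul, h.integral_bil_const, intervalIntegral.integral_add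
    intervalIntegrable_const ((hR c d).const_mul _), intervalIntegral.integral_const, smul_eq_mul,
    intervalIntegral.integral_const_mul] at this

/-- The reciprocally convex combination inequality, for an arbitrary partition
`x 0 ≥ x 1 ≥ ⋯ ≥ x (p + 1)`. -/
lemma reciprocally_convex (h : HasL2Deriv z f) {R G : Matrix ι ι ℝ} (hR : R.PosSemidef)
    (hRG : (fromBlocks R G Gᵀ R).PosSemidef) (p : ℕ) {x : ℕ → ℝ}
    (hx : ∀ m ≤ p, x (m + 1) ≤ x m) :
    ∑ a : Fin (p + 1), ∑ b : Fin (p + 1),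
      bil (if a = b then R else (1 / 2 : ℝ) • (G + Gᵀ)) (z (x a) - z (x (a + 1)))
        (z (x b) - z (x (b + 1))) ≤
      (x 0 - x (p + 1)) * ∫ t in x (p + 1)..x 0, bil R (f t) (f t) := by
  -- Positivity of the block matrix is tested on (u, −v).
  have hG : ∀ u v, 2 * bil G u v ≤ bil R u u + bil R v v := by
    intro u v
    have := hRG.dotProduct_mulVec_nonneg (Sum.elim u (-v))
    simp only [star_trivial, fromBlocks_mulVec, Sum.elim_comp_inl, Sum.elim_comp_inr,
      sumElim_dotProduct_sumElim, dotProduct_add] at this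
    change 0 ≤ bil R u u + bil G u (-v) + (bil Gᵀ (-v) u + bil R (-v) (-v)) at this
    rw [bil_transpose] at this
    simp only [bil_neg_left, bil_neg_right, neg_neg] at this
    linarith
  have hGs : ∀ u v, 2 * bil ((1 / 2 : ℝ) • (G + Gᵀ)) u v ≤ bil R u u + bil R v v := by
    intro u v
    rw [bil_smul, bil_add, bil_transpose]
    linarith [hG u v, hG v u]
  have hRR : ∀ u v, 2 * bil R u v ≤ bil R u u + bil R v v := by
    intro u v
    have := bil_self_nonneg hR (u - v)
    simp only [bil_sub_left, bil_sub_right] at this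
    rw [bil_comm_of_isHermitian hR.1 v u] at this
    linarith
  set I : ℕ → ℝ := fun m => ∫ t in x (m + 1)..x m, bil R (f t) (f t) with hI
  have hsumI : ∑ a : Fin (p + 1), I a = ∫ t in x (p + 1)..x 0, bil R (f t) (f t) := by
    rw [Fin.sum_univ_eq_sum_range I (p + 1)]
    have := intervalIntegral.sum_integral_adjacent_intervals (a := x) (n := p + 1) (μ := volume)
      (f := fun t => bil R (f t) (f t)) fun k _ => h.intervalIntegrable_bil h R _ _
    rw [intervalIntegral.integral_symm, ← this, ← Finset.sum_neg_distrib]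
    exact Finset.sum_congr rfl fun m _ => intervalIntegral.integral_symm _ _
  have hsumL : ∑ a : Fin (p + 1), (x a - x (a + 1)) = x 0 - x (p + 1) := by
    rw [Fin.sum_univ_eq_sum_range (fun a => x a - x (a + 1)) (p + 1), Finset.sum_range_sub']
  -- Each pair of subintervals is bounded by lengths times energies. Over all pairs the bounds add
  -- up to (sum of lengths) · (sum of energies), and no division by a length occurs, so degenerate
  -- subintervals are harmless.
  have hterm : ∀ a b : Fin (p + 1),
      bil (if a = b then R else (1 / 2 : ℝ) • (G + Gᵀ)) (z (x a) - z (x (a + 1)))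
        (z (x b) - z (x (b + 1))) ≤
      (1 / 2) * ((x b - x (b + 1)) * I a + (x a - x (a + 1)) * I b) := by
    intro a b
    have hM : ∀ u v, 2 * bil (if a = b then R else (1 / 2 : ℝ) • (G + Gᵀ)) u v ≤
        bil R u u + bil R v v := by
      split_ifs
      exacts [hRR, hGs]
    linarith [h.two_bil_sub_le hM (hx a (Nat.lt_succ_iff.1 a.2)) (hx b (Nat.lt_succ_iff.1 b.2))]
  refine (Finset.sum_le_sum fun a _ => Finset.sum_le_sum fun b _ => hterm a b).trans_eq ?_
  rw [← hsumI, ← hsumL]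
  simp only [← Finset.mul_sum, Finset.sum_add_distrib, ← Finset.sum_mul]
  ring

end HasL2Deriv

/-! ### The round-robin schedule -/

section Polling

lemma shiftPerm_append_singleton {V : Type} (l : List V) (x : V) :
    shiftPerm (l ++ [x]) = x :: l := by
  rcases l with _ | ⟨y, l⟩
  · rfl
  · have h : 1 % (l.length + 1 + 1) = 1 := Nat.mod_eq_of_lt (by omega)
    simp [shiftPerm, List.rotateRight, h]

lemma shiftPerm_perm {V : Type} (l : List V) : (shiftPerm l).Perm l := by
  rcases List.eq_nil_or_concat' l with rfl | ⟨l', x, rfl⟩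
  · simp [shiftPerm, List.rotateRight]
  · rw [shiftPerm_append_singleton]
    exact (List.perm_append_singleton x l').symm

lemma idxOf_shiftPerm {V : Type} [DecidableEq V] {l : List V} (hl : l.Nodup) {x : V} (hx : x ∈ l) :
    (shiftPerm l).idxOf x = if l.idxOf x + 1 < l.length then l.idxOf x + 1 else 0 := by
  rcases List.eq_nil_or_concat' l with rfl | ⟨l', y, rfl⟩
  · simp at hx
  rw [shiftPerm_append_singleton]
  by_cases hxy : y = x
  · subst hxy
    have : y ∉ l' := fun h => by
      have := List.disjoint_of_nodup_append hl h
      simp at this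
    simp [List.idxOf_append_of_notMem this]
  · have hx' : x ∈ l' := by
      rcases List.mem_append.1 hx with h | h
      · exact h
      · exact absurd (List.mem_singleton.1 h).symm hxy
    have := List.idxOf_lt_length_iff.2 hx'
    rw [List.idxOf_cons_ne _ hxy, List.idxOf_append_of_mem hx']
    simp [this]

variable {N : ℕ} (G : Digraph (Fin N)) (i : Fin N)

lemma pollOrder_perm (k : ℕ) : (pollOrder G i k).Perm ((nbhd G i).sort (· ≤ ·)) := by
  induction k with
  | zero => exact List.Perm.refl _
  | succ k ih =>
    rw [pollOrder, Function.iterate_succ_apply']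
    exact (shiftPerm_perm _).trans ih

lemma pollOrder_nodup (k : ℕ) : (pollOrder G i k).Nodup :=
  (pollOrder_perm G i k).nodup_iff.2 (Finset.sort_nodup _ _)

lemma mem_pollOrder (k : ℕ) {j : Fin N} : j ∈ pollOrder G i k ↔ j ∈ nbhd G i := by
  rw [(pollOrder_perm G i k).mem_iff, Finset.mem_sort]

lemma length_pollOrder (k : ℕ) : (pollOrder G i k).length = inDeg G i := by
  rw [(pollOrder_perm G i k).length_eq, Finset.length_sort, inDeg]

lemma one_le_pollIndex (k : ℕ) (j : Fin N) : 1 ≤ pollIndex G i k j := Nat.le_add_left _ _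

lemma pollIndex_le (k : ℕ) {j : Fin N} (hj : j ∈ nbhd G i) : pollIndex G i k j ≤ inDeg G i := by
  rw [← length_pollOrder G i k]
  exact List.idxOf_lt_length_iff.2 ((mem_pollOrder G i k).2 hj)

/-- One shift moves every neighbour one place back, except the last one, which comes to the front
and is the one polled at the new instant. -/
lemma pollIndex_succ (k : ℕ) {j : Fin N} (hj : j ∈ nbhd G i) :
    pollIndex G i (k + 1) j = pollIndex G i k j + 1 ∨ pollIndex G i (k + 1) j = 1 := by
  have : pollOrder G i (k + 1) = shiftPerm (pollOrder G i k) := Function.iterate_succ_apply' _ _ _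
  rw [pollIndex, this, idxOf_shiftPerm (pollOrder_nodup G i k) ((mem_pollOrder G i k).2 hj)]
  split_ifs
  · exact Or.inl rfl
  · exact Or.inr rfl

/-- In each interval the polled positions run through all the indices. -/
lemma sum_pollIndex {E : Type*} [AddCommMonoid E] (k : ℕ) (φ : ℕ → E) :
    ∑ j ∈ nbhd G i, φ (pollIndex G i k j) = ∑ ν : Fin (inDeg G i), φ (ν + 1) := by
  have hn := pollOrder_nodup G i k
  have hf : nbhd G i = (pollOrder G i k).toFinset := by
    ext j
    rw [List.mem_toFinset, mem_pollOrder]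
  rw [hf, List.sum_toFinset _ hn, ← length_pollOrder G i k]
  have : (pollOrder G i k).map (fun j => φ (pollIndex G i k j)) =
      List.ofFn fun ν : Fin (pollOrder G i k).length => φ (ν + 1) := by
    refine List.ext_getElem (by simp) fun m h1 h2 => ?_
    simp [pollIndex, hn.idxOf_getElem]
  rw [this, List.sum_ofFn]

end Polling

/-! ### Age and renewal of the samples -/

section Sampling

variable {N n mw mv : ℕ} (S : Network N n mw mv)

namespace Network

lemma tExt_mono : Monotone S.tExt := fun _ _ h => S.t_strictMono.monotone (Int.toNat_le_toNat h)

lemma tExt_natCast (k : ℕ) : S.tExt k = S.t k := by simp [tExt]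

lemma t_nonneg (k : ℕ) : 0 ≤ S.t k := S.t_zero ▸ S.t_strictMono.monotone (Nat.zero_le k)

lemma tExt_nonneg (k : ℤ) : 0 ≤ S.tExt k := S.t_nonneg _

variable (i : Fin N)

lemma sampleTime_le (k : ℕ) (j : Fin N) : S.sampleTime i k j ≤ S.t k := by
  rw [← S.tExt_natCast k]
  refine S.tExt_mono ?_
  have := one_le_pollIndex S.graph i k j
  omega

lemma sampleTime_nonneg (k : ℕ) (j : Fin N) : 0 ≤ S.sampleTime i k j := S.tExt_nonneg _

/-- A channel keeps its sample until it is polled. -/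
lemma sampleTime_succ (k : ℕ) {j : Fin N} (hj : j ∈ nbhd S.graph i) :
    S.sampleTime i (k + 1) j = S.sampleTime i k j ∨ S.sampleTime i (k + 1) j = S.t (k + 1) := by
  rcases pollIndex_succ S.graph i k hj with h | h
  · left
    rw [sampleTime, sampleTime, h]
    congr 1
    push_cast
    ring
  · right
    rw [sampleTime, h, ← S.tExt_natCast]
    congr 1
    push_cast
    ring

/-- The polling order is a permutation of the neighbourhood. A node's own samples enter the coupling
only through their sum, so they can be listed by time, independently of the permutation. -/
lemma sum_sampleTime {E : Type*} [AddCommMonoid E] (k : ℕ) (φ : ℝ → E) :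
    ∑ j ∈ nbhd S.graph i, φ (S.sampleTime i k j) =
      ∑ ν : Fin (S.p i), φ (S.tExt ((k : ℤ) - (ν : ℕ))) := by
  refine (sum_pollIndex S.graph i k fun m : ℕ => φ (S.tExt ((k : ℤ) - m + 1))).trans ?_
  refine Finset.sum_congr rfl fun ν _ => ?_
  congr 2
  push_cast
  ring

lemma pollGap_le_τ (hτ : ∀ i, BddAbove (Set.range (S.pollGap i))) (k : ℕ) :
    S.pollGap i k ≤ S.τ i := le_ciSup (hτ i) k

lemma τ_nonneg (hτ : ∀ i, BddAbove (Set.range (S.pollGap i))) : 0 ≤ S.τ i := by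
  refine le_trans ?_ (S.pollGap_le_τ i hτ 0)
  rw [pollGap, sub_nonneg, ← S.tExt_natCast]
  exact S.tExt_mono (by push_cast; omega)

lemma τ_le_τmax : S.τ i ≤ S.τmax := le_ciSup (Set.finite_range _).bddAbove i

lemma t_succ_sub_τ_le (hτ : ∀ i, BddAbove (Set.range (S.pollGap i))) (k : ℕ) :
    S.t (k + 1) - S.τ i ≤ S.tExt ((k : ℤ) - S.p i + 1) := by
  have := S.pollGap_le_τ i hτ k
  rw [pollGap] at this
  linarith

/-- A polling index is at most p_i, so even at the end of the sampling interval a sample is at most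
τ_i old. This is the age bound that Wirtinger's inequality needs. -/
lemma t_succ_sub_τ_le_sampleTime (hτ : ∀ i, BddAbove (Set.range (S.pollGap i))) (k : ℕ)
    {j : Fin N} (hj : j ∈ nbhd S.graph i) : S.t (k + 1) - S.τ i ≤ S.sampleTime i k j := by
  refine (S.t_succ_sub_τ_le i hτ k).trans (S.tExt_mono ?_)
  have := pollIndex_le S.graph i k hj
  rw [p]
  omega

end Network

end Sampling

/-! ### The quadratic form of `Ξ_i` -/

section BlockForms

variable {m m' m'' : Type} [Fintype m'] {p n : ℕ}

/-- The vector with the blocks `v 0, …, v (p - 1)`. -/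
def stack {κ ι : Type} (v : κ → ι → ℝ) (a : κ × ι) : ℝ := v a.1 a.2

lemma rowRep_mulVec_stack (M : Matrix m m' ℝ) (v : Fin p → m' → ℝ) :
    rowRep p M *ᵥ stack v = M *ᵥ ∑ ν, v ν := by
  ext a
  simp only [mulVec, dotProduct, rowRep, of_apply, stack, Fintype.sum_prod_type, Finset.sum_apply,
    Finset.mul_sum]
  exact Finset.sum_comm

variable [Fintype m] [Fintype m'']

lemma bil_symBlock (E : Matrix m m ℝ) (F : Matrix m m' ℝ) (D : Matrix m' m' ℝ) (u : m → ℝ)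
    (v : m' → ℝ) : bil (symBlock E F D) (Sum.elim u v) (Sum.elim u v) =
      bil E u u + 2 * bil F u v + bil D v v := by
  have : bil (symBlock E F D) (Sum.elim u v) (Sum.elim u v) =
      bil E u u + bil F u v + (bil Fᵀ v u + bil D v v) := by
    simp [bil, symBlock, fromBlocks_mulVec, dotProduct_add]
  rw [this, bil_transpose]
  ring

lemma bil_fromCols (F : Matrix m m' ℝ) (F' : Matrix m m'' ℝ) (u : m → ℝ) (v : m' → ℝ)
    (w : m'' → ℝ) : bil (fromCols F F') u (Sum.elim v w) = bil F u v + bil F' u w := by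
  simp [bil, dotProduct_add]

lemma bil_rowRep (M : Matrix m m' ℝ) (u : m → ℝ) (v : Fin p → m' → ℝ) :
    bil (rowRep p M) u (stack v) = bil M u (∑ ν, v ν) := by
  rw [bil, bil, rowRep_mulVec_stack]

lemma bil_colRep (M : Matrix m m' ℝ) (u : Fin p → m → ℝ) (v : m' → ℝ) :
    bil (colRep p M) (stack u) v = bil M (∑ ν, u ν) v := by
  have : colRep p M = (rowRep p Mᵀ)ᵀ := rfl
  rw [this, bil_transpose, bil_rowRep, bil_transpose]

lemma bil_sqRep (M : Matrix m m' ℝ) (u : Fin p → m → ℝ) (v : Fin p → m' → ℝ) :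
    bil (sqRep p M) (stack u) (stack v) = bil M (∑ ν, u ν) (∑ ν, v ν) := by
  have : sqRep p M = colRep p (rowRep p M) := rfl
  rw [this, bil_colRep, bil_rowRep]

/-- A quadratic form on stacked vectors as a sum over the blocks. -/
lemma bil_stack {κ κ' : Type} [Fintype κ] [Fintype κ'] (M : Matrix (κ × m) (κ' × m') ℝ)
    (u : κ → m → ℝ) (v : κ' → m' → ℝ) :
    bil M (stack u) (stack v) =
      ∑ a, ∑ b, bil (M.submatrix (Prod.mk a) (Prod.mk b)) (u a) (v b) := by
  simp only [bil_eq_sum, Fintype.sum_prod_type, stack, submatrix_apply]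
  exact Finset.sum_congr rfl fun a _ => Finset.sum_comm

lemma bil_diagBlocks (M : Fin p → Matrix (Fin n) (Fin n) ℝ) (u v : Fin p → Fin n → ℝ) :
    bil (diagBlocks M) (stack u) (stack v) = ∑ ν, bil (M ν) (u ν) (v ν) := by
  rw [bil_stack]
  refine Finset.sum_congr rfl fun a _ => ?_
  rw [Finset.sum_eq_single a]
  · congr 1
    ext x y
    simp [diagBlocks]
  · intro b _ hb
    rw [show (diagBlocks M).submatrix (Prod.mk a) (Prod.mk b) = 0 by
      ext x y; simp [diagBlocks, hb.symm], bil_zero]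
  · simp

lemma bil_Psi (R G : Matrix (Fin n) (Fin n) ℝ) (u : Fin (p + 1) → Fin n → ℝ) :
    bil (Psi p R G) (stack u) (stack u) =
      ∑ a, ∑ b, bil (if a = b then R else (1 / 2 : ℝ) • (G + Gᵀ)) (u a) (u b) := by
  rw [bil_stack]
  refine Finset.sum_congr rfl fun a _ => Finset.sum_congr rfl fun b _ => ?_
  congr 1
  ext x y
  by_cases h : a = b <;> simp [Psi, h]

lemma Psi_transpose {R : Matrix (Fin n) (Fin n) ℝ} (hR : R.IsHermitian)
    (G : Matrix (Fin n) (Fin n) ℝ) : (Psi p R G)ᵀ = Psi p R G := by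
  ext ⟨a, x⟩ ⟨b, y⟩
  have := congrFun (congrFun hR x) y
  simp only [conjTranspose_apply, star_trivial] at this
  by_cases h : a = b
  · subst h
    simp [Psi, this]
  · simp [Psi, h, Ne.symm h, add_comm]

lemma T_mulVec_stack (z : Fin (p + 2) → Fin n → ℝ) :
    T p n *ᵥ stack z = stack fun a : Fin (p + 1) => z a.castSucc - z a.succ := by
  ext ⟨a, x⟩
  have hne : a.succ ≠ a.castSucc := by simp [Fin.ext_iff]
  simp only [mulVec, dotProduct, T, kroneckerMap_apply, of_apply, stack, Fintype.sum_prod_type,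
    one_apply, mul_ite, mul_one, mul_zero, ite_mul, zero_mul, Finset.sum_ite_eq, Finset.mem_univ,
    if_true, one_mul, neg_mul, Pi.sub_apply]
  -- Row a of the difference matrix has exactly two nonzero entries, 1 and −1.
  rw [Finset.sum_eq_add_of_mem a.castSucc a.succ (Finset.mem_univ _) (Finset.mem_univ _) hne.symm]
  · simp [hne, sub_eq_add_neg]
  · rintro b - ⟨h1, h2⟩
    simp [h1, h2]

/-- The partition of a quadratic form into blocks of sizes `n`, `p n`, `n`. -/
lemma bil_partition {M : Matrix (Fin (p + 2) × Fin n) (Fin (p + 2) × Fin n) ℝ} (hM : Mᵀ = M)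
    (u : Fin n → ℝ) (v : Fin p → Fin n → ℝ) (w : Fin n → ℝ) :
    bil M (stack (Fin.cons u (Fin.snoc v w : Fin (p + 1) → Fin n → ℝ) : Fin (p + 2) → Fin n → ℝ))
        (stack (Fin.cons u (Fin.snoc v w : Fin (p + 1) → Fin n → ℝ) : Fin (p + 2) → Fin n → ℝ)) =
      bil (M.submatrix (blk₁ p) (blk₁ p)) u u
      + bil (M.submatrix (blk₂ p) (blk₂ p)) (stack v) (stack v)
      + bil (M.submatrix (blk₃ p) (blk₃ p)) w w
      + 2 * bil (M.submatrix (blk₁ p) (blk₂ p)) u (stack v)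
      + 2 * bil (M.submatrix (blk₁ p) (blk₃ p)) u w
      + 2 * bil (M.submatrix (blk₂ p) (blk₃ p)) (stack v) w := by
  have hsym : ∀ (a b : Fin (p + 2)) (x y : Fin n → ℝ),
      bil (M.submatrix (Prod.mk a) (Prod.mk b)) x y =
        bil (M.submatrix (Prod.mk b) (Prod.mk a)) y x := by
    intro a b x y
    rw [← bil_transpose, transpose_submatrix, hM]
  have h12 : bil (M.submatrix (blk₁ p) (blk₂ p)) u (stack v) =
      ∑ ν : Fin p, bil (M.submatrix (Prod.mk 0) (Prod.mk ν.castSucc.succ)) u (v ν) := by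
    simp only [bil_eq_sum, Fintype.sum_prod_type, stack, submatrix_apply, blk₁, blk₂]
    exact Finset.sum_comm
  have h23 : bil (M.submatrix (blk₂ p) (blk₃ p)) (stack v) w =
      ∑ ν : Fin p, bil (M.submatrix (Prod.mk ν.castSucc.succ) (Prod.mk (Fin.last (p + 1))))
        (v ν) w := by
    simp only [bil_eq_sum, Fintype.sum_prod_type, stack, submatrix_apply, blk₂, blk₃]
  have h22 : bil (M.submatrix (blk₂ p) (blk₂ p)) (stack v) (stack v) =
      ∑ ν : Fin p, ∑ μ : Fin p,
        bil (M.submatrix (Prod.mk ν.castSucc.succ) (Prod.mk μ.castSucc.succ)) (v ν) (v μ) := by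
    rw [bil_stack]
    rfl
  have h11 : M.submatrix (blk₁ p) (blk₁ p) = M.submatrix (Prod.mk 0) (Prod.mk 0) := rfl
  have h13 : M.submatrix (blk₁ p) (blk₃ p) =
      M.submatrix (Prod.mk 0) (Prod.mk (Fin.last (p + 1))) := rfl
  have h33 : M.submatrix (blk₃ p) (blk₃ p) =
      M.submatrix (Prod.mk (Fin.last (p + 1))) (Prod.mk (Fin.last (p + 1))) := rfl
  rw [bil_stack, h12, h23, h22, h11, h13, h33]
  simp only [Fin.sum_univ_succ (n := p + 1), Fin.sum_univ_castSucc (n := p), Fin.cons_zero,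
    Fin.cons_succ, Fin.snoc_castSucc, Fin.snoc_last, Fin.succ_last, Finset.sum_add_distrib,
    hsym (Fin.last (p + 1)), hsym _ 0 _ u]
  ring

end BlockForms

/-! ### Evaluation of Ξ_i along solutions -/

section XiForm

variable {N n mw mv : ℕ} (S : Network N n mw mv) (g : Gains S) (γ : ℝ) (V : LMIVars N n)
  (i : Fin N)

/-- The argument of the quadratic form of `Ξ_i`. -/
def xiVec (a b : Fin n → ℝ) (c : Fin (S.p i) → Fin n → ℝ) (d : Fin n → ℝ)
    (e f : Fin (S.p i) → Fin n → ℝ) (w : Fin mw ⊕ Fin mv → ℝ) : XiIndex S i → ℝ :=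
  Sum.elim a <| Sum.elim b <| Sum.elim (stack c) <| Sum.elim d <| Sum.elim (stack e) <|
    Sum.elim (stack f) w

lemma PsiBar_transpose (hR : (V.R i).IsHermitian) : (PsiBar S V i)ᵀ = PsiBar S V i := by
  simp only [PsiBar, transpose_smul, transpose_mul, transpose_transpose, Psi_transpose hR,
    Matrix.mul_assoc]

/-- The successive differences of `b, c 0, …, c (p - 1), d`. -/
def succDiff {p : ℕ} (b : Fin n → ℝ) (c : Fin p → Fin n → ℝ) (d : Fin n → ℝ)
    (a : Fin (p + 1)) : Fin n → ℝ :=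
  (Fin.cons b (Fin.snoc c d : Fin (p + 1) → Fin n → ℝ) : Fin (p + 2) → Fin n → ℝ) a.castSucc -
    (Fin.snoc c d : Fin (p + 1) → Fin n → ℝ) a

lemma bil_PsiBar (b : Fin n → ℝ) (c : Fin (S.p i) → Fin n → ℝ) (d : Fin n → ℝ) :
    bil (PsiBar S V i)
        (stack (Fin.cons b (Fin.snoc c d : Fin (S.p i + 1) → Fin n → ℝ) :
          Fin (S.p i + 2) → Fin n → ℝ))
        (stack (Fin.cons b (Fin.snoc c d : Fin (S.p i + 1) → Fin n → ℝ) :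
          Fin (S.p i + 2) → Fin n → ℝ)) =
      Real.exp (-2 * V.α i * S.τ i) * ∑ x, ∑ y,
        bil (if x = y then V.R i else (1 / 2 : ℝ) • (V.G i + (V.G i)ᵀ))
          (succDiff b c d x) (succDiff b c d y) := by
  rw [PsiBar, bil_smul, Matrix.mul_assoc, bil_mul, bil_transpose, bil, dotProduct_comm,
    ← mulVec_mulVec, T_mulVec_stack]
  have := bil_Psi (V.R i) (V.G i) (succDiff b c d)
  rw [bil] at this
  rw [← this]
  rfl

/-- The value of the quadratic form of `Ξ_i` along the error dynamics. -/
lemma bil_Xi (hR : (V.R i).IsHermitian) {a b : Fin n → ℝ} {c : Fin (S.p i) → Fin n → ℝ}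
    {d : Fin n → ℝ} {e f : Fin (S.p i) → Fin n → ℝ} {w : Fin mw ⊕ Fin mv → ℝ}
    (ha : a = (S.A - g.L i * S.C i) *ᵥ b + (S.B - g.L i * S.D i) *ᵥ w
      + (g.K i * S.H i) *ᵥ (∑ ν, f ν - ∑ ν, c ν)) :
    bil (Xi S g γ V i) (xiVec S i a b c d e f w) (xiVec S i a b c d e f w) =
      2 * bil (V.Y i)⁻¹ a b + S.τ i ^ 2 * bil (V.R i) a a
      + (∑ j ∈ outNbhd S.graph i, S.τ j ^ 2) * bil (V.W i) a a
      + ((S.p i : ℝ) + S.q i) / γ ^ 2 * (b ⬝ᵥ b) + 2 * V.α i * bil (V.Y i)⁻¹ b b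
      + bil (V.S i) b b - Real.exp (-2 * V.α i * S.τ i) * bil (V.S i) d d
      - Real.exp (-2 * V.α i * S.τ i) * (∑ x, ∑ y,
        bil (if x = y then V.R i else (1 / 2 : ℝ) • (V.G i + (V.G i)ᵀ))
          (succDiff b c d x) (succDiff b c d y))
      - 2 / γ ^ 2 * (b ⬝ᵥ ∑ ν, e ν)
      - ∑ ν, (V.ϖ (nbr S.graph i ν) * bil (V.Y (nbr S.graph i ν))⁻¹ (e ν) (e ν)
        + Real.pi ^ 2 / 4 * (bil (V.W (nbr S.graph i ν)) (e ν) (e ν)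
          - 2 * bil (V.W (nbr S.graph i ν)) (e ν) (f ν)
          + bil (V.W (nbr S.graph i ν)) (f ν) (f ν)))
      - w ⬝ᵥ w := by
  rw [← bil_PsiBar, bil_partition (PsiBar_transpose S V i hR)]
  -- The error equation paired with an arbitrary multiplier y. It is used below with y = Z a, X b
  -- and Q Σf, which removes the free matrices Z, X, Q from the form.
  have hdot : ∀ y : Fin n → ℝ, y ⬝ᵥ a = y ⬝ᵥ (S.A - g.L i * S.C i) *ᵥ b
      + y ⬝ᵥ (S.B - g.L i * S.D i) *ᵥ w
      + (y ⬝ᵥ (g.K i * S.H i) *ᵥ (∑ ν, f ν) - y ⬝ᵥ (g.K i * S.H i) *ᵥ (∑ ν, c ν)) := by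
    intro y
    conv_lhs => rw [ha]
    rw [dotProduct_add, dotProduct_add, mulVec_sub, dotProduct_sub]
  have h1 := hdot (V.Z i *ᵥ a)
  have h2 := hdot (V.X i *ᵥ b)
  have h3 := hdot (V.Q i *ᵥ ∑ ν, f ν)
  have hZ : bil (V.Z i) a a = (V.Z i *ᵥ a) ⬝ᵥ a := by rw [bil, dotProduct_comm]
  have hX : bil (V.X i) a b = (V.X i *ᵥ b) ⬝ᵥ a := by rw [bil, dotProduct_comm]
  have hQ : bil (V.Q i) a (∑ ν, f ν) = (V.Q i *ᵥ ∑ ν, f ν) ⬝ᵥ a := by rw [bil, dotProduct_comm]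
  have hKH : (S.H i)ᵀ * (g.K i)ᵀ = (g.K i * S.H i)ᵀ := by rw [transpose_mul]
  simp only [Xi, xiVec, bil_symBlock, bil_fromCols, bil_zero, XiAA, XiAB, XiAC, XiAF, XiAG, XiBB,
    XiBC, XiBE, XiBF, XiBG, XiCF, XiFF, XiFG, PsiTilde₁₁, PsiTilde₁₂, PsiTilde₁₃, PsiTilde₂₂,
    PsiTilde₂₃, PsiTilde₃₃, PhiBar₁₁, PhiBar₁₂, PhiBar₂₂, bil_add, bil_sub, bil_neg, bil_smul,
    bil_one, bil_rowRep, bil_sqRep, bil_colRep, bil_diagBlocks, bil_transpose, hKH,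
    Matrix.mul_assoc (V.Z i)ᵀ, Matrix.mul_assoc (V.X i)ᵀ, Matrix.mul_assoc (V.Q i)ᵀ,
    bil_transpose_mul, rowRep_mulVec_stack]
  rw [hZ, hX, hQ]
  simp only [Finset.sum_add_distrib, Finset.sum_sub_distrib, mul_add, mul_sub, ← Finset.mul_sum]
  rw [dotProduct_comm ((S.A - g.L i * S.C i) *ᵥ b) (V.X i *ᵥ b),
    dotProduct_comm ((S.A - g.L i * S.C i) *ᵥ b) (V.Q i *ᵥ ∑ ν, f ν),
    dotProduct_comm ((g.K i * S.H i) *ᵥ ∑ ν, c ν) (V.Q i *ᵥ ∑ ν, f ν),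
    dotProduct_comm ((g.K i * S.H i) *ᵥ ∑ ν, f ν) (V.Q i *ᵥ ∑ ν, f ν)]
  -- The terms of Ξ_i in Z, X, Q are twice (Z a + X b + Q Σf) against the residual of the error
  -- equation, which is zero.
  linear_combination (-2) * h1 - 2 * h2 - 2 * h3

end XiForm

/-! ### The Lyapunov–Krasovskii functional -/

section Functional

/-- The increment of a moving-window integral. -/
lemma window_integral_sub {φ : ℝ → ℝ} (hφ : Continuous φ) (τ a b : ℝ) :
    (∫ t in (b - τ)..b, φ t) - ∫ t in (a - τ)..a, φ t = ∫ t in a..b, (φ t - φ (t - τ)) := by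
  have hi := fun x y => hφ.intervalIntegrable (μ := volume) x y
  have hs : Continuous fun t => φ (t - τ) := hφ.comp (continuous_id.sub continuous_const)
  have hP : ∀ x y, ∫ t in x..y, φ t = (∫ t in (0 : ℝ)..y, φ t) - ∫ t in (0 : ℝ)..x, φ t :=
    fun x y => (intervalIntegral.integral_interval_sub_left (hi _ _) (hi _ _)).symm
  rw [intervalIntegral.integral_sub (hi a b) (hs.intervalIntegrable a b),
    intervalIntegral.integral_comp_sub_right (fun t => φ t) τ, hP (b - τ), hP (a - τ) a, hP a,
    hP (a - τ) (b - τ)]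
  ring

variable {N n mw mv : ℕ} (S : Network N n mw mv) (V : LMIVars N n)

/-- The weight `e^{-2 α_i τ_i}`. -/
def wt (i : Fin N) : ℝ := Real.exp (-2 * V.α i * S.τ i)

lemma wt_pos (i : Fin N) : 0 < wt S V i := Real.exp_pos _

variable (e f : Fin N → ℝ → Fin n → ℝ)

/-- A primitive of the quadratic form of `R_i` along the derivative. -/
def energyR (i : Fin N) (t : ℝ) : ℝ := ∫ s in (0 : ℝ)..t, bil (V.R i) (f i s) (f i s)

/-- The part of the functional that belongs to node `i`. -/
def nodeFun (i : Fin N) (t : ℝ) : ℝ :=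
  bil (V.Y i)⁻¹ (e i t) (e i t)
    + wt S V i * (∫ s in (t - S.τ i)..t, bil (V.S i) (e i s) (e i s))
    + wt S V i * S.τ i * (S.τ i * energyR V f i t - ∫ s in (t - S.τ i)..t, energyR V f i s)

/-- The derivative of `nodeFun`. -/
def nodeRate (i : Fin N) (t : ℝ) : ℝ :=
  2 * bil (V.Y i)⁻¹ (e i t) (f i t)
    + wt S V i * (bil (V.S i) (e i t) (e i t)
      - bil (V.S i) (e i (t - S.τ i)) (e i (t - S.τ i)))
    + wt S V i * S.τ i * (S.τ i * bil (V.R i) (f i t) (f i t)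
      - (energyR V f i t - energyR V f i (t - S.τ i)))

/-- The part of the functional that belongs to the channel from `j` to `i` with a sample taken
at time `s`. -/
def edgeFun (i j : Fin N) (s t : ℝ) : ℝ :=
  S.τ i ^ 2 * (∫ u in s..t, bil (V.W j) (f j u) (f j u))
    - Real.pi ^ 2 / 4 * ∫ u in s..t, bil (V.W j) (e j u - e j s) (e j u - e j s)

/-- The derivative of `edgeFun`. -/
def edgeRate (i j : Fin N) (s t : ℝ) : ℝ :=
  S.τ i ^ 2 * bil (V.W j) (f j t) (f j t)
    - Real.pi ^ 2 / 4 * bil (V.W j) (e j t - e j s) (e j t - e j s)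

/-- The Lyapunov–Krasovskii functional on `[t_k, t_{k+1}]`. -/
def lyap (k : ℕ) (t : ℝ) : ℝ :=
  ∑ i, nodeFun S V e f i t
    + ∑ i, ∑ j ∈ nbhd S.graph i, edgeFun S V e f i j (S.sampleTime i k j) t

variable {S V e f}

lemma continuous_energyR {i : Fin N} (h : HasL2Deriv (e i) (f i)) : Continuous (energyR V f i) :=
  intervalIntegral.continuous_primitive (fun a b => h.intervalIntegrable_bil h _ a b) 0

lemma energyR_sub {i : Fin N} (h : HasL2Deriv (e i) (f i)) (a b : ℝ) :
    energyR V f i b - energyR V f i a = ∫ s in a..b, bil (V.R i) (f i s) (f i s) :=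
  intervalIntegral.integral_interval_sub_left (h.intervalIntegrable_bil h _ _ _)
    (h.intervalIntegrable_bil h _ _ _)

lemma energyR_mono {i : Fin N} (h : HasL2Deriv (e i) (f i)) (hR : (V.R i).PosSemidef) :
    Monotone (energyR V f i) := fun a b hab => by
  rw [← sub_nonneg, energyR_sub h]
  exact intervalIntegral.integral_nonneg hab fun s _ => bil_self_nonneg hR _

lemma intervalIntegrable_nodeRate {i : Fin N} (h : HasL2Deriv (e i) (f i)) (a b : ℝ) :
    IntervalIntegrable (nodeRate S V e f i) volume a b := by
  have hc := h.continuous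
  have hG := continuous_energyR (V := V) h
  have h1 := (h.intervalIntegrable_bil_continuous (V.Y i)⁻¹
    (hc.continuousOn (s := uIcc a b))).const_mul 2
  have h2 := (continuous_bil (V.S i) hc hc)
  have h3 : Continuous fun t => bil (V.S i) (e i (t - S.τ i)) (e i (t - S.τ i)) :=
    h2.comp (continuous_id.sub continuous_const)
  have h4 : Continuous fun t => energyR V f i (t - S.τ i) :=
    hG.comp (continuous_id.sub continuous_const)
  exact (h1.add (((h2.sub h3).intervalIntegrable a b).const_mul _)).add
    ((((h.intervalIntegrable_bil h (V.R i) a b).const_mul _).sub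
      ((hG.sub h4).intervalIntegrable a b)).const_mul _)

lemma nodeFun_sub {i : Fin N} (h : HasL2Deriv (e i) (f i)) (hY : (V.Y i).PosDef) (a b : ℝ) :
    nodeFun S V e f i b - nodeFun S V e f i a = ∫ t in a..b, nodeRate S V e f i t := by
  have hc := h.continuous
  have hG := continuous_energyR (V := V) h
  have h1 := (h.intervalIntegrable_bil_continuous (V.Y i)⁻¹
    (hc.continuousOn (s := uIcc a b))).const_mul 2
  have h2 := (continuous_bil (V.S i) hc hc)
  have h3 : Continuous fun t => bil (V.S i) (e i (t - S.τ i)) (e i (t - S.τ i)) :=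
    h2.comp (continuous_id.sub continuous_const)
  have h4 : Continuous fun t => energyR V f i (t - S.τ i) :=
    hG.comp (continuous_id.sub continuous_const)
  have h5 : IntervalIntegrable (fun t => wt S V i * (bil (V.S i) (e i t) (e i t)
      - bil (V.S i) (e i (t - S.τ i)) (e i (t - S.τ i)))) volume a b :=
    ((h2.sub h3).intervalIntegrable a b).const_mul _
  have h6 := ((h.intervalIntegrable_bil h (V.R i) a b).const_mul (S.τ i))
  have h7 : IntervalIntegrable (fun t => energyR V f i t - energyR V f i (t - S.τ i)) volume a b :=
    (hG.sub h4).intervalIntegrable a b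
  simp only [nodeRate]
  rw [intervalIntegral.integral_add (h1.add h5) ((h6.sub h7).const_mul _),
    intervalIntegral.integral_add h1 h5, h.integral_two_bil hY.inv.1,
    intervalIntegral.integral_const_mul, intervalIntegral.integral_const_mul,
    intervalIntegral.integral_sub h6 h7, intervalIntegral.integral_const_mul,
    ← window_integral_sub h2, ← window_integral_sub hG, ← energyR_sub h, nodeFun, nodeFun]
  ring

lemma intervalIntegrable_edgeRate {j : Fin N} (h : HasL2Deriv (e j) (f j)) (i : Fin N)
    (s a b : ℝ) : IntervalIntegrable (edgeRate S V e f i j s) volume a b := by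
  have hd : Continuous fun u => e j u - e j s := h.continuous.sub continuous_const
  exact ((h.intervalIntegrable_bil h _ a b).const_mul _).sub
    (((continuous_bil (V.W j) hd hd).intervalIntegrable a b).const_mul _)

lemma edgeFun_sub {j : Fin N} (h : HasL2Deriv (e j) (f j)) (i : Fin N) (s a b : ℝ) :
    edgeFun S V e f i j s b - edgeFun S V e f i j s a = ∫ t in a..b, edgeRate S V e f i j s t := by
  have hd : Continuous fun u => e j u - e j s := h.continuous.sub continuous_const
  have hq := continuous_bil (V.W j) hd hd
  have hi := fun x y => hq.intervalIntegrable (μ := volume) x y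
  have hf := fun x y => h.intervalIntegrable_bil h (V.W j) x y
  simp only [edgeRate]
  rw [intervalIntegral.integral_sub ((hf _ _).const_mul _) ((hi _ _).const_mul _),
    intervalIntegral.integral_const_mul, intervalIntegral.integral_const_mul,
    ← intervalIntegral.integral_interval_sub_left (hf s b) (hf s a),
    ← intervalIntegral.integral_interval_sub_left (hi s b) (hi s a), edgeFun, edgeFun]
  ring

/-- This is Wirtinger's inequality for e_j − e_j(s) on [s, t], an interval no longer than τ_i. -/
lemma edgeFun_nonneg {j : Fin N} (h : HasL2Deriv (e j) (f j)) (hW : (V.W j).PosSemidef)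
    {i : Fin N} {s t : ℝ} (hst : s ≤ t) (ht : t - s ≤ S.τ i) : 0 ≤ edgeFun S V e f i j s t :=
  sub_nonneg.2 (h.wirtinger hW hst ht)

/-- The functional does not increase at the sampling instants. -/
lemma lyap_succ_le (h : ∀ i, HasL2Deriv (e i) (f i)) (hW : ∀ i, (V.W i).PosSemidef)
    (hτ : ∀ i, BddAbove (Set.range (S.pollGap i))) (k : ℕ) :
    lyap S V e f (k + 1) (S.t (k + 1)) ≤ lyap S V e f k (S.t (k + 1)) := by
  rw [lyap, lyap]
  gcongr with i _ j hj
  -- Either the sample is kept and the term is unchanged, or it is renewed and a nonnegative term is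
  -- replaced by zero.
  rcases S.sampleTime_succ i k hj with hs | hs
  · rw [hs]
  · rw [hs, show edgeFun S V e f i j (S.t (k + 1)) (S.t (k + 1)) = 0 by simp [edgeFun]]
    refine edgeFun_nonneg (h j) (hW j) ?_ ?_
    · exact (S.sampleTime_le i k j).trans (S.t_strictMono.monotone (Nat.le_succ k))
    · linarith [S.t_succ_sub_τ_le_sampleTime i hτ k hj]

/-- The other two terms are nonnegative. With E the nondecreasing primitive of ė'Rė, the expression
τE(t) − ∫E over [t − τ, t] compares E with its largest value on the window; it is the usual double
integral of ė'Rė and does not depend on the base point of E. -/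
lemma le_nodeFun {i : Fin N} (h : HasL2Deriv (e i) (f i)) (hS : (V.S i).PosSemidef)
    (hR : (V.R i).PosSemidef) (hτ : ∀ i, BddAbove (Set.range (S.pollGap i))) (t : ℝ) :
    bil (V.Y i)⁻¹ (e i t) (e i t) ≤ nodeFun S V e f i t := by
  have hτ0 := S.τ_nonneg i hτ
  have hw := (wt_pos S V i).le
  have h1 : 0 ≤ ∫ s in (t - S.τ i)..t, bil (V.S i) (e i s) (e i s) :=
    intervalIntegral.integral_nonneg (by linarith) fun s _ => bil_self_nonneg hS _
  have h2 : ∫ s in (t - S.τ i)..t, energyR V f i s ≤ S.τ i * energyR V f i t := by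
    have := intervalIntegral.integral_mono_on (μ := volume) (by linarith : t - S.τ i ≤ t)
      ((continuous_energyR h).intervalIntegrable _ _)
      (intervalIntegrable_const (c := energyR V f i t)) fun s hs => energyR_mono h hR hs.2
    simpa using this
  have h3 := mul_nonneg hw h1
  have h4 := mul_nonneg (mul_nonneg hw hτ0) (sub_nonneg.2 h2)
  rw [nodeFun]
  linarith

lemma sum_bil_le_lyap (h : ∀ i, HasL2Deriv (e i) (f i)) (hS : ∀ i, (V.S i).PosSemidef)
    (hR : ∀ i, (V.R i).PosSemidef) (hW : ∀ i, (V.W i).PosSemidef)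
    (hτ : ∀ i, BddAbove (Set.range (S.pollGap i))) {k : ℕ} {t : ℝ}
    (ht : t ∈ Icc (S.t k) (S.t (k + 1))) :
    ∑ i, bil (V.Y i)⁻¹ (e i t) (e i t) ≤ lyap S V e f k t := by
  rw [lyap]
  have h1 : ∑ i, bil (V.Y i)⁻¹ (e i t) (e i t) ≤ ∑ i, nodeFun S V e f i t :=
    Finset.sum_le_sum fun i _ => le_nodeFun (h i) (hS i) (hR i) hτ t
  have h2 : 0 ≤ ∑ i, ∑ j ∈ nbhd S.graph i, edgeFun S V e f i j (S.sampleTime i k j) t :=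
    Finset.sum_nonneg fun i _ => Finset.sum_nonneg fun j hj =>
      edgeFun_nonneg (h j) (hW j) ((S.sampleTime_le i k j).trans ht.1)
        (by linarith [S.t_succ_sub_τ_le_sampleTime i hτ k hj, ht.2])
  linarith

end Functional

/-! ### The dissipation inequality -/

section Dissipation

variable {N n mw mv : ℕ}

lemma sum_nbr {E : Type*} [AddCommMonoid E] (G : Digraph (Fin N)) (i : Fin N) (φ : Fin N → E) :
    ∑ ν, φ (nbr G i ν) = ∑ j ∈ nbhd G i, φ j := by
  conv_rhs => rw [← Finset.map_orderEmbOfFin_univ (nbhd G i) rfl]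
  rw [Finset.sum_map]
  rfl

lemma sum_nbhd_comm {E : Type*} [AddCommMonoid E] (G : Digraph (Fin N)) (φ : Fin N → Fin N → E) :
    ∑ i, ∑ j ∈ nbhd G i, φ i j = ∑ j, ∑ i ∈ outNbhd G j, φ i j :=
  Finset.sum_comm' fun i j => by simp [outNbhd]

/-- `e` satisfies the error dynamics from time `a₀` on, and is absolutely continuous with locally
square integrable derivative `f` on the whole line. -/
structure IsMotion (S : Network N n mw mv) (g : Gains S) (a₀ : ℝ)
    (ξ : Fin N → ℝ → Fin mw ⊕ Fin mv → ℝ) (e f : Fin N → ℝ → Fin n → ℝ) : Prop where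
  hasL2Deriv : ∀ i, HasL2Deriv (e i) (f i)
  eq : ∀ i, ∀ k : ℕ, ∀ t, a₀ ≤ t → t ∈ Ico (S.t k) (S.t (k + 1)) →
    f i t = (S.A - g.L i * S.C i) *ᵥ e i t + (S.B - g.L i * S.D i) *ᵥ ξ i t
      + (g.K i * S.H i) *ᵥ ∑ j ∈ nbhd S.graph i,
          (e j (S.sampleTime i k j) - e i (S.sampleTime i k j))

variable {S : Network N n mw mv} {g : Gains S} {γ : ℝ} {V : LMIVars N n}
  {ξ : Fin N → ℝ → Fin mw ⊕ Fin mv → ℝ} {e f : Fin N → ℝ → Fin n → ℝ} {a₀ : ℝ}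

/-- The reciprocally convex bound along the sampling instants in use. -/
lemma sum_succDiff_le {i : Fin N} (h : HasL2Deriv (e i) (f i)) (hR : (V.R i).PosSemidef)
    (hRG : (fromBlocks (V.R i) (V.G i) (V.G i)ᵀ (V.R i)).PosSemidef)
    (hτ : ∀ i, BddAbove (Set.range (S.pollGap i))) {k : ℕ} {t : ℝ}
    (ht : t ∈ Icc (S.t k) (S.t (k + 1))) :
    ∑ x, ∑ y, bil (if x = y then V.R i else (1 / 2 : ℝ) • (V.G i + (V.G i)ᵀ))
      (succDiff (e i t) (fun ν : Fin (S.p i) => e i (S.tExt ((k : ℤ) - (ν : ℕ))))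
        (e i (t - S.τ i)) x)
      (succDiff (e i t) (fun ν : Fin (S.p i) => e i (S.tExt ((k : ℤ) - (ν : ℕ))))
        (e i (t - S.τ i)) y) ≤
    S.τ i * (energyR V f i t - energyR V f i (t - S.τ i)) := by
  have hτ0 := S.τ_nonneg i hτ
  -- The partition t ≥ t_k ≥ … ≥ t_{k−p+1} ≥ t − τ_i, with x m = t_{k−m+1} for 1 ≤ m ≤ p. The
  -- truncated difference m − 1 is evaluated only for m ≥ 1.
  set x : ℕ → ℝ := fun m => if m = 0 then t else if m ≤ S.p i then
    S.tExt ((k : ℤ) - (m - 1 : ℕ)) else t - S.τ i with hx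
  -- The last inequality of the partition: t ≤ t_{k+1}, and τ_i is at least t_{k+1} − t_{k−p+1}.
  have hlast : ∀ m : ℕ, m ≤ S.p i - 1 → 1 ≤ S.p i → t - S.τ i ≤ S.tExt ((k : ℤ) - m) := by
    intro m hm hp
    have h1 := S.t_succ_sub_τ_le i hτ k
    have h2 : S.tExt ((k : ℤ) - S.p i + 1) ≤ S.tExt ((k : ℤ) - m) := S.tExt_mono (by omega)
    linarith [ht.2]
  have hmono : ∀ m ≤ S.p i, x (m + 1) ≤ x m := by
    intro m hm
    rcases Nat.eq_zero_or_pos m with rfl | hm0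
    · by_cases hp : 1 ≤ S.p i
      · simp only [hx, zero_add, one_ne_zero, if_false, if_true, hp]
        simpa [S.tExt_natCast] using ht.1
      · simp only [hx, zero_add, one_ne_zero, if_false, if_true, hp]
        linarith
    · by_cases hp : m + 1 ≤ S.p i
      · simp only [hx, hm0.ne', Nat.succ_ne_zero, if_false, hp, hm, if_true]
        exact S.tExt_mono (by omega)
      · simp only [hx, hm0.ne', Nat.succ_ne_zero, if_false, hp, hm, if_true]
        exact hlast _ (by omega) (by omega)
  have hdiff : ∀ a : Fin (S.p i + 1),
      succDiff (e i t) (fun ν : Fin (S.p i) => e i (S.tExt ((k : ℤ) - (ν : ℕ))))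
        (e i (t - S.τ i)) a = e i (x a) - e i (x (a + 1)) := by
    have hsnoc : ∀ a : Fin (S.p i + 1), (Fin.snoc (α := fun _ => Fin n → ℝ)
        (fun ν : Fin (S.p i) => e i (S.tExt ((k : ℤ) - (ν : ℕ)))) (e i (t - S.τ i)) :
          Fin (S.p i + 1) → Fin n → ℝ) a = e i (x (a + 1)) := by
      intro a
      refine Fin.lastCases ?_ (fun b => ?_) a
      · simp [hx]
      · have : (b : ℕ) + 1 ≤ S.p i := b.2
        simp [hx, this]
    have hcons : ∀ a : Fin (S.p i + 2), (Fin.cons (α := fun _ => Fin n → ℝ) (e i t)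
        (Fin.snoc (α := fun _ => Fin n → ℝ)
        (fun ν : Fin (S.p i) => e i (S.tExt ((k : ℤ) - (ν : ℕ)))) (e i (t - S.τ i)) :
          Fin (S.p i + 1) → Fin n → ℝ) : Fin (S.p i + 2) → Fin n → ℝ) a = e i (x a) := by
      intro a
      refine Fin.cases ?_ (fun b => ?_) a
      · simp [hx]
      · rw [Fin.cons_succ, hsnoc, Fin.val_succ]
    intro a
    rw [succDiff, hcons, hsnoc, Fin.val_castSucc]
  have := h.reciprocally_convex hR hRG (S.p i) hmono
  have h0 : x 0 = t := by simp [hx]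
  have h1 : x (S.p i + 1) = t - S.τ i := by simp [hx]
  rw [h0, h1, sub_sub_cancel] at this
  rw [energyR_sub h]
  simpa only [hdiff] using this

/-- The argument of the form `Ξ_i` at time `t`. -/
def motionVec (S : Network N n mw mv) (ξ : Fin N → ℝ → Fin mw ⊕ Fin mv → ℝ)
    (e f : Fin N → ℝ → Fin n → ℝ) (i : Fin N) (k : ℕ) (t : ℝ) : XiIndex S i → ℝ :=
  xiVec S i (f i t) (e i t) (fun ν => e i (S.tExt ((k : ℤ) - (ν : ℕ)))) (e i (t - S.τ i))
    (fun ν => e (nbr S.graph i ν) t)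
    (fun ν => e (nbr S.graph i ν) (S.sampleTime i k (nbr S.graph i ν))) (ξ i t)

/-- The blocks a and b of the argument are ė_i and e_i, so Ξ_i ≤ −εI leaves a multiple of |e_i|² +
|ė_i|² as dissipation. -/
lemma le_motionVec_dotProduct (i : Fin N) (k : ℕ) (t : ℝ) :
    e i t ⬝ᵥ e i t + f i t ⬝ᵥ f i t ≤ motionVec S ξ e f i k t ⬝ᵥ motionVec S ξ e f i k t := by
  simp only [motionVec, xiVec, sumElim_dotProduct_sumElim]
  have h1 := dotProduct_self_nonneg'
    (stack fun ν : Fin (S.p i) => e i (S.tExt ((k : ℤ) - (ν : ℕ))))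
  have h2 := dotProduct_self_nonneg' (e i (t - S.τ i))
  have h3 := dotProduct_self_nonneg' (stack fun ν => e (nbr S.graph i ν) t)
  have h4 := dotProduct_self_nonneg'
    (stack fun ν => e (nbr S.graph i ν) (S.sampleTime i k (nbr S.graph i ν)))
  have h5 := dotProduct_self_nonneg' (ξ i t)
  linarith

/-- The derivative of the part of the functional at node `i`, with the channels that arrive at
`i`, in terms of the form `Ξ_i`. -/
lemma nodeRate_le (hm : IsMotion S g a₀ ξ e f) {i : Fin N} (hY : (V.Y i).PosDef)
    (hS : (V.S i).PosSemidef) (hR : (V.R i).PosSemidef) (hW : ∀ j, (V.W j).PosSemidef)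
    (hα : 0 < V.α i) (hRG : (fromBlocks (V.R i) (V.G i) (V.G i)ᵀ (V.R i)).PosSemidef)
    (hτ : ∀ i, BddAbove (Set.range (S.pollGap i))) {k : ℕ} {t : ℝ} (ha : a₀ ≤ t)
    (ht : t ∈ Ico (S.t k) (S.t (k + 1))) :
    nodeRate S V e f i t
      + ∑ j ∈ nbhd S.graph i, edgeRate S V e f i j (S.sampleTime i k j) t ≤
    bil (Xi S g γ V i) (motionVec S ξ e f i k t) (motionVec S ξ e f i k t)
      + ξ i t ⬝ᵥ ξ i t
      - (∑ j ∈ outNbhd S.graph i, S.τ j ^ 2) * bil (V.W i) (f i t) (f i t)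
      + ∑ j ∈ nbhd S.graph i, S.τ i ^ 2 * bil (V.W j) (f j t) (f j t)
      - ((S.p i : ℝ) + S.q i) / γ ^ 2 * (e i t ⬝ᵥ e i t)
      - 2 * V.α i * bil (V.Y i)⁻¹ (e i t) (e i t)
      + ∑ j ∈ nbhd S.graph i, V.ϖ j * bil (V.Y j)⁻¹ (e j t) (e j t)
      + 2 / γ ^ 2 * ∑ j ∈ nbhd S.graph i, e i t ⬝ᵥ e j t := by
  have hτ0 := S.τ_nonneg i hτ
  have hrec := sum_succDiff_le (hm.hasL2Deriv i) hR hRG hτ (Ico_subset_Icc_self ht)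
  have hw0 := wt_pos S V i
  -- The functional carries S and τ²R with weight e^{-2ατ}, whereas Ξ_i carries them with weight one
  -- at time t. The difference has the right sign.
  have hw1 : wt S V i ≤ 1 := by
    refine Real.exp_le_one_iff.2 ?_
    nlinarith
  have heq := hm.eq i k t ha ht
  -- The coupling becomes the sum of the neighbours' samples, indexed by neighbour, minus the sum of
  -- the node's own samples, indexed by time, as in blocks f and c.
  rw [Finset.sum_sub_distrib, S.sum_sampleTime i k (e i),
    ← sum_nbr S.graph i fun j => e j (S.sampleTime i k j)] at heq
  have hX := bil_Xi S g γ V i hR.1 heq (d := e i (t - S.τ i))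
    (e := fun ν => e (nbr S.graph i ν) t)
  rw [motionVec, hX]
  have hedge : ∑ j ∈ nbhd S.graph i, edgeRate S V e f i j (S.sampleTime i k j) t =
      ∑ j ∈ nbhd S.graph i, S.τ i ^ 2 * bil (V.W j) (f j t) (f j t)
      - ∑ j ∈ nbhd S.graph i, Real.pi ^ 2 / 4 * (bil (V.W j) (e j t) (e j t)
          - 2 * bil (V.W j) (e j t) (e j (S.sampleTime i k j))
          + bil (V.W j) (e j (S.sampleTime i k j)) (e j (S.sampleTime i k j))) := by
    rw [← Finset.sum_sub_distrib]
    refine Finset.sum_congr rfl fun j _ => ?_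
    simp only [edgeRate, bil_sub_left, bil_sub_right]
    rw [bil_comm_of_isHermitian (hW j).1 (e j (S.sampleTime i k j)) (e j t)]
    ring
  rw [hedge, sum_nbr S.graph i fun j => V.ϖ j * bil (V.Y j)⁻¹ (e j t) (e j t)
        + Real.pi ^ 2 / 4 * (bil (V.W j) (e j t) (e j t)
          - 2 * bil (V.W j) (e j t) (e j (S.sampleTime i k j))
          + bil (V.W j) (e j (S.sampleTime i k j)) (e j (S.sampleTime i k j))),
    sum_nbr S.graph i fun j => e j t, dotProduct_sum, Finset.sum_add_distrib, nodeRate,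
    bil_comm_of_isHermitian hY.inv.1 (f i t) (e i t)]
  have h1 := mul_le_mul_of_nonneg_right hw1 (bil_self_nonneg hS (e i t))
  have h2 := mul_le_mul_of_nonneg_right hw1
    (mul_nonneg (sq_nonneg (S.τ i)) (bil_self_nonneg hR (f i t)))
  have h3 := mul_le_mul_of_nonneg_left hrec hw0.le
  change _ ≤ _ - wt S V i * _ - wt S V i * _ - _ - _ - _ + _ - _ + _ - _ - _ + _ + _
  linarith

/-- The disagreement of the errors at time `t`. -/
def disagreeRate (S : Network N n mw mv) (e : Fin N → ℝ → Fin n → ℝ) (t : ℝ) : ℝ :=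
  ∑ i, ∑ j ∈ nbhd S.graph i, (e j t - e i t) ⬝ᵥ (e j t - e i t)

/-- The square of the state and of its derivative. -/
def sqRate (e f : Fin N → ℝ → Fin n → ℝ) (t : ℝ) : ℝ :=
  ∑ i, (e i t ⬝ᵥ e i t + f i t ⬝ᵥ f i t)

lemma sqRate_nonneg (t : ℝ) : 0 ≤ sqRate e f t :=
  Finset.sum_nonneg fun _ _ => add_nonneg (dotProduct_self_nonneg' _) (dotProduct_self_nonneg' _)

lemma disagreeRate_nonneg (t : ℝ) : 0 ≤ disagreeRate S e t :=
  Finset.sum_nonneg fun _ _ => Finset.sum_nonneg fun _ _ => dotProduct_self_nonneg' _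

/-- Expand the squares and count edges: node i appears p_i times as a receiver and q_i times as a
sender. -/
lemma disagreeRate_eq (t : ℝ) :
    disagreeRate S e t = ∑ i, ((S.p i : ℝ) + S.q i) * (e i t ⬝ᵥ e i t)
      - 2 * ∑ i, ∑ j ∈ nbhd S.graph i, e i t ⬝ᵥ e j t := by
  have h1 : ∑ i, ∑ j ∈ nbhd S.graph i, e j t ⬝ᵥ e j t = ∑ i, (S.q i : ℝ) * (e i t ⬝ᵥ e i t) := by
    rw [sum_nbhd_comm]
    simp [Network.q, outDeg]
  have h2 : ∑ i, ∑ j ∈ nbhd S.graph i, e i t ⬝ᵥ e i t = ∑ i, (S.p i : ℝ) * (e i t ⬝ᵥ e i t) := by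
    simp [Network.p, inDeg]
  simp only [add_mul, Finset.sum_add_distrib]
  rw [← h1, ← h2, disagreeRate, Finset.mul_sum, ← Finset.sum_add_distrib,
    ← Finset.sum_sub_distrib]
  refine Finset.sum_congr rfl fun i _ => ?_
  rw [Finset.mul_sum, ← Finset.sum_add_distrib, ← Finset.sum_sub_distrib]
  refine Finset.sum_congr rfl fun j _ => ?_
  simp only [sub_dotProduct, dotProduct_sub]
  rw [dotProduct_comm (e j t) (e i t)]
  ring

/-- The hypotheses on the solution of the matrix inequalities, with `Ξ_i ≤ -ε I`. -/
structure Feasible (S : Network N n mw mv) (g : Gains S) (γ : ℝ) (V : LMIVars N n) (ε : ℝ) :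
    Prop where
  bdd : ∀ i, BddAbove (Set.range (S.pollGap i))
  posY : ∀ i, (V.Y i).PosDef
  posW : ∀ i, (V.W i).PosSemidef
  posS : ∀ i, (V.S i).PosSemidef
  posR : ∀ i, (V.R i).PosSemidef
  posα : ∀ i, 0 < V.α i
  ϖ_lt : ∀ i, (S.q i : ℝ) * V.ϖ i < 2 * V.α i
  park : ∀ i, (fromBlocks (V.R i) (V.G i) (V.G i)ᵀ (V.R i)).PosSemidef
  posε : 0 < ε
  xi : ∀ i v, ε * (v ⬝ᵥ v) ≤ bil (-Xi S g γ V i) v v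

/-- The dissipation rate. -/
def supplyRate (S : Network N n mw mv) (γ ε : ℝ) (ξ : Fin N → ℝ → Fin mw ⊕ Fin mv → ℝ)
    (e f : Fin N → ℝ → Fin n → ℝ) (t : ℝ) : ℝ :=
  ∑ i, ξ i t ⬝ᵥ ξ i t - 1 / γ ^ 2 * disagreeRate S e t - ε * sqRate e f t

/-- Summation over the nodes closes the estimate: quantities of the senders that appear at each
receiver are regrouped by sender and meet the matching terms there. -/
lemma lyapRate_le {ε : ℝ} (hF : Feasible S g γ V ε) (hm : IsMotion S g a₀ ξ e f) {k : ℕ} {t : ℝ}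
    (ha : a₀ ≤ t) (ht : t ∈ Ico (S.t k) (S.t (k + 1))) :
    ∑ i, nodeRate S V e f i t
      + ∑ i, ∑ j ∈ nbhd S.graph i, edgeRate S V e f i j (S.sampleTime i k j) t ≤
    supplyRate S γ ε ξ e f t := by
  rw [← Finset.sum_add_distrib]
  refine (Finset.sum_le_sum fun i _ => nodeRate_le (γ := γ) hm (hF.posY i) (hF.posS i) (hF.posR i)
    hF.posW (hF.posα i) (hF.park i) hF.bdd ha ht).trans ?_
  simp only [Finset.sum_add_distrib, Finset.sum_sub_distrib]
  have hxi : ∑ i, bil (Xi S g γ V i) (motionVec S ξ e f i k t) (motionVec S ξ e f i k t) ≤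
      -(ε * sqRate e f t) := by
    rw [sqRate, Finset.mul_sum, ← Finset.sum_neg_distrib]
    refine Finset.sum_le_sum fun i _ => ?_
    have h1 := hF.xi i (motionVec S ξ e f i k t)
    rw [bil_neg] at h1
    have h2 := mul_le_mul_of_nonneg_left
      (le_motionVec_dotProduct (S := S) (ξ := ξ) (e := e) (f := f) i k t) hF.posε.le
    linarith
  have hW : ∑ i, ∑ j ∈ nbhd S.graph i, S.τ i ^ 2 * bil (V.W j) (f j t) (f j t) =
      ∑ i, (∑ j ∈ outNbhd S.graph i, S.τ j ^ 2) * bil (V.W i) (f i t) (f i t) := by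
    rw [sum_nbhd_comm]
    simp only [Finset.sum_mul]
  -- Regrouped by sender, π_j occurs q_j times, and q_jπ_j < 2α_j.
  have hϖ : ∑ i, ∑ j ∈ nbhd S.graph i, V.ϖ j * bil (V.Y j)⁻¹ (e j t) (e j t) ≤
      ∑ i, 2 * V.α i * bil (V.Y i)⁻¹ (e i t) (e i t) := by
    rw [sum_nbhd_comm]
    refine Finset.sum_le_sum fun i _ => ?_
    rw [Finset.sum_const, nsmul_eq_mul, ← mul_assoc]
    exact mul_le_mul_of_nonneg_right (hF.ϖ_lt i).le
      (bil_self_nonneg (hF.posY i).inv.posSemidef _)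
  have hd := disagreeRate_eq (S := S) (e := e) t
  have hd' : ∑ i, ((S.p i : ℝ) + S.q i) / γ ^ 2 * (e i t ⬝ᵥ e i t)
      - ∑ i, 2 / γ ^ 2 * ∑ j ∈ nbhd S.graph i, e i t ⬝ᵥ e j t = 1 / γ ^ 2 * disagreeRate S e t := by
    rw [hd, mul_sub, Finset.mul_sum, ← Finset.mul_sum]
    congr 1
    · exact Finset.sum_congr rfl fun i _ => by ring
    · ring
  rw [supplyRate]
  linarith

lemma intervalIntegrable_dotProduct_deriv {i : Fin N} (h : HasL2Deriv (e i) (f i)) (a b : ℝ) :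
    IntervalIntegrable (fun t => f i t ⬝ᵥ f i t) volume a b := by
  simpa only [bil_one] using h.intervalIntegrable_bil h 1 a b

lemma continuous_dotProduct' {u v : ℝ → Fin n → ℝ} (hu : Continuous u) (hv : Continuous v) :
    Continuous fun t => u t ⬝ᵥ v t := by
  simpa only [bil_one] using continuous_bil 1 hu hv

lemma intervalIntegrable_sqRate (h : ∀ i, HasL2Deriv (e i) (f i)) (a b : ℝ) :
    IntervalIntegrable (sqRate e f) volume a b :=
  intervalIntegrable_fun_sum fun i _ =>
    ((continuous_dotProduct' (h i).continuous (h i).continuous).intervalIntegrable a b).add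
      (intervalIntegrable_dotProduct_deriv (h i) a b)

lemma continuous_disagreeRate (h : ∀ i, Continuous (e i)) : Continuous (disagreeRate S e) :=
  continuous_finsetSum _ fun i _ => continuous_finsetSum _ fun j _ =>
    continuous_dotProduct' ((h j).sub (h i)) ((h j).sub (h i))

lemma intervalIntegrable_supplyRate {ε : ℝ} (h : ∀ i, HasL2Deriv (e i) (f i)) {a b : ℝ}
    (hξ : ∀ i, IntervalIntegrable (fun t => ξ i t ⬝ᵥ ξ i t) volume a b) :
    IntervalIntegrable (supplyRate S γ ε ξ e f) volume a b :=
  ((intervalIntegrable_fun_sum fun i _ => hξ i).sub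
    (((continuous_disagreeRate fun i => (h i).continuous).intervalIntegrable a b).const_mul _)).sub
      ((intervalIntegrable_sqRate h a b).const_mul _)

/-- The dissipation inequality between two sampling instants. -/
lemma lyap_le_of_mem_Icc {ε : ℝ} (hF : Feasible S g γ V ε) (hm : IsMotion S g a₀ ξ e f) {k : ℕ}
    {a b : ℝ} (ha : a₀ ≤ a) (hka : S.t k ≤ a) (hab : a ≤ b) (hbk : b ≤ S.t (k + 1))
    (hξ : ∀ i, IntervalIntegrable (fun t => ξ i t ⬝ᵥ ξ i t) volume a b) :
    lyap S V e f k b ≤ lyap S V e f k a + ∫ t in a..b, supplyRate S γ ε ξ e f t := by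
  have h := hm.hasL2Deriv
  have hn : ∀ i ∈ (Finset.univ : Finset (Fin N)),
      IntervalIntegrable (nodeRate S V e f i) volume a b :=
    fun i _ => intervalIntegrable_nodeRate (h i) a b
  have he : ∀ i ∈ (Finset.univ : Finset (Fin N)), ∀ j ∈ nbhd S.graph i,
      IntervalIntegrable (edgeRate S V e f i j (S.sampleTime i k j)) volume a b :=
    fun i _ j _ => intervalIntegrable_edgeRate (h j) i _ a b
  have hsub : lyap S V e f k b - lyap S V e f k a = ∫ t in a..b, (∑ i, nodeRate S V e f i t
      + ∑ i, ∑ j ∈ nbhd S.graph i, edgeRate S V e f i j (S.sampleTime i k j) t) := by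
    rw [intervalIntegral.integral_add (intervalIntegrable_fun_sum hn)
      (intervalIntegrable_fun_sum fun i hi => intervalIntegrable_fun_sum (he i hi)),
      intervalIntegral.integral_finsetSum hn, intervalIntegral.integral_finsetSum
        fun i hi => intervalIntegrable_fun_sum (he i hi), lyap, lyap, add_sub_add_comm,
      ← Finset.sum_sub_distrib, ← Finset.sum_sub_distrib]
    congr 1
    · exact Finset.sum_congr rfl fun i _ => nodeFun_sub (h i) (hF.posY i) a b
    · refine Finset.sum_congr rfl fun i hi => ?_
      rw [intervalIntegral.integral_finsetSum (he i hi), ← Finset.sum_sub_distrib]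
      exact Finset.sum_congr rfl fun j _ => edgeFun_sub (h j) i _ a b
  rw [← sub_le_iff_le_add', hsub]
  -- Only the open interval may be used: at b = t_{k+1} the coupling has already changed.
  refine intervalIntegral.integral_mono_on_of_le_Ioo hab
    ((intervalIntegrable_fun_sum hn).add
      (intervalIntegrable_fun_sum fun i hi => intervalIntegrable_fun_sum (he i hi)))
    (intervalIntegrable_supplyRate h hξ) fun t ht => ?_
  exact lyapRate_le hF hm (ha.trans ht.1.le) ⟨hka.trans ht.1.le, ht.2.trans_le hbk⟩

/-- The dissipation inequality. -/
lemma lyap_le {ε : ℝ} (hF : Feasible S g γ V ε) (hm : IsMotion S g a₀ ξ e f)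
    (hξ : ∀ i a b, a₀ ≤ a → a ≤ b →
      IntervalIntegrable (fun t => ξ i t ⬝ᵥ ξ i t) volume a b) {k l : ℕ} (hkl : k ≤ l)
    {a b : ℝ} (ha : a₀ ≤ a) (hka : a ∈ Icc (S.t k) (S.t (k + 1))) (hab : a ≤ b)
    (hlb : b ∈ Icc (S.t l) (S.t (l + 1))) :
    lyap S V e f l b ≤ lyap S V e f k a + ∫ t in a..b, supplyRate S γ ε ξ e f t := by
  induction l, hkl using Nat.le_induction generalizing b with
  | base => exact lyap_le_of_mem_Icc hF hm ha hka.1 hab hlb.2 fun i => hξ i a b ha hab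
  | succ l hkl ih =>
    have hal : a ≤ S.t (l + 1) :=
      hka.2.trans (S.t_strictMono.monotone (Nat.succ_le_succ hkl))
    have h1 := ih hal ⟨S.t_strictMono.monotone (Nat.le_succ l), le_rfl⟩
    -- At t_{l+1} the functional passes from its l-th to its (l+1)-st expression without increasing;
    -- this joins the two pieces.
    have h2 := lyap_succ_le hm.hasL2Deriv hF.posW hF.bdd l (V := V)
    have h3 := lyap_le_of_mem_Icc hF hm (ha.trans hal) le_rfl hlb.1 hlb.2
      fun i => hξ i _ _ (ha.trans hal) hlb.1
    have h4 := intervalIntegral.integral_add_adjacent_intervals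
      (intervalIntegrable_supplyRate (S := S) (γ := γ) (ε := ε) hm.hasL2Deriv
        fun i => hξ i a _ ha hal)
      (intervalIntegrable_supplyRate (S := S) (γ := γ) (ε := ε) hm.hasL2Deriv
        fun i => hξ i _ _ (ha.trans hal) hlb.1)
    linarith

end Dissipation

/-! ### Solutions of the error dynamics as absolutely continuous functions -/

section Motion

variable {N n mw mv : ℕ} (S : Network N n mw mv)

namespace Network

lemma exists_lt_t_succ (t : ℝ) : ∃ k, t < S.t (k + 1) := by
  obtain ⟨k, hk⟩ := (S.t_tendsto.eventually_gt_atTop t).exists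
  exact ⟨k, hk.trans (S.t_strictMono (Nat.lt_succ_self k))⟩

open scoped Classical in
/-- The index of the sampling interval that contains `t`. -/
def idx (t : ℝ) : ℕ := Nat.find (S.exists_lt_t_succ t)

lemma lt_t_idx_succ (t : ℝ) : t < S.t (S.idx t + 1) := by
  classical exact Nat.find_spec (S.exists_lt_t_succ t)

lemma idx_le {t : ℝ} {k : ℕ} (h : t < S.t (k + 1)) : S.idx t ≤ k := by
  classical exact Nat.find_min' (S.exists_lt_t_succ t) h

lemma idx_mono : Monotone S.idx := fun _ b hab => S.idx_le (hab.trans_lt (S.lt_t_idx_succ b))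

lemma t_idx_le {t : ℝ} (ht : 0 ≤ t) : S.t (S.idx t) ≤ t := by
  rcases h : S.idx t with _ | k
  · rwa [S.t_zero]
  · by_contra! hlt
    have := S.idx_le hlt
    omega

lemma mem_Ico_idx {t : ℝ} (ht : 0 ≤ t) : t ∈ Ico (S.t (S.idx t)) (S.t (S.idx t + 1)) :=
  ⟨S.t_idx_le ht, S.lt_t_idx_succ t⟩

lemma idx_eq {t : ℝ} {k : ℕ} (h : t ∈ Ico (S.t k) (S.t (k + 1))) : S.idx t = k := by
  refine le_antisymm (S.idx_le h.2) ?_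
  have := S.t_strictMono.lt_iff_lt.1 (h.1.trans_lt (S.lt_t_idx_succ t))
  omega

end Network

variable {S} (g : Gains S) (ξ : Fin N → ℝ → Fin mw ⊕ Fin mv → ℝ) (e : Fin N → ℝ → Fin n → ℝ)
  (s₀ : ℝ)

/-- The coupling term in use on `[t_k, t_{k+1})`. -/
def coupling (i : Fin N) (k : ℕ) : Fin n → ℝ :=
  (g.K i * S.H i) *ᵥ ∑ j ∈ nbhd S.graph i,
    (e j (S.sampleTime i k j) - e i (S.sampleTime i k j))

/-- The right-hand side of the error dynamics on `[t_k, t_{k+1})`. -/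
def errorField (i : Fin N) (k : ℕ) (t : ℝ) : Fin n → ℝ :=
  (S.A - g.L i * S.C i) *ᵥ e i t + (S.B - g.L i * S.D i) *ᵥ ξ i t + coupling g e i k

/-- The error with its history before `s₀` replaced by a constant. -/
def frozen (i : Fin N) (t : ℝ) : Fin n → ℝ := e i (max t s₀)

/-- The derivative of `frozen`. -/
def frozenDeriv (i : Fin N) (t : ℝ) : Fin n → ℝ :=
  (Ici s₀).indicator (fun t => errorField g ξ e i (S.idx t) t) t

variable {g ξ e s₀}

lemma frozen_of_le {i : Fin N} {t : ℝ} (ht : s₀ ≤ t) : frozen e s₀ i t = e i t := by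
  rw [frozen, max_eq_left ht]

lemma continuous_frozen (he : ∀ i, ContinuousOn (e i) (Ici s₀)) (i : Fin N) :
    Continuous (frozen e s₀ i) :=
  (he i).comp_continuous (continuous_id.max continuous_const) fun t => mem_Ici.2 (le_max_right t s₀)

lemma memLp_of_continuous {φ : ℝ → ℝ} (hφ : Continuous φ) (a b : ℝ) :
    MemLp φ 2 (volume.restrict (Ioc a b)) := by
  obtain ⟨C, hC⟩ := isCompact_Icc.exists_bound_of_continuousOn (hφ.continuousOn (s := Icc a b))
  exact MemLp.of_bound hφ.aestronglyMeasurable C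
    ((ae_restrict_mem measurableSet_Ioc).mono fun t ht => hC t (Ioc_subset_Icc_self ht))

/-- A function of the sampling index is square integrable on bounded intervals. -/
lemma memLp_comp_idx (φ : ℕ → ℝ) (a b : ℝ) :
    MemLp (fun t => φ (S.idx t)) 2 (volume.restrict (Ioc a b)) := by
  have hmeas : Measurable fun t => φ (S.idx t) :=
    (measurable_from_nat (f := φ)).comp S.idx_mono.measurable
  refine MemLp.of_bound hmeas.aestronglyMeasurable (∑ k ∈ Finset.range (S.idx b + 1), ‖φ k‖)
    ((ae_restrict_mem measurableSet_Ioc).mono fun t ht => ?_)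
  exact Finset.single_le_sum (f := fun k => ‖φ k‖) (fun k _ => norm_nonneg _)
    (Finset.mem_range.2 (Nat.lt_succ_of_le (S.idx_mono ht.2)))

lemma memLp_mulVec {ι ι' : Type} [Fintype ι'] (M : Matrix ι ι' ℝ) {u : ℝ → ι' → ℝ}
    {μ : Measure ℝ} (hu : ∀ c, MemLp (fun t => u t c) 2 μ) (c : ι) :
    MemLp (fun t => (M *ᵥ u t) c) 2 μ := by
  simp only [mulVec, dotProduct]
  exact memLp_finsetSum _ fun d _ => (hu d).const_mul _

lemma memLp_frozenDeriv (he : ∀ i, ContinuousOn (e i) (Ici s₀))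
    (hξ : ∀ i c, MemLp (fun t => ξ i t c) 2 (volume.restrict (Ici s₀))) (i : Fin N) (a b : ℝ)
    (c : Fin n) : MemLp (fun t => frozenDeriv g ξ e s₀ i t c) 2 (volume.restrict (Ioc a b)) := by
  have h1 : (fun t => frozenDeriv g ξ e s₀ i t c) = (Ici s₀).indicator fun t =>
      ((S.A - g.L i * S.C i) *ᵥ frozen e s₀ i t) c + ((S.B - g.L i * S.D i) *ᵥ ξ i t) c
        + coupling g e i (S.idx t) c := by
    ext t
    by_cases ht : t ∈ Ici s₀
    · simp only [frozenDeriv, indicator_of_mem ht, errorField, frozen_of_le ht, Pi.add_apply]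
    · simp only [frozenDeriv, indicator_of_notMem ht, Pi.zero_apply]
  rw [h1, memLp_indicator_iff_restrict measurableSet_Ici]
  have hc := continuous_frozen he i
  refine MemLp.add (MemLp.add ?_ ?_) ?_
  · exact memLp_mulVec _ (fun d => (memLp_of_continuous (by fun_prop) a b).mono_measure
      Measure.restrict_le_self) c
  · exact memLp_mulVec _ (fun d => (hξ i d).mono_measure
      (Measure.restrict_mono_measure Measure.restrict_le_self _)) c
  · exact (memLp_comp_idx (fun k => coupling g e i k c) a b).mono_measure Measure.restrict_le_self

/-- A solution of the error dynamics is absolutely continuous, with the right-hand side as its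
derivative. -/
lemma IsErrorTrajectory.hasL2Deriv (hs₀ : 0 ≤ s₀) (he : IsErrorTrajectory S g s₀ ξ e)
    (hξ : ∀ i c, MemLp (fun t => ξ i t c) 2 (volume.restrict (Ici s₀))) (i : Fin N) :
    HasL2Deriv (frozen e s₀ i) (frozenDeriv g ξ e s₀ i) := by
  have hmem := memLp_frozenDeriv (g := g) he.cont hξ i
  have hint : ∀ c a b, IntervalIntegrable (fun t => frozenDeriv g ξ e s₀ i t c) volume a b :=
    fun c a b => ⟨(hmem a b c).integrable one_le_two, (hmem b a c).integrable one_le_two⟩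
  -- Inside one sampling interval the index `idx` is constant, so `frozenDeriv` agrees with the
  -- right-hand side there; the endpoints form a null set.
  have hpiece : ∀ k c a b, s₀ ≤ a → S.t k ≤ a → a ≤ b → b ≤ S.t (k + 1) →
      e i b c - e i a c = ∫ s in a..b, frozenDeriv g ξ e s₀ i s c := by
    intro k c a b ha hka hab hbk
    have heq : EqOn (fun s => frozenDeriv g ξ e s₀ i s) (errorField g ξ e i k) (Ioo a b) := by
      intro s hs
      have h1 : s ∈ Ici s₀ := ha.trans hs.1.le
      simp only [frozenDeriv, indicator_of_mem h1,
        S.idx_eq ⟨hka.trans hs.1.le, hs.2.trans_le hbk⟩]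
    have hvec : IntervalIntegrable (errorField g ξ e i k) volume a b := by
      have h1 : Integrable (frozenDeriv g ξ e s₀ i) (volume.restrict (Ioc a b)) :=
        Integrable.of_eval fun c => (hint c a b).1
      have h2 : IntegrableOn (frozenDeriv g ξ e s₀ i) (Ioo a b) :=
        IntegrableOn.mono_set h1 Ioo_subset_Ioc_self
      rw [intervalIntegrable_iff_integrableOn_Ioo_of_le hab]
      exact h2.congr_fun heq measurableSet_Ioo
    have h3 := congrFun (he.eq i k a b ha hka hab hbk) c
    rw [Pi.add_apply] at h3
    have h4 := ContinuousLinearMap.intervalIntegral_comp_comm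
      (ContinuousLinearMap.proj (R := ℝ) (φ := fun _ : Fin n => ℝ) c) hvec
    simp only [ContinuousLinearMap.proj_apply] at h4
    rw [h3]
    change e i a c + (∫ s in a..b, errorField g ξ e i k s) c - e i a c = _
    rw [← h4, add_sub_cancel_left, intervalIntegral.integral_of_le hab,
      intervalIntegral.integral_of_le hab,
      integral_Ioc_eq_integral_Ioo, integral_Ioc_eq_integral_Ioo]
    exact setIntegral_congr_fun measurableSet_Ioo fun s hs => (congrFun (heq hs) c).symm
  -- The pieces are glued by induction over the sampling intervals that lie between s₀ and b.
  have hstart : ∀ k c b, s₀ ≤ b → b ≤ S.t k →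
      e i b c - e i s₀ c = ∫ s in s₀..b, frozenDeriv g ξ e s₀ i s c := by
    intro k
    induction k with
    | zero =>
      intro c b hb hbk
      rw [S.t_zero] at hbk
      obtain rfl : b = s₀ := le_antisymm (hbk.trans hs₀) hb
      simp
    | succ k ih =>
      intro c b hb hbk
      rcases le_total b (S.t k) with h | h
      · exact ih c b hb h
      · rcases le_total s₀ (S.t k) with h' | h'
        · rw [← intervalIntegral.integral_add_adjacent_intervals (hint c s₀ (S.t k))
            (hint c (S.t k) b), ← ih c _ h' le_rfl, ← hpiece k c _ b h' le_rfl h hbk]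
          ring
        · exact hpiece k c s₀ b le_rfl h' hb hbk
  have hall : ∀ c b, frozen e s₀ i b c - e i s₀ c = ∫ s in s₀..b, frozenDeriv g ξ e s₀ i s c := by
    intro c b
    rcases le_total s₀ b with hb | hb
    · rw [frozen_of_le hb]
      exact hstart _ c b hb (S.lt_t_idx_succ b).le
    · rw [frozen, max_eq_right hb, sub_self, intervalIntegral.integral_symm,
        intervalIntegral.integral_of_le hb, integral_Ioc_eq_integral_Ioo,
        setIntegral_eq_zero_of_forall_eq_zero, neg_zero]
      intro s hs
      simp [frozenDeriv, hs.2]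
  refine ⟨hmem, fun a b c => ?_⟩
  rw [← intervalIntegral.integral_interval_sub_left (hint c s₀ b) (hint c s₀ a), ← hall, ← hall]
  ring

/-- Freezing the history does not alter the dynamics once every sample in use was taken at or after
s₀, which is what `hsample` provides from a₀ on. -/
lemma IsErrorTrajectory.isMotion (hs₀ : 0 ≤ s₀) (he : IsErrorTrajectory S g s₀ ξ e)
    (hξ : ∀ i c, MemLp (fun t => ξ i t c) 2 (volume.restrict (Ici s₀))) {a₀ : ℝ} (ha₀ : s₀ ≤ a₀)
    (hsample : ∀ i k t, a₀ ≤ t → t < S.t (k + 1) → ∀ j ∈ nbhd S.graph i,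
      s₀ ≤ S.sampleTime i k j) :
    IsMotion S g a₀ ξ (frozen e s₀) (frozenDeriv g ξ e s₀) where
  hasL2Deriv := he.hasL2Deriv hs₀ hξ
  eq i k t ht hk := by
    have h1 : t ∈ Ici s₀ := ha₀.trans ht
    simp only [frozenDeriv, indicator_of_mem h1, S.idx_eq hk, errorField, coupling,
      frozen_of_le (ha₀.trans ht)]
    congr 2
    refine Finset.sum_congr rfl fun j hj => ?_
    rw [frozen_of_le (hsample i k t ht hk.2 j hj), frozen_of_le (hsample i k t ht hk.2 j hj)]

end Motion

/-! ### Consensus performance -/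

section Performance

variable {N n mw mv : ℕ} {S : Network N n mw mv} {g : Gains S} {γ : ℝ} {V : LMIVars N n}

lemma eucl_sq {ι : Type} [Fintype ι] (v : ι → ℝ) : eucl v ^ 2 = v ⬝ᵥ v := by
  rw [eucl, EuclideanSpace.real_norm_sq_eq]
  simp [dotProduct, pow_two]

lemma intervalIntegrable_mulVec {ι ι' : Type} [Fintype ι] [Fintype ι'] (M : Matrix ι ι' ℝ)
    {u : ℝ → ι' → ℝ} {a b : ℝ} (hu : IntervalIntegrable u volume a b) :
    IntervalIntegrable (fun t => M *ᵥ u t) volume a b :=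
  ⟨ContinuousLinearMap.integrable_comp (LinearMap.toContinuousLinearMap M.mulVecLin) hu.1,
    ContinuousLinearMap.integrable_comp (LinearMap.toContinuousLinearMap M.mulVecLin) hu.2⟩

/-- The estimation errors satisfy the error dynamics. -/
lemma IsTrajectory.isErrorTrajectory {x₀ : Fin n → ℝ} {w : ℝ → Fin mw → ℝ}
    {v : Fin N → ℝ → Fin mv → ℝ} {x : ℝ → Fin n → ℝ} {xh : Fin N → ℝ → Fin n → ℝ}
    (hL : IsL2 w v) (ht : IsTrajectory S g x₀ w v x xh) :
    IsErrorTrajectory S g 0 (pert w v) fun i t => x t - xh i t where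
  cont i := (ht.plant_cont.sub (ht.obs_cont i)).continuousOn
  eq i k a b ha hka hab hbk := by
    have hpert : ∀ c d, 0 ≤ c → c ≤ d → IntervalIntegrable (pert w v i) volume c d := by
      intro c d hc hcd
      rw [intervalIntegrable_iff_integrableOn_Ioc_of_le hcd]
      have h1 : MemLp (pert w v i) 2 (volume.restrict (Ioc c d)) :=
        (hL i).mono_measure (Measure.restrict_mono
          (Ioc_subset_Ioi_self.trans (Ioi_subset_Ioi hc)) le_rfl)
      exact h1.integrable one_le_two
    -- Square integrability is assumed for the stacked perturbation, so the disturbance terms are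
    -- rewritten through `pert` before integrability is used.
    have hB : ∀ s, S.B₂ *ᵥ w s = S.B *ᵥ pert w v i s := fun s => by
      rw [Network.B, pert, fromCols_mulVec_sumElim, zero_mulVec, add_zero]
    have hD : ∀ s, S.D₂ i *ᵥ w s + S.Dbar₂ i *ᵥ v i s = S.D i *ᵥ pert w v i s := fun s => by
      rw [Network.D, pert, fromCols_mulVec_sumElim]
    have hxc := ht.plant_cont
    have hhc := ht.obs_cont i
    set φ : ℝ → Fin n → ℝ := fun s => S.A *ᵥ x s + S.B₂ *ᵥ w s with hφ
    set ψ : ℝ → Fin n → ℝ := fun s => S.A *ᵥ xh i s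
      + g.L i *ᵥ (measurement S x w v i s - S.C i *ᵥ xh i s)
      + g.K i *ᵥ ∑ j ∈ nbhd S.graph i,
        S.H i *ᵥ (xh j (S.sampleTime i k j) - xh i (S.sampleTime i k j)) with hψ
    have hφi : ∀ c d, 0 ≤ c → c ≤ d → IntervalIntegrable φ volume c d := by
      intro c d hc hcd
      simp only [hφ, hB]
      exact (intervalIntegrable_mulVec _ (hxc.intervalIntegrable c d)).add
        (intervalIntegrable_mulVec _ (hpert c d hc hcd))
    have hψi : ∀ c d, 0 ≤ c → c ≤ d → IntervalIntegrable ψ volume c d := by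
      intro c d hc hcd
      simp only [hψ, measurement, add_assoc (S.C i *ᵥ _), hD]
      have hy : IntervalIntegrable (fun s => S.C i *ᵥ x s + S.D i *ᵥ pert w v i s
          - S.C i *ᵥ xh i s) volume c d :=
        ((intervalIntegrable_mulVec (S.C i) (hxc.intervalIntegrable c d)).add
          (intervalIntegrable_mulVec (S.D i) (hpert c d hc hcd))).sub
            (intervalIntegrable_mulVec (S.C i) (hhc.intervalIntegrable c d))
      exact ((intervalIntegrable_mulVec S.A (hhc.intervalIntegrable c d)).add
        (intervalIntegrable_mulVec (g.L i) hy)).add intervalIntegrable_const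
    have hk0 := S.t_nonneg k
    have hx : x b - x a = ∫ s in a..b, φ s := by
      rw [ht.plant_eq a ha, ht.plant_eq b (ha.trans hab), add_sub_add_left_eq_sub]
      exact intervalIntegral.integral_interval_sub_left (hφi 0 b le_rfl (ha.trans hab))
        (hφi 0 a le_rfl ha)
    have hh : xh i b - xh i a = ∫ s in a..b, ψ s := by
      rw [ht.obs_eq i k a ⟨hka, hab.trans hbk⟩, ht.obs_eq i k b ⟨hka.trans hab, hbk⟩,
        add_sub_add_left_eq_sub]
      exact intervalIntegral.integral_interval_sub_left (hψi _ b hk0 (hka.trans hab))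
        (hψi _ a hk0 hka)
    have hsub : x b - xh i b = x a - xh i a + ∫ s in a..b, (φ s - ψ s) := by
      rw [intervalIntegral.integral_sub (hφi a b ha hab) (hψi a b ha hab), ← hx, ← hh]
      abel
    rw [hsub]
    congr 1
    refine intervalIntegral.integral_congr fun s _ => ?_
    -- The plant state cancels from the coupling: e_j − e_i = −(x̂_j − x̂_i).
    have hsum : ∑ j ∈ nbhd S.graph i, (x (S.sampleTime i k j) - xh j (S.sampleTime i k j)
        - (x (S.sampleTime i k j) - xh i (S.sampleTime i k j))) =
        -∑ j ∈ nbhd S.graph i, (xh j (S.sampleTime i k j) - xh i (S.sampleTime i k j)) := by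
      rw [← Finset.sum_neg_distrib]
      exact Finset.sum_congr rfl fun j _ => by abel
    have hH : ∑ j ∈ nbhd S.graph i, S.H i *ᵥ (xh j (S.sampleTime i k j)
        - xh i (S.sampleTime i k j)) = S.H i *ᵥ ∑ j ∈ nbhd S.graph i,
          (xh j (S.sampleTime i k j) - xh i (S.sampleTime i k j)) :=
      (map_sum (S.H i).mulVecLin _ _).symm
    simp only [hφ, hψ, measurement, add_assoc (S.C i *ᵥ _), hD, hB, hsum, hH]
    simp only [sub_mulVec, mulVec_sub, mulVec_add, mulVec_neg, ← mulVec_mulVec]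
    abel

/-- The value of the functional at time zero for a constant history. -/
lemma lyap_zero_le {e f : Fin N → ℝ → Fin n → ℝ} {x₀ : Fin n → ℝ} {ε : ℝ}
    (hF : Feasible S g γ V ε) (hN : 1 ≤ N) (he : ∀ i, ∀ t ≤ 0, e i t = x₀)
    (hf : ∀ i, ∀ t < 0, f i t = 0) :
    lyap S V e f 0 0 ≤ N * (x₀ ⬝ᵥ weightP S V *ᵥ x₀) := by
  have hedge : ∀ i j, edgeFun S V e f i j (S.sampleTime i 0 j) 0 = 0 := by
    intro i j
    have h1 := S.sampleTime_le i 0 j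
    rw [S.t_zero] at h1
    rw [le_antisymm h1 (S.sampleTime_nonneg i 0 j)]
    simp [edgeFun]
  have hen : ∀ i, ∀ t ≤ 0, energyR V f i t = 0 := by
    intro i t ht
    rw [energyR, intervalIntegral.integral_symm, intervalIntegral.integral_of_le ht,
      integral_Ioc_eq_integral_Ioo, setIntegral_eq_zero_of_forall_eq_zero, neg_zero]
    intro s hs
    rw [hf i s hs.2, bil_zero_left]
  have hN0 : (N : ℝ) ≠ 0 := by positivity
  have hP : N * (x₀ ⬝ᵥ weightP S V *ᵥ x₀) = ∑ i, (bil (V.Y i)⁻¹ x₀ x₀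
      + (1 - wt S V i) / (2 * V.α i) * bil (V.S i) x₀ x₀) := by
    change N * bil (weightP S V) x₀ x₀ = _
    rw [weightP, bil_smul, ← mul_assoc, mul_one_div_cancel hN0, one_mul, bil, sum_mulVec,
      dotProduct_sum]
    refine Finset.sum_congr rfl fun i _ => ?_
    change bil ((V.Y i)⁻¹ + _) x₀ x₀ = _
    rw [bil_add, bil_smul, wt]
  rw [hP, lyap]
  simp only [hedge, Finset.sum_const_zero, add_zero]
  refine Finset.sum_le_sum fun i _ => ?_
  have hτ0 := S.τ_nonneg i hF.bdd
  have hα := hF.posα i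
  have hint : ∫ s in (0 - S.τ i)..0, bil (V.S i) (e i s) (e i s) =
      S.τ i * bil (V.S i) x₀ x₀ := by
    rw [intervalIntegral.integral_congr (g := fun _ => bil (V.S i) x₀ x₀)]
    · simp
    · intro s hs
      rw [uIcc_of_le (by linarith)] at hs
      simp only [he i s hs.2]
  have hint' : ∫ s in (0 - S.τ i)..0, energyR V f i s = 0 := by
    rw [intervalIntegral.integral_congr (g := fun _ => 0)]
    · simp
    · intro s hs
      rw [uIcc_of_le (by linarith)] at hs
      exact hen i s hs.2
  rw [nodeFun, hint, hint', hen i 0 le_rfl, he i 0 le_rfl, mul_zero, sub_zero, mul_zero, add_zero,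
    ← mul_assoc]
  -- This is 1 + 2ατ ≤ e^{2ατ} multiplied by e^{-2ατ}. It compares the constant-weight window
  -- integral at time zero with the coefficient of S in P.
  have hw : wt S V i * S.τ i ≤ (1 - wt S V i) / (2 * V.α i) := by
    rw [le_div_iff₀ (by positivity)]
    have h1 := Real.add_one_le_exp (2 * V.α i * S.τ i)
    have h2 : wt S V i * Real.exp (2 * V.α i * S.τ i) = 1 := by
      rw [wt, ← Real.exp_add, show -2 * V.α i * S.τ i + 2 * V.α i * S.τ i = 0 by ring,
        Real.exp_zero]
    have h3 := mul_le_mul_of_nonneg_left h1 (wt_pos S V i).le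
    linarith
  have := mul_le_mul_of_nonneg_right hw (bil_self_nonneg (hF.posS i) x₀)
  linarith

lemma integrableOn_dotProduct_pert {w : ℝ → Fin mw → ℝ} {v : Fin N → ℝ → Fin mv → ℝ}
    (hL : IsL2 w v) (i : Fin N) :
    IntegrableOn (fun t => pert w v i t ⬝ᵥ pert w v i t) (Ioi 0) :=
  integrable_finsetSum _ fun c _ => ((hL i).eval c).integrable_mul ((hL i).eval c)

/-- The bound on the disagreement up to a sampling instant. -/
lemma integral_disagreeRate_le {ε : ℝ} (hF : Feasible S g γ V ε) (hN : 1 ≤ N) (hγ : 0 < γ)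
    {x₀ : Fin n → ℝ} {w : ℝ → Fin mw → ℝ} {v : Fin N → ℝ → Fin mv → ℝ} {x : ℝ → Fin n → ℝ}
    {xh : Fin N → ℝ → Fin n → ℝ} (hL : IsL2 w v) (ht : IsTrajectory S g x₀ w v x xh) (k : ℕ) :
    ∫ t in (0 : ℝ)..S.t k, disagreeRate S (fun i t => x t - xh i t) t ≤
      γ ^ 2 * (N * (x₀ ⬝ᵥ weightP S V *ᵥ x₀)
        + ∫ t in (0 : ℝ)..S.t k, ∑ i, pert w v i t ⬝ᵥ pert w v i t) := by
  set e : Fin N → ℝ → Fin n → ℝ := fun i t => x t - xh i t with he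
  have hpast : ∀ i, ∀ t ≤ 0, e i t = x₀ := by
    intro i t h
    simp only [he, ht.plant_init t h, ht.obs_init i t h, sub_zero]
  -- The history is the constant x₀, so freezing at time zero changes nothing. Sample times are
  -- never negative, so the dynamics can be used from a₀ = 0.
  have hfr : frozen e 0 = e := by
    ext i t c
    rcases le_total 0 t with h | h
    · rw [frozen_of_le h]
    · rw [frozen, max_eq_right h, hpast i t h, hpast i 0 le_rfl]
  have hcomp : ∀ i c, MemLp (fun t => pert w v i t c) 2 (volume.restrict (Ici 0)) := by
    intro i c
    rw [← restrict_Ioi_eq_restrict_Ici]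
    exact (hL i).eval c
  have hm := (ht.isErrorTrajectory hL).isMotion le_rfl hcomp le_rfl
    fun i k t _ _ j _ => S.sampleTime_nonneg i k j
  rw [hfr] at hm
  have hξ : ∀ i a b, 0 ≤ a → a ≤ b →
      IntervalIntegrable (fun t => pert w v i t ⬝ᵥ pert w v i t) volume a b := by
    intro i a b ha hab
    rw [intervalIntegrable_iff_integrableOn_Ioc_of_le hab]
    exact (integrableOn_dotProduct_pert hL i).mono_set
      (Ioc_subset_Ioi_self.trans (Ioi_subset_Ioi ha))
  have hk0 := S.t_nonneg k
  have hstep : ∀ l, S.t l ∈ Icc (S.t l) (S.t (l + 1)) :=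
    fun l => ⟨le_rfl, S.t_strictMono.monotone (Nat.le_succ l)⟩
  have h0 : (0 : ℝ) ∈ Icc (S.t 0) (S.t (0 + 1)) := S.t_zero ▸ hstep 0
  have hdis := lyap_le hF hm hξ (Nat.zero_le k) le_rfl h0 hk0 (hstep k)
  have hlow := sum_bil_le_lyap hm.hasL2Deriv hF.posS hF.posR hF.posW hF.bdd (hstep k) (V := V)
  have hnn : 0 ≤ ∑ i, bil (V.Y i)⁻¹ (e i (S.t k)) (e i (S.t k)) :=
    Finset.sum_nonneg fun i _ => bil_self_nonneg (hF.posY i).inv.posSemidef _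
  have hup := lyap_zero_le (f := frozenDeriv g (pert w v) e 0) hF hN hpast
    fun i t h => by simp [frozenDeriv, h]
  have hi1 : IntervalIntegrable (fun t => ∑ i, pert w v i t ⬝ᵥ pert w v i t) volume 0 (S.t k) :=
    intervalIntegrable_fun_sum fun i _ => hξ i _ _ le_rfl hk0
  have hi2 : IntervalIntegrable (disagreeRate S e) volume 0 (S.t k) :=
    (continuous_disagreeRate fun i => (hm.hasL2Deriv i).continuous).intervalIntegrable _ _
  have hsup : ∫ t in (0 : ℝ)..S.t k,
      supplyRate S γ ε (pert w v) e (frozenDeriv g (pert w v) e 0) t ≤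
      (∫ t in (0 : ℝ)..S.t k, ∑ i, pert w v i t ⬝ᵥ pert w v i t)
        - 1 / γ ^ 2 * ∫ t in (0 : ℝ)..S.t k, disagreeRate S e t := by
    rw [← intervalIntegral.integral_const_mul, ← intervalIntegral.integral_sub hi1
      (hi2.const_mul _)]
    refine intervalIntegral.integral_mono_on hk0
      (intervalIntegrable_supplyRate hm.hasL2Deriv fun i => hξ i _ _ le_rfl hk0)
      (hi1.sub (hi2.const_mul _)) fun t _ => ?_
    have := mul_nonneg hF.posε.le
      (sqRate_nonneg (e := e) (f := frozenDeriv g (pert w v) e 0) t)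
    rw [supplyRate]
    linarith
  have hfin : 1 / γ ^ 2 * ∫ t in (0 : ℝ)..S.t k, disagreeRate S e t ≤
      N * (x₀ ⬝ᵥ weightP S V *ᵥ x₀)
        + ∫ t in (0 : ℝ)..S.t k, ∑ i, pert w v i t ⬝ᵥ pert w v i t := by
    linarith
  rwa [one_div_mul_eq_div, div_le_iff₀' (by positivity)] at hfin

lemma posDef_weightP {ε : ℝ} (hF : Feasible S g γ V ε) (hN : 1 ≤ N) : (weightP S V).PosDef := by
  have hN' : (0 : ℝ) < 1 / N := by positivity
  have : Nonempty (Fin N) := ⟨⟨0, hN⟩⟩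
  refine (Matrix.posDef_sum Finset.univ_nonempty fun i _ => ?_).smul hN'
  refine (hF.posY i).inv.add_posSemidef ((hF.posS i).smul (div_nonneg ?_ ?_))
  · rw [sub_nonneg]
    refine Real.exp_le_one_iff.2 ?_
    nlinarith [hF.posα i, S.τ_nonneg i hF.bdd]
  · linarith [hF.posα i]

/-- The bound holds up to every sampling instant with a right-hand side independent of it, and
exhausting (0, ∞) by the intervals (0, t_k] gives it for the full integral. Finiteness of the
disagreement is a consequence, not a premise. -/
lemma consensusPerformance {ε : ℝ} (hF : Feasible S g γ V ε) (hN : 1 ≤ N) (hγ : 0 < γ) :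
    ConsensusPerformance S g γ (weightP S V) := by
  rw [ConsensusPerformance]
  refine iSup_le fun x₀ => iSup_le fun w => iSup_le fun v => iSup_le fun x => iSup_le fun xh =>
    iSup_le fun hL => iSup_le fun _ => iSup_le fun ht => ENNReal.div_le_of_le_mul ?_
  have hN0 : (N : ℝ≥0∞) ≠ 0 := by exact_mod_cast (by omega : N ≠ 0)
  have hP0 : 0 ≤ x₀ ⬝ᵥ weightP S V *ᵥ x₀ :=
    bil_self_nonneg (posDef_weightP hF hN).posSemidef x₀
  have hUnion : Ioi (0 : ℝ) = ⋃ k, Ioc 0 (S.t k) := by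
    ext t
    simp only [mem_Ioi, mem_iUnion, mem_Ioc]
    exact ⟨fun h => ⟨S.idx t + 1, h, (S.lt_t_idx_succ t).le⟩, fun ⟨_, h, _⟩ => h⟩
  have hmono : Monotone fun k => Ioc 0 (S.t k) := fun k l hkl =>
    Ioc_subset_Ioc_right (S.t_strictMono.monotone hkl)
  have hd : ∀ t, ∑ i, ∑ j ∈ nbhd S.graph i, ENNReal.ofReal (eucl (xh j t - xh i t) ^ 2) =
      ENNReal.ofReal (disagreeRate S (fun i t => x t - xh i t) t) := by
    intro t
    rw [disagreeRate, ENNReal.ofReal_sum_of_nonneg fun i _ =>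
      Finset.sum_nonneg fun j _ => dotProduct_self_nonneg' _]
    refine Finset.sum_congr rfl fun i _ => ?_
    rw [ENNReal.ofReal_sum_of_nonneg fun j _ => dotProduct_self_nonneg' _]
    refine Finset.sum_congr rfl fun j _ => ?_
    rw [eucl_sq, sub_sub_sub_cancel_left, ← neg_sub (xh i t) (xh j t), neg_dotProduct_neg]
  have hp : ∀ t, ∑ i, ENNReal.ofReal (eucl (pert w v i t) ^ 2) =
      ENNReal.ofReal (∑ i, pert w v i t ⬝ᵥ pert w v i t) := by
    intro t
    rw [ENNReal.ofReal_sum_of_nonneg fun i _ => dotProduct_self_nonneg' _]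
    simp only [eucl_sq]
  have hcont : Continuous (disagreeRate S fun i t => x t - xh i t) :=
    continuous_disagreeRate fun i => ht.plant_cont.sub (ht.obs_cont i)
  have hint : ∀ k, ∫⁻ t in Ioc 0 (S.t k),
      ENNReal.ofReal (disagreeRate S (fun i t => x t - xh i t) t) ≤
      ENNReal.ofReal (γ ^ 2) * (N * ENNReal.ofReal (x₀ ⬝ᵥ weightP S V *ᵥ x₀) + pertNormSq w v) := by
    intro k
    have hk0 := S.t_nonneg k
    have hpi : IntegrableOn (fun t => ∑ i, pert w v i t ⬝ᵥ pert w v i t) (Ioc 0 (S.t k)) :=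
      integrable_finsetSum _ fun i _ =>
        (integrableOn_dotProduct_pert hL i).mono_set Ioc_subset_Ioi_self
    have hpn : ∀ t, 0 ≤ ∑ i, pert w v i t ⬝ᵥ pert w v i t :=
      fun t => Finset.sum_nonneg fun i _ => dotProduct_self_nonneg' _
    rw [← ofReal_integral_eq_lintegral_ofReal
      ((hcont.intervalIntegrable (μ := volume) 0 (S.t k)).1)
      (Filter.Eventually.of_forall fun t => disagreeRate_nonneg t),
      ← intervalIntegral.integral_of_le hk0]
    refine (ENNReal.ofReal_le_ofReal (integral_disagreeRate_le hF hN hγ hL ht k)).trans ?_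
    rw [ENNReal.ofReal_mul (by positivity), ENNReal.ofReal_add (by positivity)
      (intervalIntegral.integral_nonneg hk0 fun t _ => hpn t), ENNReal.ofReal_mul (by positivity),
      ENNReal.ofReal_natCast]
    gcongr
    rw [intervalIntegral.integral_of_le hk0, ofReal_integral_eq_lintegral_ofReal hpi
      (Filter.Eventually.of_forall hpn), pertNormSq]
    simp only [hp]
    exact lintegral_mono_set Ioc_subset_Ioi_self
  have hall : ∫⁻ t in Ioi (0 : ℝ), ∑ i, ∑ j ∈ nbhd S.graph i,
      ENNReal.ofReal (eucl (xh j t - xh i t) ^ 2) ≤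
      ENNReal.ofReal (γ ^ 2) * (N * ENNReal.ofReal (x₀ ⬝ᵥ weightP S V *ᵥ x₀) + pertNormSq w v) := by
    simp only [hd]
    rw [hUnion, setLIntegral_iUnion_of_directed _ hmono.directed_le]
    exact iSup_le hint
  rw [disagreement]
  calc (N : ℝ≥0∞)⁻¹ * ∫⁻ t in Ioi (0 : ℝ), ∑ i, ∑ j ∈ nbhd S.graph i,
        ENNReal.ofReal (eucl (xh j t - xh i t) ^ 2)
      ≤ (N : ℝ≥0∞)⁻¹ * (ENNReal.ofReal (γ ^ 2)
        * (N * ENNReal.ofReal (x₀ ⬝ᵥ weightP S V *ᵥ x₀) + pertNormSq w v)) := by gcongr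
    _ = ENNReal.ofReal (γ ^ 2) * (((N : ℝ≥0∞)⁻¹ * N) * ENNReal.ofReal (x₀ ⬝ᵥ weightP S V *ᵥ x₀)
        + (N : ℝ≥0∞)⁻¹ * pertNormSq w v) := by ring
    _ = _ := by rw [ENNReal.inv_mul_cancel hN0 (ENNReal.natCast_ne_top N), one_mul]

end Performance

/-! ### Upper bounds of the functional -/

section UpperBound

variable {N n mw mv : ℕ} {S : Network N n mw mv} {g : Gains S} {γ : ℝ} {V : LMIVars N n}

lemma le_sqRate (e f : Fin N → ℝ → Fin n → ℝ) (i : Fin N) (t : ℝ) :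
    e i t ⬝ᵥ e i t + f i t ⬝ᵥ f i t ≤ sqRate e f t :=
  Finset.single_le_sum (f := fun i => e i t ⬝ᵥ e i t + f i t ⬝ᵥ f i t)
    (fun _ _ => add_nonneg (dotProduct_self_nonneg' _) (dotProduct_self_nonneg' _))
    (Finset.mem_univ i)

/-- The common pattern behind the upper bounds: an integrand dominated by the nonnegative `sqRate`
is integrated over a subinterval and enlarged to the whole window. -/
lemma integral_le_integral_sqRate {e f : Fin N → ℝ → Fin n → ℝ}
    (he : ∀ i, HasL2Deriv (e i) (f i)) {q : ℝ → ℝ} {c h s t : ℝ} (hc : 0 ≤ c) (hs : t - h ≤ s)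
    (hst : s ≤ t) (hq : IntervalIntegrable q volume s t) (hle : ∀ u, q u ≤ c * sqRate e f u) :
    ∫ u in s..t, q u ≤ c * ∫ u in (t - h)..t, sqRate e f u := by
  have hi := fun a b => intervalIntegrable_sqRate he a b
  calc ∫ u in s..t, q u ≤ ∫ u in s..t, c * sqRate e f u :=
        intervalIntegral.integral_mono_on hst hq ((hi s t).const_mul c) fun u _ => hle u
    _ = c * ∫ u in s..t, sqRate e f u := intervalIntegral.integral_const_mul _ _
    _ ≤ c * ∫ u in (t - h)..t, sqRate e f u := by
        refine mul_le_mul_of_nonneg_left ?_ hc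
        rw [← intervalIntegral.integral_add_adjacent_intervals (hi (t - h) s) (hi s t)]
        have := intervalIntegral.integral_nonneg (μ := volume) hs
          fun u _ => sqRate_nonneg (e := e) (f := f) u
        linarith

lemma integral_sqRate_nonneg {e f : Fin N → ℝ → Fin n → ℝ} {h : ℝ} (hh : 0 ≤ h) (t : ℝ) :
    0 ≤ ∫ u in (t - h)..t, sqRate e f u :=
  intervalIntegral.integral_nonneg (by linarith) fun u _ => sqRate_nonneg u

/-- The value of the state is controlled by its square and that of its derivative on a window. -/
lemma dotProduct_self_le_integral {e f : Fin N → ℝ → Fin n → ℝ}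
    (he : ∀ i, HasL2Deriv (e i) (f i)) {h : ℝ} (hh : 0 < h) (i : Fin N) (t : ℝ) :
    e i t ⬝ᵥ e i t ≤ (1 + 1 / h) * ∫ u in (t - h)..t, sqRate e f u := by
  set I := ∫ u in (t - h)..t, sqRate e f u with hI
  have hc := (he i).continuous
  -- |e(t)|² − |e(r)|² = ∫ 2e·ė ≤ ∫(|e|² + |ė|²); averaging over r in the window then removes
  -- |e(r)|².
  have hpt : ∀ r ∈ Icc (t - h) t, e i t ⬝ᵥ e i t ≤ e i r ⬝ᵥ e i r + I := by
    intro r hr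
    have h1 := (he i).integral_two_bil (M := 1) isHermitian_one r t
    have h2 := integral_le_integral_sqRate he (q := fun u => 2 * bil 1 (e i u) (f i u)) zero_le_one
      hr.1 hr.2 (((he i).intervalIntegrable_bil_continuous 1 hc.continuousOn).const_mul 2)
      fun u => by
        rw [bil_one, one_mul]
        exact (two_mul_dotProduct_le _ _).trans (le_sqRate e f i u)
    rw [h1, bil_one, bil_one, one_mul] at h2
    linarith
  have hcont : Continuous fun r => e i r ⬝ᵥ e i r := continuous_dotProduct' hc hc
  have hint := intervalIntegral.integral_mono_on (μ := volume) (by linarith : t - h ≤ t)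
    intervalIntegrable_const ((hcont.intervalIntegrable _ _).add intervalIntegrable_const) hpt
  rw [intervalIntegral.integral_add (hcont.intervalIntegrable _ _) intervalIntegrable_const,
    intervalIntegral.integral_const, intervalIntegral.integral_const, sub_sub_cancel, smul_eq_mul,
    smul_eq_mul] at hint
  have h3 := integral_le_integral_sqRate he (q := fun u => e i u ⬝ᵥ e i u) zero_le_one
    le_rfl (by linarith : t - h ≤ t) (hcont.intervalIntegrable _ _) fun u => by
      have := le_sqRate e f i u
      have := dotProduct_self_nonneg' (f i u)
      linarith
  rw [one_mul, ← hI] at h3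
  have h4 : e i t ⬝ᵥ e i t * h ≤ ((1 + 1 / h) * I) * h := by
    have : ((1 + 1 / h) * I) * h = I + h * I := by field_simp; ring
    linarith
  exact le_of_mul_le_mul_right h4 hh

lemma bil_self_le_of_le {M : Matrix (Fin n) (Fin n) ℝ} {c : ℝ} (hc : 0 ≤ c)
    (hM : ∀ u, bil M u u ≤ c * (u ⬝ᵥ u)) {u : Fin n → ℝ} {r : ℝ} (hu : u ⬝ᵥ u ≤ r) :
    bil M u u ≤ c * r := (hM u).trans (mul_le_mul_of_nonneg_left hu hc)

lemma exists_nodeFun_le {ε : ℝ} (hF : Feasible S g γ V ε) {h : ℝ} (hh : 0 < h)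
    (i : Fin N) (hτh : S.τ i ≤ h) :
    ∃ C : ℝ, 0 ≤ C ∧ ∀ e f : Fin N → ℝ → Fin n → ℝ, (∀ i, HasL2Deriv (e i) (f i)) →
      ∀ t, nodeFun S V e f i t ≤ C * ∫ u in (t - h)..t, sqRate e f u := by
  obtain ⟨cY, hcY, hY⟩ := exists_bil_self_le (V.Y i)⁻¹
  obtain ⟨cS, hcS, hS⟩ := exists_bil_self_le (V.S i)
  obtain ⟨cR, hcR, hR⟩ := exists_bil_self_le (V.R i)
  have hτ0 := S.τ_nonneg i hF.bdd
  have hw1 : wt S V i ≤ 1 := by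
    refine Real.exp_le_one_iff.2 ?_
    nlinarith [hF.posα i]
  have hw0 := wt_pos S V i
  refine ⟨cY * (1 + 1 / h) + cS + S.τ i * (S.τ i * cR), by positivity, fun e f he t => ?_⟩
  have hI := integral_sqRate_nonneg (e := e) (f := f) hh.le t
  set I := ∫ u in (t - h)..t, sqRate e f u
  have hc := (he i).continuous
  have hle : ∀ u, e i u ⬝ᵥ e i u ≤ sqRate e f u := fun u => by
    have := le_sqRate e f i u
    have := dotProduct_self_nonneg' (f i u)
    linarith
  have hlf : ∀ u, f i u ⬝ᵥ f i u ≤ sqRate e f u := fun u => by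
    have := le_sqRate e f i u
    have := dotProduct_self_nonneg' (e i u)
    linarith
  have h1 : bil (V.Y i)⁻¹ (e i t) (e i t) ≤ cY * ((1 + 1 / h) * I) :=
    bil_self_le_of_le hcY hY (dotProduct_self_le_integral he hh i t)
  have h2 : ∫ s in (t - S.τ i)..t, bil (V.S i) (e i s) (e i s) ≤ cS * I :=
    integral_le_integral_sqRate he hcS (by linarith) (by linarith)
      ((continuous_bil _ hc hc).intervalIntegrable _ _)
      fun u => bil_self_le_of_le hcS hS (hle u)
  have h3 : energyR V f i t - energyR V f i (t - S.τ i) ≤ cR * I := by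
    rw [energyR_sub (he i)]
    exact integral_le_integral_sqRate he hcR (by linarith) (by linarith)
      ((he i).intervalIntegrable_bil (he i) _ _ _) fun u => bil_self_le_of_le hcR hR (hlf u)
  -- The primitive is nondecreasing, so on the window it is at least its value at the left end.
  have h4 : S.τ i * energyR V f i t - ∫ s in (t - S.τ i)..t, energyR V f i s ≤
      S.τ i * (energyR V f i t - energyR V f i (t - S.τ i)) := by
    have := intervalIntegral.integral_mono_on (μ := volume) (by linarith : t - S.τ i ≤ t)
      (intervalIntegrable_const (c := energyR V f i (t - S.τ i)))
      ((continuous_energyR (he i)).intervalIntegrable _ _)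
      fun s hs => energyR_mono (he i) (hF.posR i) hs.1
    rw [intervalIntegral.integral_const, sub_sub_cancel, smul_eq_mul] at this
    linarith
  have h5 : wt S V i * (∫ s in (t - S.τ i)..t, bil (V.S i) (e i s) (e i s)) ≤ cS * I := by
    have h0 : 0 ≤ ∫ s in (t - S.τ i)..t, bil (V.S i) (e i s) (e i s) :=
      intervalIntegral.integral_nonneg (by linarith) fun s _ => bil_self_nonneg (hF.posS i) _
    exact (mul_le_of_le_one_left h0 hw1).trans h2
  have h6 : wt S V i * S.τ i * (S.τ i * energyR V f i t - ∫ s in (t - S.τ i)..t, energyR V f i s) ≤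
      S.τ i * (S.τ i * (cR * I)) := by
    have h7 : S.τ i * energyR V f i t - ∫ s in (t - S.τ i)..t, energyR V f i s ≤
        S.τ i * (cR * I) := h4.trans (mul_le_mul_of_nonneg_left h3 hτ0)
    calc _ ≤ wt S V i * S.τ i * (S.τ i * (cR * I)) := by gcongr
      _ ≤ S.τ i * (S.τ i * (cR * I)) := by
        gcongr
        exact mul_le_of_le_one_left hτ0 hw1
  rw [nodeFun]
  linarith

lemma exists_edgeFun_le {ε : ℝ} (hF : Feasible S g γ V ε) {h : ℝ} (i j : Fin N) :
    ∃ C : ℝ, 0 ≤ C ∧ ∀ e f : Fin N → ℝ → Fin n → ℝ, (∀ i, HasL2Deriv (e i) (f i)) →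
      ∀ s t, t - h ≤ s → s ≤ t →
        edgeFun S V e f i j s t ≤ C * ∫ u in (t - h)..t, sqRate e f u := by
  obtain ⟨cW, hcW, hW⟩ := exists_bil_self_le (V.W j)
  refine ⟨S.τ i ^ 2 * cW, by positivity, fun e f he s t hs hst => ?_⟩
  have h1 : ∫ u in s..t, bil (V.W j) (f j u) (f j u) ≤ cW * ∫ u in (t - h)..t, sqRate e f u :=
    integral_le_integral_sqRate he hcW hs hst ((he j).intervalIntegrable_bil (he j) _ _ _)
      fun u => bil_self_le_of_le hcW hW (by
        have := le_sqRate e f j u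
        have := dotProduct_self_nonneg' (e j u)
        linarith)
  have h2 : 0 ≤ ∫ u in s..t, bil (V.W j) (e j u - e j s) (e j u - e j s) :=
    intervalIntegral.integral_nonneg hst fun u _ => bil_self_nonneg (hF.posW j) _
  have h3 := mul_le_mul_of_nonneg_left h1 (sq_nonneg (S.τ i))
  have h4 := mul_nonneg (by positivity : 0 ≤ Real.pi ^ 2 / 4) h2
  rw [edgeFun]
  linarith

/-- The functional is bounded by the square of the state and of its derivative on a window. -/
lemma exists_lyap_le {ε : ℝ} (hF : Feasible S g γ V ε) {h : ℝ} (hh : 0 < h)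
    (hτh : ∀ i, S.τ i ≤ h) :
    ∃ C : ℝ, 0 < C ∧ ∀ e f : Fin N → ℝ → Fin n → ℝ, (∀ i, HasL2Deriv (e i) (f i)) →
      ∀ k, ∀ t ∈ Icc (S.t k) (S.t (k + 1)),
        lyap S V e f k t ≤ C * ∫ u in (t - h)..t, sqRate e f u := by
  choose A hA hnode using fun i => exists_nodeFun_le hF hh i (hτh i)
  choose B hB hedge using fun i j => exists_edgeFun_le hF (h := h) i j
  refine ⟨∑ i, A i + ∑ i, ∑ j ∈ nbhd S.graph i, B i j + 1, ?_, fun e f he k t ht => ?_⟩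
  · have h1 : 0 ≤ ∑ i, A i := Finset.sum_nonneg fun i _ => hA i
    have h2 : 0 ≤ ∑ i, ∑ j ∈ nbhd S.graph i, B i j :=
      Finset.sum_nonneg fun i _ => Finset.sum_nonneg fun j _ => hB i j
    linarith
  have hI := integral_sqRate_nonneg (e := e) (f := f) hh.le t
  rw [lyap, add_mul, add_mul, Finset.sum_mul, Finset.sum_mul, one_mul]
  refine le_trans ?_ (le_add_of_nonneg_right hI)
  gcongr with i _ i _
  · exact hnode i e f he t
  · rw [Finset.sum_mul]
    gcongr with j hj
    refine hedge i j e f he _ t ?_ ((S.sampleTime_le i k j).trans ht.1)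
    linarith [S.t_succ_sub_τ_le_sampleTime i hF.bdd k hj, ht.2, hτh i]

end UpperBound

/-! ### Exponential decay -/

section Decay

/-- A nonincreasing function that contracts over steps of length `h` decays exponentially. -/
lemma le_exp_of_contraction {v : ℝ → ℝ} {a h ρ : ℝ} (hh : 0 < h) (hρ : 0 < ρ) (hρ1 : ρ < 1)
    (hv : 0 ≤ v a) (hanti : ∀ s t, a ≤ s → s ≤ t → v t ≤ v s)
    (hcontr : ∀ t, a ≤ t → v (t + h) ≤ ρ * v t) {t : ℝ} (ht : a ≤ t) :
    v t ≤ ρ⁻¹ * Real.exp (-(-Real.log ρ / h) * (t - a)) * v a := by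
  have hiter : ∀ m : ℕ, v (a + m * h) ≤ ρ ^ m * v a := by
    intro m
    induction m with
    | zero => simp
    | succ m ih =>
      have h1 := hcontr (a + m * h) (by
        have : 0 ≤ (m : ℝ) * h := by positivity
        linarith)
      have h2 : a + (m + 1 : ℕ) * h = a + m * h + h := by push_cast; ring
      rw [h2, pow_succ']
      calc _ ≤ ρ * v (a + m * h) := h1
        _ ≤ ρ * (ρ ^ m * v a) := by gcongr
        _ = _ := by ring
  -- m full steps fit into [a, t]. The factor ρ⁻¹ pays for the incomplete last step.
  set m := ⌊(t - a) / h⌋₊ with hm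
  have hm1 : (m : ℝ) * h ≤ t - a := by
    have := Nat.floor_le (div_nonneg (sub_nonneg.2 ht) hh.le)
    rwa [← hm, le_div_iff₀ hh] at this
  have hm2 : (t - a) / h ≤ m + 1 := (Nat.lt_floor_add_one ((t - a) / h)).le
  have hlog : Real.log ρ ≤ 0 := Real.log_nonpos hρ.le hρ1.le
  have hexp : ρ ^ m ≤ ρ⁻¹ * Real.exp (-(-Real.log ρ / h) * (t - a)) := by
    rw [inv_mul_eq_div, le_div_iff₀ hρ, ← pow_succ]
    calc ρ ^ (m + 1) = Real.exp ((m + 1) * Real.log ρ) := by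
          rw [← Real.exp_log (pow_pos hρ (m + 1)), Real.log_pow]
          push_cast
          rfl
      _ ≤ _ := by
          rw [Real.exp_le_exp]
          have : -(-Real.log ρ / h) * (t - a) = ((t - a) / h) * Real.log ρ := by ring
          rw [this]
          exact mul_le_mul_of_nonpos_right hm2 hlog
  calc v t ≤ v (a + m * h) := hanti _ _ (by
        have : 0 ≤ (m : ℝ) * h := by positivity
        linarith) (by linarith)
    _ ≤ ρ ^ m * v a := hiter m
    _ ≤ _ := by gcongr

end Decay

/-! ### Exponential stability -/

section Stability

variable {N n mw mv : ℕ} {S : Network N n mw mv} {g : Gains S} {γ : ℝ} {V : LMIVars N n}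

/-- The right-hand side of the unperturbed dynamics is bounded by the values of the error. -/
lemma exists_errorField_le (S : Network N n mw mv) (g : Gains S) :
    ∃ c : ℝ, 0 < c ∧ ∀ (e : Fin N → ℝ → Fin n → ℝ) (i : Fin N) (k : ℕ) (t B : ℝ), 0 ≤ B →
      ‖e i t‖ ≤ B →
      (∀ j, ∀ l ∈ nbhd S.graph i, ‖e j (S.sampleTime i k l)‖ ≤ B) →
      ‖errorField g 0 e i k t‖ ≤ c * B := by
  choose a ha hA using fun i => exists_norm_mulVec_le (S.A - g.L i * S.C i)
  choose b hb hB using fun i => exists_norm_mulVec_le (g.K i * S.H i)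
  have hc : ∀ i, 0 ≤ a i + b i * ((nbhd S.graph i).card * 2) :=
    fun i => add_nonneg (ha i) (mul_nonneg (hb i) (by positivity))
  refine ⟨∑ i, (a i + b i * ((nbhd S.graph i).card * 2)) + 1,
    add_pos_of_nonneg_of_pos (Finset.sum_nonneg fun i _ => hc i) one_pos,
    fun e i k t B hB0 he hs => ?_⟩
  have hsum : ‖∑ j ∈ nbhd S.graph i, (e j (S.sampleTime i k j) - e i (S.sampleTime i k j))‖ ≤
      (nbhd S.graph i).card * (2 * B) := by
    rw [← nsmul_eq_mul]
    refine norm_sum_le_of_le _ (fun j hj => ?_) |>.trans_eq (Finset.sum_const (2 * B))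
    refine (norm_sub_le _ _).trans ?_
    linarith [hs j j hj, hs i j hj]
  have h1 : ‖errorField g 0 e i k t‖ ≤ (a i + b i * ((nbhd S.graph i).card * 2)) * B := by
    rw [errorField, coupling, Pi.zero_apply, Pi.zero_apply, mulVec_zero, add_zero]
    refine (norm_add_le _ _).trans ?_
    have h2 := (hA i (e i t)).trans (mul_le_mul_of_nonneg_left he (ha i))
    have h3 := (hB i _).trans (mul_le_mul_of_nonneg_left hsum (hb i))
    linarith
  refine h1.trans (mul_le_mul_of_nonneg_right ?_ hB0)
  have := Finset.single_le_sum (fun i _ => hc i) (Finset.mem_univ i)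
  linarith

/-- The increment of an absolutely continuous function whose derivative is bounded by an
exponential. -/
lemma HasL2Deriv.norm_sub_le_exp {z f : ℝ → Fin n → ℝ} (h : HasL2Deriv z f) {a b c B : ℝ}
    (hab : a ≤ b) (hB : 0 ≤ B)
    (hf : ∀ t ∈ Icc a b, ‖f t‖ ≤ c * (B * Real.exp (2 * c * (t - a)))) :
    ‖z b - z a‖ ≤ B / 2 * Real.exp (2 * c * (b - a)) := by
  have hder : ∀ t ∈ uIcc a b, HasDerivAt (fun t => B / 2 * Real.exp (2 * c * (t - a)))
      (c * (B * Real.exp (2 * c * (t - a)))) t := by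
    intro t _
    have h1 : HasDerivAt (fun t => 2 * c * (t - a)) (2 * c) t := by
      simpa using ((hasDerivAt_id t).sub_const a).const_mul (2 * c)
    refine (h1.exp.const_mul (B / 2)).congr_deriv ?_
    ring
  have hcont : Continuous fun t => c * (B * Real.exp (2 * c * (t - a))) := by fun_prop
  have hint := intervalIntegral.integral_eq_sub_of_hasDerivAt hder (hcont.intervalIntegrable a b)
  refine (pi_norm_le_iff_of_nonneg (by positivity)).2 fun d => ?_
  rw [Pi.sub_apply, h.sub_eq a b d]
  refine (intervalIntegral.norm_integral_le_of_norm_le hab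
    (Filter.Eventually.of_forall fun t ht => ?_) (hcont.intervalIntegrable a b)).trans ?_
  · exact (norm_le_pi_norm (f t) d).trans (hf t (Ioc_subset_Icc_self ht))
  · rw [hint, sub_self, mul_zero, Real.exp_zero]
    linarith

/-- Growth of the unperturbed error over a bounded time. -/
lemma IsErrorTrajectory.growth (hN : 1 ≤ N) (hτ : ∀ i, BddAbove (Set.range (S.pollGap i)))
    {c : ℝ} (hc : 0 < c)
    (hfield : ∀ (e : Fin N → ℝ → Fin n → ℝ) (i : Fin N) (k : ℕ) (t B : ℝ), 0 ≤ B →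
      ‖e i t‖ ≤ B → (∀ j, ∀ l ∈ nbhd S.graph i, ‖e j (S.sampleTime i k l)‖ ≤ B) →
      ‖errorField g 0 e i k t‖ ≤ c * B)
    {s₀ : ℝ} (hs₀ : 0 ≤ s₀) {e : Fin N → ℝ → Fin n → ℝ} (he : IsErrorTrajectory S g s₀ 0 e)
    {β : ℝ} (hβ : ∀ i, ∀ s ∈ Icc (s₀ - S.τmax) s₀, ‖e i s‖ ≤ β) {D : ℝ} (hD : 0 ≤ D)
    (i : Fin N) {t : ℝ} (ht : t ≤ s₀ + D) :
    ‖frozen e s₀ i t‖ ≤ 2 * β * Real.exp (2 * c * D) ∧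
      ‖frozenDeriv g 0 e s₀ i t‖ ≤ c * (2 * β * Real.exp (2 * c * D)) := by
  have hτ0 : 0 ≤ S.τmax := (S.τ_nonneg ⟨0, hN⟩ hτ).trans (S.τ_le_τmax _)
  have hs₀mem : s₀ ∈ Icc (s₀ - S.τmax) s₀ := ⟨by linarith, le_rfl⟩
  have hβ0 : 0 ≤ β := (norm_nonneg _).trans (hβ i s₀ hs₀mem)
  have hξ : ∀ (i : Fin N) (c : Fin mw ⊕ Fin mv), MemLp
      (fun t => (0 : Fin N → ℝ → Fin mw ⊕ Fin mv → ℝ) i t c) 2 (volume.restrict (Ici s₀)) :=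
    fun _ _ => MemLp.zero
  have hd := he.hasL2Deriv hs₀ hξ
  set z : ℝ → Fin N → Fin n → ℝ := fun t i => frozen e s₀ i t with hz
  have hzc : Continuous z := continuous_pi fun i => (hd i).continuous
  -- Gronwall by a weighted sup norm. The exponent 2c is chosen so that integrating the bound
  -- c·B·e^{2c(t−s₀)} produces the factor 1/2.
  have hψ : Continuous fun t => Real.exp (-(2 * c * (t - s₀))) * ‖z t‖ := by fun_prop
  obtain ⟨t₁, ht₁, hmax⟩ := (isCompact_Icc (a := s₀) (b := s₀ + D)).exists_isMaxOn
    ⟨s₀, le_rfl, by linarith⟩ hψ.continuousOn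
  set μ := Real.exp (-(2 * c * (t₁ - s₀))) * ‖z t₁‖ with hμ
  have hμ0 : 0 ≤ μ := by positivity
  have hzle : ∀ s ∈ Icc s₀ (s₀ + D), ∀ j, ‖e j s‖ ≤ μ * Real.exp (2 * c * (s - s₀)) := by
    intro s hs j
    have h1 : Real.exp (-(2 * c * (s - s₀))) * ‖z s‖ ≤ μ := hmax hs
    have h2 : ‖e j s‖ ≤ ‖z s‖ := by
      rw [← frozen_of_le (e := e) hs.1]
      exact norm_le_pi_norm (z s) j
    rw [Real.exp_neg, inv_mul_le_iff₀ (Real.exp_pos _)] at h1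
    linarith
  set B := max β μ with hB
  have hB0 : 0 ≤ B := hβ0.trans (le_max_left _ _)
  have hfb : ∀ j, ∀ s ∈ Icc s₀ (s₀ + D),
      ‖frozenDeriv g 0 e s₀ j s‖ ≤ c * (B * Real.exp (2 * c * (s - s₀))) := by
    intro j s hs
    have hsm : s ∈ Ici s₀ := hs.1
    have hone : 1 ≤ Real.exp (2 * c * (s - s₀)) :=
      Real.one_le_exp (mul_nonneg (by positivity) (sub_nonneg.2 hs.1))
    rw [frozenDeriv, indicator_of_mem hsm]
    refine hfield e j _ s _ (by positivity) ?_ fun j' l hl => ?_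
    · exact (hzle s hs j).trans (mul_le_mul_of_nonneg_right (le_max_right _ _) (by positivity))
    · have hidx := S.mem_Ico_idx (hs₀.trans hs.1)
      have h1 := S.sampleTime_le j (S.idx s) l
      have h2 := S.t_succ_sub_τ_le_sampleTime j hτ (S.idx s) hl
      have h3 := S.τ_le_τmax j
      -- A sample taken after s₀ is bounded by the weighted maximum; an earlier one lies in [s₀ − τ,
      -- s₀], where the history is bounded by β.
      rcases le_total s₀ (S.sampleTime j (S.idx s) l) with h | h
      · refine (hzle _ ⟨h, by linarith [hidx.1, hs.2]⟩ j').trans ?_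
        gcongr
        · exact le_max_right _ _
        · linarith [hidx.1]
      · refine (hβ j' _ ⟨by linarith [hidx.2, hs.1], h⟩).trans ?_
        exact (le_max_left β μ).trans (le_mul_of_one_le_right hB0 hone)
  -- With B = max(β, μ) this yields B ≤ 2β: the half of B is absorbed whenever μ is the larger one.
  have hμle : μ ≤ β + B / 2 := by
    have h1 : ‖z t₁‖ ≤ β + B / 2 * Real.exp (2 * c * (t₁ - s₀)) := by
      refine (pi_norm_le_iff_of_nonneg (by positivity)).2 fun j => ?_
      have h2 := (hd j).norm_sub_le_exp ht₁.1 hB0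
        fun s hs => hfb j s ⟨hs.1, hs.2.trans ht₁.2⟩
      have h3 : ‖frozen e s₀ j s₀‖ ≤ β := by
        rw [frozen_of_le le_rfl]
        exact hβ j s₀ hs₀mem
      have h4 := norm_le_norm_add_norm_sub' (frozen e s₀ j t₁) (frozen e s₀ j s₀)
      change ‖frozen e s₀ j t₁‖ ≤ _
      linarith
    have hone : 1 ≤ Real.exp (2 * c * (t₁ - s₀)) :=
      Real.one_le_exp (mul_nonneg (by positivity) (sub_nonneg.2 ht₁.1))
    rw [hμ, Real.exp_neg, inv_mul_le_iff₀ (Real.exp_pos _)]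
    have := le_mul_of_one_le_right hβ0 hone
    linarith
  have hB2 : B ≤ 2 * β := by
    rcases max_cases β μ with ⟨h, _⟩ | ⟨h, _⟩
    · rw [hB, h]; linarith
    · rw [← hB] at h
      linarith
  have hexpD : 1 ≤ Real.exp (2 * c * D) := Real.one_le_exp (by positivity)
  rcases le_or_gt s₀ t with hst | hst
  · have hmem : t ∈ Icc s₀ (s₀ + D) := ⟨hst, ht⟩
    have hexp : Real.exp (2 * c * (t - s₀)) ≤ Real.exp (2 * c * D) := by
      gcongr
      linarith
    have hle : B * Real.exp (2 * c * (t - s₀)) ≤ 2 * β * Real.exp (2 * c * D) := by gcongr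
    constructor
    · rw [frozen_of_le hst]
      refine (hzle t hmem i).trans (le_trans ?_ hle)
      exact mul_le_mul_of_nonneg_right (le_max_right _ _) (by positivity)
    · exact (hfb i t hmem).trans (mul_le_mul_of_nonneg_left hle hc.le)
  · constructor
    · rw [frozen, max_eq_right hst.le]
      refine (hβ i s₀ hs₀mem).trans ?_
      have := le_mul_of_one_le_right hβ0 hexpD
      linarith
    · rw [frozenDeriv, indicator_of_notMem (by simpa using hst), norm_zero]
      positivity

lemma sqRate_le {e f : Fin N → ℝ → Fin n → ℝ} {t B c : ℝ}
    (he : ∀ i, ‖e i t‖ ≤ B) (hf : ∀ i, ‖f i t‖ ≤ c * B) :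
    sqRate e f t ≤ N * (n * (1 + c ^ 2)) * B ^ 2 := by
  have h : ∀ i ∈ (Finset.univ : Finset (Fin N)), e i t ⬝ᵥ e i t + f i t ⬝ᵥ f i t ≤
      n * (1 + c ^ 2) * B ^ 2 := by
    intro i _
    have h1 := dotProduct_self_le_card_mul (e i t)
    have h2 := dotProduct_self_le_card_mul (f i t)
    have h3 : ‖e i t‖ ^ 2 ≤ B ^ 2 := by gcongr; exact he i
    have h4 : ‖f i t‖ ^ 2 ≤ (c * B) ^ 2 := by gcongr; exact hf i
    rw [Fintype.card_fin] at h1 h2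
    have h5 := mul_le_mul_of_nonneg_left h3 (Nat.cast_nonneg' (α := ℝ) n)
    have h6 := mul_le_mul_of_nonneg_left h4 (Nat.cast_nonneg' (α := ℝ) n)
    calc _ ≤ n * B ^ 2 + n * (c * B) ^ 2 := by linarith
      _ = _ := by ring
  refine (Finset.sum_le_card_nsmul _ _ _ h).trans_eq ?_
  rw [nsmul_eq_mul, Finset.card_univ, Fintype.card_fin]
  ring

/-- Finitely many coercivity constants have a positive minimum, which gives one ε for all Ξ_i and
one δ for all Y_i⁻¹. -/
lemma exists_coercive_family {ι : Type} [Finite ι] {κ : ι → Type} [∀ i, Fintype (κ i)]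
    {M : ∀ i, Matrix (κ i) (κ i) ℝ} (hM : ∀ i, (M i).PosDef) :
    ∃ ε : ℝ, 0 < ε ∧ ∀ i v, ε * (v ⬝ᵥ v) ≤ bil (M i) v v := by
  choose ε hε h using fun i => exists_coercive (hM i)
  obtain ⟨δ, hδ, hle⟩ : ∃ δ : ℝ, 0 < δ ∧ ∀ i, δ ≤ ε i := by
    rcases isEmpty_or_nonempty ι with _ | _
    · exact ⟨1, one_pos, fun i => isEmptyElim i⟩
    · obtain ⟨i, hi⟩ := Finite.exists_min ε
      exact ⟨ε i, hε i, hi⟩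
  exact ⟨δ, hδ, fun i v =>
    (mul_le_mul_of_nonneg_right (hle i) (dotProduct_self_nonneg' v)).trans (h i v)⟩

/-- Decay of the functional along the unperturbed dynamics. -/
lemma exists_lyap_decay {ε : ℝ} (hF : Feasible S g γ V ε) {h : ℝ} (hh : 0 < h)
    (hτh : ∀ i, S.τ i ≤ h) :
    ∃ K > (0 : ℝ), ∃ κ > (0 : ℝ), ∀ (a₀ : ℝ), 0 ≤ a₀ → ∀ e f : Fin N → ℝ → Fin n → ℝ,
      IsMotion S g a₀ 0 e f → ∀ t, a₀ ≤ t →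
      lyap S V e f (S.idx t) t ≤
        K * Real.exp (-κ * (t - a₀)) * ∫ u in (a₀ - h)..a₀, sqRate e f u := by
  obtain ⟨C, hC, hup⟩ := exists_lyap_le hF hh hτh
  have hε := hF.posε
  -- The contraction factor: V(t + h) ≤ V(t) − ε∫ and V(t + h) ≤ C∫, with the same integral over [t,
  -- t + h], give (ε + C)V(t + h) ≤ C V(t).
  have hρ0 : 0 < C / (ε + C) := by positivity
  have hρ1 : C / (ε + C) < 1 := by
    rw [div_lt_one (by positivity)]
    linarith
  refine ⟨(C / (ε + C))⁻¹ * C, by positivity, -Real.log (C / (ε + C)) / h,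
    div_pos (neg_pos.2 (Real.log_neg hρ0 hρ1)) hh, fun a₀ ha₀ e f hm t ht => ?_⟩
  have hmem : ∀ s, a₀ ≤ s → s ∈ Icc (S.t (S.idx s)) (S.t (S.idx s + 1)) :=
    fun s hs => Ico_subset_Icc_self (S.mem_Ico_idx (ha₀.trans hs))
  have hξ : ∀ (i : Fin N) (a b : ℝ), a₀ ≤ a → a ≤ b → IntervalIntegrable
      (fun t => (0 : Fin N → ℝ → Fin mw ⊕ Fin mv → ℝ) i t ⬝ᵥ
        (0 : Fin N → ℝ → Fin mw ⊕ Fin mv → ℝ) i t) volume a b := by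
    intro i a b _ _
    simp
  have hsup : ∀ s, supplyRate S γ ε 0 e f s ≤ -ε * sqRate e f s := by
    intro s
    have h1 : 0 ≤ 1 / γ ^ 2 * disagreeRate S e s :=
      mul_nonneg (by positivity) (disagreeRate_nonneg s)
    simp only [supplyRate, Pi.zero_apply, dotProduct_zero, Finset.sum_const_zero]
    linarith
  have hdiss : ∀ s r, a₀ ≤ s → s ≤ r → lyap S V e f (S.idx r) r ≤
      lyap S V e f (S.idx s) s - ε * ∫ u in s..r, sqRate e f u := by
    intro s r hs hsr
    have h1 := lyap_le hF hm hξ (S.idx_mono hsr) hs (hmem s hs) hsr (hmem r (hs.trans hsr))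
    have h2 := intervalIntegral.integral_mono_on hsr
      (intervalIntegrable_supplyRate (S := S) (γ := γ) (ε := ε) hm.hasL2Deriv
        fun i => hξ i s r hs hsr)
      ((intervalIntegrable_sqRate hm.hasL2Deriv s r).const_mul (-ε)) fun u _ => hsup u
    rw [intervalIntegral.integral_const_mul] at h2
    linarith
  have hnn : ∀ s, a₀ ≤ s → 0 ≤ lyap S V e f (S.idx s) s := fun s hs =>
    (Finset.sum_nonneg fun i _ => bil_self_nonneg (hF.posY i).inv.posSemidef _).trans
      (sum_bil_le_lyap hm.hasL2Deriv hF.posS hF.posR hF.posW hF.bdd (hmem s hs))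
  have hdecay := le_exp_of_contraction (v := fun s => lyap S V e f (S.idx s) s) hh hρ0 hρ1
    (hnn a₀ le_rfl)
    (fun s r hs hsr => by
      have h1 := hdiss s r hs hsr
      have h2 := intervalIntegral.integral_nonneg (μ := volume) hsr
        fun u _ => sqRate_nonneg (e := e) (f := f) u
      have := mul_nonneg hε.le h2
      linarith)
    (fun s hs => by
      have h1 := hdiss s (s + h) hs (by linarith)
      have h2 := hup e f hm.hasL2Deriv _ _ (hmem (s + h) (by linarith))
      rw [add_sub_cancel_right] at h2
      rw [div_mul_eq_mul_div, le_div_iff₀ (by positivity)]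
      have h3 := mul_le_mul_of_nonneg_left h2 hε.le
      have h4 := mul_le_mul_of_nonneg_left h1 hC.le
      linarith) ht
  refine hdecay.trans ?_
  have h5 := hup e f hm.hasL2Deriv _ _ (hmem a₀ le_rfl)
  calc _ ≤ (C / (ε + C))⁻¹ * Real.exp (-(-Real.log (C / (ε + C)) / h) * (t - a₀))
        * (C * ∫ u in (a₀ - h)..a₀, sqRate e f u) := by gcongr
    _ = _ := by ring

lemma norm_le_eucl (v : Fin n → ℝ) : ‖v‖ ≤ eucl v := by
  have h := norm_sq_le_dotProduct_self v
  rw [← eucl_sq] at h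
  exact le_of_sq_le_sq h (norm_nonneg _)

lemma eucl_le_of_sq_le {v : Fin n → ℝ} {r : ℝ} (hr : 0 ≤ r) (h : v ⬝ᵥ v ≤ r ^ 2) : eucl v ≤ r := by
  rw [← eucl_sq] at h
  exact le_of_sq_le_sq h hr

/-- The growth bound covers [s₀, s₀ + τ] and also bounds the functional at s₀ + τ, after which it
decays exponentially. The functional dominates δ|e|², so the error decays at half its rate. -/
lemma exponentiallyStable {ε : ℝ} (hF : Feasible S g γ V ε) (hN : 1 ≤ N) :
    ExponentiallyStable S g := by
  have hτ0 : 0 ≤ S.τmax := (S.τ_nonneg ⟨0, hN⟩ hF.bdd).trans (S.τ_le_τmax _)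
  obtain ⟨c, hc, hfield⟩ := exists_errorField_le S g
  -- The window is τ + 1 rather than τ, because it must be positive and all delays vanish when the
  -- graph has no edges.
  obtain ⟨K, hK, κ, hκ, hdecay⟩ := exists_lyap_decay hF (h := S.τmax + 1) (by linarith)
    fun i => (S.τ_le_τmax i).trans (by linarith)
  obtain ⟨δ, hδ, hY⟩ := exists_coercive_family fun i => (hF.posY i).inv
  set E := 2 * Real.exp (2 * c * S.τmax) with hE
  have hE0 : 0 < E := by positivity
  -- The first summand serves times after s₀ + τ. The summand n serves the initial interval, where
  -- only the sup norm is bounded.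
  set Q := K * ((S.τmax + 1) * (N * (n * (1 + c ^ 2)))) / δ + n with hQ
  have hQ0 : 0 ≤ Q := by positivity
  -- The added 1 keeps M positive even if Q = 0, and the last exponential moves the reference time
  -- from s₀ + τ back to s₀.
  refine ⟨(Real.sqrt Q + 1) * E * Real.exp (κ / 2 * S.τmax), by positivity, κ / 2, by positivity,
    fun s₀ hs₀ e he β hβ i t ht => ?_⟩
  have hβ' : ∀ i, ∀ s ∈ Icc (s₀ - S.τmax) s₀, ‖e i s‖ ≤ β :=
    fun i s hs => (norm_le_eucl _).trans (hβ i s hs)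
  have hβ0 : 0 ≤ β := (norm_nonneg _).trans (hβ' i s₀ ⟨by linarith, le_rfl⟩)
  have hgrow := fun (j : Fin N) (s : ℝ) (hs : s ≤ s₀ + S.τmax) =>
    he.growth hN hF.bdd hc hfield hs₀ hβ' hτ0 j hs
  have hE' : 2 * β * Real.exp (2 * c * S.τmax) = E * β := by rw [hE]; ring
  simp only [hE'] at hgrow
  have hsqrt : Q ≤ (Real.sqrt Q + 1) ^ 2 := by
    nlinarith [Real.sq_sqrt hQ0, Real.sqrt_nonneg Q]
  have hexp : Real.exp (κ / 2 * S.τmax) * Real.exp (-(κ / 2) * (t - s₀)) =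
      Real.exp (-(κ / 2) * (t - (s₀ + S.τmax))) := by
    rw [← Real.exp_add]
    congr 1
    ring
  have hgoal : (Real.sqrt Q + 1) * E * Real.exp (κ / 2 * S.τmax)
      * Real.exp (-(κ / 2) * (t - s₀)) * β =
      (Real.sqrt Q + 1) * (E * β) * Real.exp (-(κ / 2) * (t - (s₀ + S.τmax))) := by
    rw [← hexp]; ring
  rw [hgoal]
  refine eucl_le_of_sq_le (by positivity) ?_
  have hsq : Q * (E * β) ^ 2 * Real.exp (-κ * (t - (s₀ + S.τmax))) ≤
      ((Real.sqrt Q + 1) * (E * β) * Real.exp (-(κ / 2) * (t - (s₀ + S.τmax)))) ^ 2 := by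
    have h1 : Real.exp (-(κ / 2) * (t - (s₀ + S.τmax))) ^ 2 =
        Real.exp (-κ * (t - (s₀ + S.τmax))) := by
      rw [← Real.exp_nat_mul]
      congr 1
      push_cast
      ring
    rw [mul_pow _ (Real.exp _), h1, mul_pow _ (E * β)]
    gcongr
  refine le_trans ?_ hsq
  rcases le_total t (s₀ + S.τmax) with hta | hta
  · have h1 := (hgrow i t hta).1
    rw [frozen_of_le ht] at h1
    have h2 : 1 ≤ Real.exp (-κ * (t - (s₀ + S.τmax))) :=
      Real.one_le_exp (by nlinarith)
    have h3 := dotProduct_self_le_card_mul (e i t)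
    rw [Fintype.card_fin] at h3
    have h4 : (n : ℝ) ≤ Q := le_add_of_nonneg_left (by positivity)
    calc e i t ⬝ᵥ e i t ≤ n * ‖e i t‖ ^ 2 := h3
      _ ≤ Q * (E * β) ^ 2 := by gcongr
      _ ≤ _ := le_mul_of_one_le_right (by positivity) h2
  · have hm : IsMotion S g (s₀ + S.τmax) 0 (frozen e s₀) (frozenDeriv g 0 e s₀) :=
      he.isMotion hs₀ (fun _ _ => MemLp.zero) (by linarith) fun j k s hs hk l hl => by
        have h1 := S.t_succ_sub_τ_le_sampleTime j hF.bdd k hl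
        linarith [S.τ_le_τmax j]
    have h1 := hdecay _ (by linarith) _ _ hm t hta
    have h2 := sum_bil_le_lyap hm.hasL2Deriv hF.posS hF.posR hF.posW hF.bdd (V := V)
      (Ico_subset_Icc_self (S.mem_Ico_idx (hs₀.trans ht)))
    have h3 : δ * (e i t ⬝ᵥ e i t) ≤
        ∑ j, bil (V.Y j)⁻¹ (frozen e s₀ j t) (frozen e s₀ j t) := by
      refine le_trans ?_ (Finset.single_le_sum (f := fun j =>
        bil (V.Y j)⁻¹ (frozen e s₀ j t) (frozen e s₀ j t))
        (fun j _ => bil_self_nonneg (hF.posY j).inv.posSemidef _) (Finset.mem_univ i))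
      rw [← frozen_of_le (e := e) ht]
      exact hY i _
    -- The window starts at s₀ − 1, where the frozen error is constant; the growth bound includes
    -- those times.
    have h4 : ∫ u in (s₀ + S.τmax - (S.τmax + 1))..(s₀ + S.τmax),
        sqRate (frozen e s₀) (frozenDeriv g 0 e s₀) u ≤
        (S.τmax + 1) * (N * (n * (1 + c ^ 2)) * (E * β) ^ 2) := by
      have h5 := intervalIntegral.integral_mono_on (μ := volume)
        (by linarith : s₀ + S.τmax - (S.τmax + 1) ≤ s₀ + S.τmax)
        (intervalIntegrable_sqRate hm.hasL2Deriv _ _)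
        (intervalIntegrable_const (c := N * (n * (1 + c ^ 2)) * (E * β) ^ 2))
        fun u hu => sqRate_le (fun j => (hgrow j u hu.2).1) fun j => (hgrow j u hu.2).2
      rwa [intervalIntegral.integral_const, sub_sub_cancel, smul_eq_mul] at h5
    have h6 : δ * (e i t ⬝ᵥ e i t) ≤ K * Real.exp (-κ * (t - (s₀ + S.τmax)))
        * ((S.τmax + 1) * (N * (n * (1 + c ^ 2)) * (E * β) ^ 2)) :=
      (h3.trans (h2.trans h1)).trans (mul_le_mul_of_nonneg_left h4 (by positivity))
    have h7 : e i t ⬝ᵥ e i t ≤ (K * ((S.τmax + 1) * (N * (n * (1 + c ^ 2)))) / δ)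
        * (E * β) ^ 2 * Real.exp (-κ * (t - (s₀ + S.τmax))) := by
      rw [div_mul_eq_mul_div, div_mul_eq_mul_div, le_div_iff₀ hδ]
      linarith
    refine h7.trans ?_
    gcongr
    exact le_add_of_nonneg_right (Nat.cast_nonneg n)

end Stability

end

end RoundRobin

open RoundRobin in
theorem theorem1 {N n mw mv : ℕ} (hN : 1 ≤ N) (S : Network N n mw mv)
    (hτ : ∀ i, BddAbove (Set.range (S.pollGap i)))
    (γ : ℝ) (hγ : 0 < γ) (g : Gains S) (V : LMIVars N n)
    (hY : ∀ i, (V.Y i).PosDef)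
    (hW : ∀ i, (V.W i).PosSemidef)
    (hS : ∀ i, (V.S i).PosSemidef)
    (hR : ∀ i, (V.R i).PosSemidef)
    (hα : ∀ i, 0 < V.α i)
    (hϖ : ∀ i, 0 ≤ V.ϖ i ∧ (S.q i : ℝ) * V.ϖ i < 2 * V.α i)
    (hPark : ∀ i, (Matrix.fromBlocks (V.R i) (V.G i) (V.G i).transpose (V.R i)).PosSemidef)
    (hXi : ∀ i, (-Xi S g γ V i).PosDef) :
    SolvesEstimationProblem S g γ (weightP S V) := by
  obtain ⟨ε, hε, hxi⟩ := exists_coercive_family hXi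
  have hF : Feasible S g γ V ε :=
    ⟨hτ, hY, hW, hS, hR, hα, fun i => (hϖ i).2, hPark, hε, hxi⟩
  exact ⟨posDef_weightP hF hN, exponentiallyStable hF hN, consensusPerformance hF hN hγ⟩
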